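/- **Setting.** Let $\Lambda$ be the $D$-dimensional lattice $N\times\cdots\times N$ ($N\ge1$) with free or periodic boundary conditions and nearest-neighbour edges, with $M=N^D$ sites, one spin with local space $\mathbb C^d$ ($d\ge 1$) per site, and $H=(\mathbb C^d)^{\otimes M}$. Any number $k$ of ancillas $\mathbb C^d$ may be added to each site. Local unitaries ($\mathcal{LU}$) are products $\bigotimes_i u_i$, where the unitary $u_i$ acts on the spin of site $i$ and on its ancillas, if there are any. A *layer* is a product of two-spin unitary gates acting on disjoint pairs of nearest-neighbour spins. * $\mathcal{QC}_\ell$ is the set of products $V_\ell\cdots V_1$ of $\ell$ layers (so $\mathcal{QC}_0=\{1\}$). A depth-$\ell$ circuit *with ancillas* is $U_\ell V_\ell\cdots U_1V_1U_0$ with layers $V_n$ acting on the spins and $U_n\in\mathcal{LU}$ acting on spins and ancillas. * A unit vector $\varphi\in H$ is *prepared by $\mathrm{QCcc}_\ell$* if, for some number of ancillas, some depth-$\ell$ circuit with ancillas applied to $|0\cdots0\rangle$ of spins and ancillas, followed by LOCC, produces $\varphi$ on the spins deterministically. Here LOCC means: the sites are visited once each in some order; at each site its ancillas are measured in an orthonormal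 basis, and then a local unitary is applied; the choices may depend on all previous outcomes (the local unitary also on the present one). For every sequence of outcomes of nonzero probability the final state must be $\varphi\otimes\chi$ for some ancilla state $\chi$, up to normalization. * $\mathcal{QC}\mathrm{cc}_\ell$ is the set of unitaries $U$ on $H$ for which there are a state $\varphi$ prepared by $\mathrm{QCcc}_\ell$ (loaded into one ancilla per site, all further ancillas being in $|0\rangle$), a depth-$\ell$ circuit $V$ with ancillas, an orthonormal basis of the ancilla space of each site, and for every string $\alpha$ of outcomes a $W^\alpha\in\mathcal{LU}$ on the spins, such that for every $\alpha$ there is $c_\alpha\in\mathbb C$ with $$W^{\alpha}\Big(\bigotimes_i\langle\alpha_i|\Big)V\big(|\psi\rangle\otimes|\varphi\rangle\otimes|0\cdots0\rangle\big)=c_\alpha\,U|\psi\rangle\qquad\text{for all }\psi\in H .$$ * For qubits ($d=2$), a unitary $U$ is *Clifford* if for every tensor product $s$ of operators from $\{1,\sigma_x,\sigma_y,\sigma_z\}$, $U^\dagger sU$ is again such a product up to a scalar factor. Put $U_{\rm GHZ}=(1+i\,\sigma_x^{\otimes M})/\sqrt2$. * For $D=2$, $N$ even and periodic boundary conditions,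 let $P_A$ be one of the two colour classes of a chess-board colouring of the elementary square plaquettes, let $X_p=\prod_{i\in p}\sigma_x^{(i)}$ (product over the four vertices of $p$), and let $|{\rm TC}\rangle$ be the normalization of $\prod_{p\in P_A}(1+X_p)|0\cdots0\rangle$. **Statement.** 1. For all $D,N,d,\ell$ and both boundary conditions, $\mathcal{QC}_\ell\subseteq\mathcal{QC}\mathrm{cc}_\ell$. 2. For qubits, all $D,N\ge1$ and both boundary conditions, $U_{\rm GHZ}$ is Clifford and $U_{\rm GHZ}\in\mathcal{QC}\mathrm{cc}_2$. 3. For qubits and $\ell\ge 0$, suppose that either $D\ge2$ and $\ell<N$; or $D=1$ with free boundary conditions and $\ell<N-1$; or $D=1$ with periodic boundary conditions and $\ell<N/2$. Then $U_{\rm GHZ}\notin\mathcal{QC}_\ell$, and the inclusion $\mathcal{QC}_\ell\subsetneq\mathcal{QC}\mathrm{cc}_\ell$ is strict. 4. For qubits, $D=2$, periodic boundary conditions and every even $N\ge2$, there is a Clifford unitary $U_{\rm TC}\in\mathcal{QC}\mathrm{cc}_{16}$ such that $U_{\rm TC}|0\cdots0\rangle=V_0|{\rm TC}\rangle$ for some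 $V_0\in\mathcal{LU}$ on the qubits, and $U_{\rm TC}\notin\mathcal{QC}_\ell$ for all $\ell<N/4$. -/

import Mathlib

open Matrix

/-! ### Lattices -/

/-- The two boundary conditions of the `N × ⋯ × N` lattice. -/
inductive Boundary where
  | free : Boundary
  | periodic : Boundary

/-- The sites of the `D`-dimensional lattice of linear size `N`. -/
abbrev Site (D N : ℕ) : Type := Fin D → Fin N

/-- Nearest-neighbour graph of the lattice. With periodic boundary conditions, coordinates are
added modulo `N` (this is the addition of `Fin N`). -/
def lattice (b : Boundary) (D N : ℕ) [NeZero N] : SimpleGraph (Site D N) :=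
  match b with
  | Boundary.free => SimpleGraph.fromRel fun i j =>
      ∃ k, (j k : ℕ) = (i k : ℕ) + 1 ∧ ∀ m, m ≠ k → j m = i m
  | Boundary.periodic => SimpleGraph.fromRel fun i j => ∃ k, j = i + Pi.single k 1

section Circuits

variable {S : Type} [Fintype S] [DecidableEq S]

/-! ### Operators on a system of spins, one per site -/

/-- The tensor product `⊗ i, u i` of one-site operators on local spaces with basis `κ`; the space
`⊗ i, ℂ^κ` has basis `S → κ`. -/
def tensorOp {κ : Type} (u : S → Matrix κ κ ℂ) : Matrix (S → κ) (S → κ) ℂ :=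
  Matrix.of fun x y => ∏ i, u i (x i) (y i)

/-- Local unitaries `⊗ i, u i`. -/
def LU (S κ : Type) [Fintype S] [Fintype κ] [DecidableEq κ] :
    Set (Matrix (S → κ) (S → κ) ℂ) :=
  {U | ∃ u : S → Matrix κ κ ℂ, (∀ i, u i ∈ Matrix.unitaryGroup κ ℂ) ∧ U = tensorOp u}

/-- The two-site operator `g` acting on the sites `i` and `j`, and trivially elsewhere. -/
def twoSite {d : ℕ} (i j : S) (g : Matrix (Fin d × Fin d) (Fin d × Fin d) ℂ) :
    Matrix (S → Fin d) (S → Fin d) ℂ :=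
  Matrix.of fun x y =>
    if ∀ m, m ≠ i → m ≠ j → x m = y m then g (x i, x j) (y i, y j) else 0

/-- A quantum gate: a two-qudit unitary on an edge of the graph. -/
structure Gate (G : SimpleGraph S) (d : ℕ) where
  fst : S
  snd : S
  adj : G.Adj fst snd
  op : Matrix (Fin d × Fin d) (Fin d × Fin d) ℂ
  unitary : op ∈ Matrix.unitaryGroup (Fin d × Fin d) ℂ

/-- Two gates act on disjoint pairs of sites. -/
def Gate.Apart {G : SimpleGraph S} {d : ℕ} (g h : Gate G d) : Prop :=
  g.fst ≠ h.fst ∧ g.fst ≠ h.snd ∧ g.snd ≠ h.fst ∧ g.snd ≠ h.snd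

/-- A layer: a product of gates acting on disjoint pairs of nearest neighbours. -/
def Layer (G : SimpleGraph S) (d : ℕ) : Set (Matrix (S → Fin d) (S → Fin d) ℂ) :=
  {V | ∃ L : List (Gate G d), L.Pairwise Gate.Apart ∧
    V = (L.map fun g => twoSite g.fst g.snd g.op).prod}

/-- Quantum circuits of depth `ℓ` (without ancillas): products `V_ℓ ⋯ V_2 V_1` of layers. -/
def QC (G : SimpleGraph S) (d : ℕ) : ℕ → Set (Matrix (S → Fin d) (S → Fin d) ℂ)
  | 0 => {1}
  | n + 1 => {W | ∃ V ∈ Layer G d, ∃ W' ∈ QC G d n, W = V * W'}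

/-! ### Ancillas -/

/-- Basis of the local space of one site: one spin and `k` ancillas, all of dimension `d`. -/
abbrev Loc (d k : ℕ) : Type := Fin d × (Fin k → Fin d)

/-- An operator on the spins, acting trivially on the ancillas. -/
def onSpins {d : ℕ} (k : ℕ) (V : Matrix (S → Fin d) (S → Fin d) ℂ) :
    Matrix (S → Loc d k) (S → Loc d k) ℂ :=
  Matrix.of fun x y =>
    if ∀ i, (x i).2 = (y i).2 then V (fun i => (x i).1) (fun i => (y i).1) else 0

/-- Depth-`ℓ` circuits with ancillas: `U_ℓ V_ℓ ⋯ U_2 V_2 U_1 V_1 U_0`, with layers `V_n` of gates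
on the spins, and local unitaries `U_n` that act on the spin and all the ancillas of a site. -/
def QCAnc (G : SimpleGraph S) (d k : ℕ) : ℕ → Set (Matrix (S → Loc d k) (S → Loc d k) ℂ)
  | 0 => LU S (Loc d k)
  | n + 1 => {W | ∃ U ∈ LU S (Loc d k), ∃ V ∈ Layer G d, ∃ W' ∈ QCAnc G d k n,
      W = U * (onSpins k V * W')}

/-- The product state `ψ ⊗ χ` of the spins and the ancillas. -/
def withAnc {d k : ℕ} (ψ : (S → Fin d) → ℂ) (χ : (S → Fin k → Fin d) → ℂ) :
    (S → Loc d k) → ℂ :=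
  fun x => ψ (fun i => (x i).1) * χ (fun i => (x i).2)

/-- The product state `|0…0⟩` of the spins. -/
def zeroSpins (S : Type) [Fintype S] [DecidableEq S] (d : ℕ) [NeZero d] : (S → Fin d) → ℂ :=
  fun x => if ∀ i, x i = 0 then 1 else 0

/-- The product state `|0…0⟩` of `k` ancillas per site. -/
def zeroAnc (S : Type) [Fintype S] [DecidableEq S] (d k : ℕ) [NeZero d] :
    (S → Fin k → Fin d) → ℂ :=
  fun a => if ∀ i j, a i j = 0 then 1 else 0

/-- The ancilla state in which the first ancilla of each site carries the many-body state `φ`,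
and the remaining `k` ancillas of each site are in the state `|0⟩`. -/
def loadAnc {d : ℕ} [NeZero d] (k : ℕ) (φ : (S → Fin d) → ℂ) : (S → Fin (k + 1) → Fin d) → ℂ :=
  fun a => φ (fun i => a i 0) * if ∀ i, ∀ j : Fin k, a i j.succ = 0 then 1 else 0

/-! ### Preparation of states by circuits and LOCC -/

/-- The (unnormalized) state after a measurement of the ancillas of the site `i` with outcome the
unit vector `v`: the projection `|v⟩⟨v|` is applied to these ancillas. -/
def collapse {d k : ℕ} (i : S) (v : (Fin k → Fin d) → ℂ) (Ψ : (S → Loc d k) → ℂ) :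
    (S → Loc d k) → ℂ :=
  fun x => v (x i).2 * ∑ a, star (v a) * Ψ (Function.update x i ((x i).1, a))

/-- From `Ψ`, the state `φ` of the spins is obtained deterministically by measuring one after
the other the ancillas of the sites in the list, each in some orthonormal basis (the columns of
the unitary `B`), every measurement being followed by a local unitary. All choices may depend on
the previous outcomes. An outcome of probability zero leaves the vector `0`, and then nothing is
required; for all others, the final state is `φ ⊗ χ` up to normalization. -/
def LOCCTo {d k : ℕ} (φ : (S → Fin d) → ℂ) : List S → ((S → Loc d k) → ℂ) → Prop
  | [], Ψ => ∃ χ, Ψ = withAnc φ χ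
  | i :: L, Ψ => ∃ B ∈ Matrix.unitaryGroup (Fin k → Fin d) ℂ,
      ∃ W : (Fin k → Fin d) → Matrix (S → Loc d k) (S → Loc d k) ℂ,
        (∀ α, W α ∈ LU S (Loc d k)) ∧
          ∀ α, LOCCTo φ L (W α *ᵥ collapse i (fun a => B a α) Ψ)

/-- The normalized state `φ` can be prepared from `|0…0⟩` by a circuit of depth `ℓ` with ancillas,
followed by LOCC with one measurement per site, in some order of the sites. -/
def PreparedByQCcc (G : SimpleGraph S) (d : ℕ) [NeZero d] (ℓ : ℕ) (φ : (S → Fin d) → ℂ) : Prop :=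
  ∑ x, ‖φ x‖ ^ 2 = 1 ∧
    ∃ k, ∃ V ∈ QCAnc G d k ℓ, ∃ L : List S, L.Nodup ∧ (∀ i, i ∈ L) ∧
      LOCCTo φ L (V *ᵥ withAnc (zeroSpins S d) (zeroAnc S d k))

/-! ### Unitary operations by circuits and LOCC -/

/-- The vector `(⊗ i, ⟨α i|) Ψ` of the spins, where `|α i⟩` is the column `α i` of `B i`. -/
def braAnc {d k : ℕ} (B : S → Matrix (Fin k → Fin d) (Fin k → Fin d) ℂ)
    (α : S → Fin k → Fin d) (Ψ : (S → Loc d k) → ℂ) : (S → Fin d) → ℂ :=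
  fun x => ∑ a : S → Fin k → Fin d, (∏ i, star (B i (a i) (α i))) * Ψ (fun i => (x i, a i))

/-- LOCC-assisted circuits of depth `ℓ`: the unitaries `U` for which there are a state `φ` of the
ancillas prepared with depth `ℓ`, a circuit `V` of depth `ℓ` with ancillas, local orthonormal
bases for the ancillas and local unitaries `W α` such that, for every outcome `α`,
`W α (⊗ i, ⟨α i|) V (ψ ⊗ φ)` is a multiple of `U ψ` for all input states `ψ` of the spins. -/
def QCcc (G : SimpleGraph S) (d : ℕ) [NeZero d] (ℓ : ℕ) :
    Set (Matrix (S → Fin d) (S → Fin d) ℂ) :=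
  {U | U ∈ Matrix.unitaryGroup (S → Fin d) ℂ ∧
    ∃ φ : (S → Fin d) → ℂ, PreparedByQCcc G d ℓ φ ∧
      ∃ k, ∃ V ∈ QCAnc G d (k + 1) ℓ,
        ∃ B : S → Matrix (Fin (k + 1) → Fin d) (Fin (k + 1) → Fin d) ℂ,
          (∀ i, B i ∈ Matrix.unitaryGroup (Fin (k + 1) → Fin d) ℂ) ∧
          ∃ W : (S → Fin (k + 1) → Fin d) → Matrix (S → Fin d) (S → Fin d) ℂ,
            (∀ α, W α ∈ LU S (Fin d)) ∧
            ∀ α, ∃ c : ℂ, ∀ ψ : (S → Fin d) → ℂ,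
              W α *ᵥ braAnc B α (V *ᵥ withAnc ψ (loadAnc k φ)) = c • (U *ᵥ ψ)}

/-! ### Qubits: Pauli strings and Clifford operators -/

/-- The identity and the Pauli matrices `σx`, `σy`, `σz`. -/
noncomputable def pauli : Fin 4 → Matrix (Fin 2) (Fin 2) ℂ :=
  ![1, !![0, 1; 1, 0], !![0, -Complex.I; Complex.I, 0], !![1, 0; 0, -1]]

/-- Tensor products of Pauli operators. -/
noncomputable def pauliString (s : S → Fin 4) : Matrix (S → Fin 2) (S → Fin 2) ℂ :=
  tensorOp fun i => pauli (s i)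

/-- Clifford operators: unitaries mapping Pauli strings to Pauli strings, up to a factor. -/
def IsClifford (U : Matrix (S → Fin 2) (S → Fin 2) ℂ) : Prop :=
  U ∈ Matrix.unitaryGroup (S → Fin 2) ℂ ∧
    ∀ s : S → Fin 4, ∃ s' : S → Fin 4, ∃ c : ℂ,
      Uᴴ * pauliString s * U = c • pauliString s'

/-- The unitary `(1 + i σx ⊗ ⋯ ⊗ σx) / √2`. -/
noncomputable def UGHZ (S : Type) [Fintype S] [DecidableEq S] :
    Matrix (S → Fin 2) (S → Fin 2) ℂ :=
  ((Real.sqrt 2 : ℝ) : ℂ)⁻¹ • (1 + Complex.I • pauliString fun _ : S => 1)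

end Circuits

/-! ### The toric-code state -/

/-- The vertices of the plaquette with upper-left corner `v`, on the periodic square lattice. -/
def plaquette {N : ℕ} [NeZero N] (v : Site 2 N) : Finset (Site 2 N) :=
  {v, v + Pi.single 0 1, v + Pi.single 1 1, v + Pi.single 0 1 + Pi.single 1 1}

/-- The (upper-left corners of the) plaquettes of type A: one colour of the chess board. -/
def plaquettesA (N : ℕ) [NeZero N] : Finset (Site 2 N) :=
  Finset.univ.filter fun v => Even ((v 0 : ℕ) + (v 1 : ℕ))

/-- `X_p`: the product of `σx` over the vertices of the plaquette. -/
noncomputable def plaquetteX {N : ℕ} [NeZero N] (v : Site 2 N) :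
    Matrix (Site 2 N → Fin 2) (Site 2 N → Fin 2) ℂ :=
  pauliString fun i => if i ∈ plaquette v then 1 else 0

/-- The vector `∏ p, (1 + X_p) |0…0⟩`, over the plaquettes of type A (the factors commute, so the
order of the product does not matter). -/
noncomputable def toricVec (N : ℕ) [NeZero N] : (Site 2 N → Fin 2) → ℂ :=
  ((plaquettesA N).toList.map fun p => 1 + plaquetteX p).prod *ᵥ zeroSpins (Site 2 N) 2

/-- The toric-code state: the normalization of `toricVec`. -/
noncomputable def toricCode (N : ℕ) [NeZero N] : (Site 2 N → Fin 2) → ℂ :=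
  ((Real.sqrt (∑ x, ‖toricVec N x‖ ^ 2) : ℝ) : ℂ)⁻¹ • toricVec N

/-! Write X^a for the product of bit flips on the support of a binary configuration a, and Z^β for
the diagonal operator with signs (-1)^(β·x). The GHZ unitary and the toric-code unitary both have
the form `convOp φ` = Σ_a φ(a) X^a, so that U|0…0⟩ = φ. Suppose that multiplying φ by any character
β gives a multiple of a translate of φ by some γ (`IsQuadratic`). Then U is Clifford if unitary,
because U commutes with all X^a and U†Z^βU = c X^γ Z^β (`convOp_isClifford`). The same property lets
U be implemented from the resource state φ (`convOp_mem_QCcc`): add the ancilla bits to the spins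
and measure the ancillas in the Hadamard basis. The outcome m multiplies φ by the character m, so it
produces a translate of Uψ, and an X string undoes the translation.

The states φ come from linear maps δ over the field with two elements for which x ↦ x + δa is a
shallow CNOT network controlled by ancilla bits a (`Realizes.prepared`). Start with the ancillas in
uniform superposition and measure them in the Hadamard basis. This leaves Σ_a (-1)^(m·a)|δa⟩, which
vanishes unless m = z∘δ for some functional z. In that case Z^z turns it into the uniform
superposition of the range of δ. For GHZ, δ is the boundary map of a Hamiltonian path. Its range is
the even-weight strings, the Hadamard dual of the GHZ state, and the edges of a path split into two
matchings, hence depth 2. For the toric code, δ sums plaquettes and depth 4 is enough. To obtain a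
unitary from a code, choose pivot coordinates on which a codeword is determined by arbitrary values.
Hadamard gates on the remaining sites turn the superposition of codewords into a vector of signs
(-1)^q(z), with q quadratic (`PivotData.hadOff_mulVec_indicator`). These signs serve as the
eigenvalues of U in the Hadamard basis.

The lower bounds are light-cone arguments. For GHZ, U†Z_iU contains X on every site, so the cone of
a site must cover the lattice. For the toric code, U†Z_jU contains X^γ, where γ computes bit j of
the encoding map. A shallow circuit makes γ local, which would force a noncontractible line to be a
codeword, whereas each plaquette meets a crossing line evenly and that line exactly once. Strictness
at depths 0 and 1, below the depth of the GHZ protocol, is witnessed by a global phase and by a GHZ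
unitary on three sites. -/

set_option linter.unusedSectionVars false

/-! ### Local operators, gates and circuits -/

section Operators

variable {S : Type} [Fintype S] [DecidableEq S]

/-! ### Tensor products of one-site operators -/

section LocalUnitaries

variable {κ : Type} [Fintype κ] [DecidableEq κ]

theorem tensorOp_mul (u v : S → Matrix κ κ ℂ) :
    tensorOp u * tensorOp v = tensorOp fun i => u i * v i := by
  ext x y
  simp only [tensorOp, Matrix.mul_apply, Matrix.of_apply, ← Finset.prod_mul_distrib]
  rw [Finset.prod_univ_sum, Fintype.piFinset_univ]

theorem tensorOp_one : tensorOp (fun _ : S => (1 : Matrix κ κ ℂ)) = 1 := by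
  ext x y
  simp only [tensorOp, Matrix.of_apply, Matrix.one_apply]
  rw [Finset.prod_ite_zero]
  simp [funext_iff]

theorem tensorOp_conjTranspose (u : S → Matrix κ κ ℂ) :
    (tensorOp u)ᴴ = tensorOp fun i => (u i)ᴴ := by
  ext x y
  simp [tensorOp, Matrix.conjTranspose_apply]

theorem tensorOp_mem_LU {u : S → Matrix κ κ ℂ} (hu : ∀ i, u i ∈ unitaryGroup κ ℂ) :
    tensorOp u ∈ LU S κ := ⟨u, hu, rfl⟩

theorem one_mem_LU : (1 : Matrix (S → κ) (S → κ) ℂ) ∈ LU S κ :=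
  ⟨fun _ => 1, fun _ => one_mem _, tensorOp_one.symm⟩

theorem mul_mem_LU {U V : Matrix (S → κ) (S → κ) ℂ} (hU : U ∈ LU S κ) (hV : V ∈ LU S κ) :
    U * V ∈ LU S κ := by
  obtain ⟨u, hu, rfl⟩ := hU
  obtain ⟨v, hv, rfl⟩ := hV
  exact ⟨_, fun i => mul_mem (hu i) (hv i), tensorOp_mul u v⟩

theorem LU_subset_unitaryGroup {U : Matrix (S → κ) (S → κ) ℂ} (hU : U ∈ LU S κ) :
    U ∈ unitaryGroup (S → κ) ℂ := by
  obtain ⟨u, hu, rfl⟩ := hU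
  rw [mem_unitaryGroup_iff, star_eq_conjTranspose, tensorOp_conjTranspose, tensorOp_mul]
  have : (fun i => u i * (u i)ᴴ) = fun _ => 1 :=
    funext fun i => by simpa [star_eq_conjTranspose] using mem_unitaryGroup_iff.1 (hu i)
  rw [this, tensorOp_one]

end LocalUnitaries

/-! ### Permutations of the basis -/

section Permutations

variable {κ : Type} [Fintype κ] [DecidableEq κ]

/-- The operator `Ψ ↦ Ψ ∘ F`. -/
def compOp (F : κ → κ) : Matrix κ κ ℂ := Matrix.of fun x y => if y = F x then 1 else 0

theorem compOp_mulVec (F : κ → κ) (Ψ : κ → ℂ) : compOp F *ᵥ Ψ = Ψ ∘ F := by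
  ext x
  simp [compOp, Matrix.mulVec, dotProduct]

theorem compOp_mul (F G : κ → κ) : compOp F * compOp G = compOp (G ∘ F) := by
  ext x y
  simp only [compOp, Matrix.mul_apply, Matrix.of_apply, ite_mul, one_mul, zero_mul,
    Finset.sum_ite_eq', Finset.mem_univ, if_true, Function.comp_apply]

theorem compOp_id : compOp (id : κ → κ) = 1 := by
  ext x y
  simp [compOp, Matrix.one_apply, eq_comm]

theorem compOp_mem_unitaryGroup {F : κ → κ} (hF : Function.Involutive F) :
    compOp F ∈ unitaryGroup κ ℂ := by
  rw [mem_unitaryGroup_iff]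
  have : star (compOp F) = compOp F := by
    ext x y
    simp only [compOp, star_apply, of_apply, apply_ite star, star_one, star_zero]
    exact if_congr (by rw [eq_comm, hF.eq_iff]) rfl rfl
  rw [this, compOp_mul, hF.comp_self, compOp_id]

theorem tensorOp_compOp (F : S → κ → κ) :
    tensorOp (fun i => compOp (F i)) = compOp fun x i => F i (x i) := by
  ext x y
  simp only [tensorOp, compOp, Matrix.of_apply]
  rw [Finset.prod_ite_zero]
  simp [funext_iff]

end Permutations

/-! ### Two-site operators -/

section TwoSite

variable {d : ℕ}

theorem twoSite_one (i j : S) :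
    twoSite (S := S) i j (1 : Matrix (Fin d × Fin d) (Fin d × Fin d) ℂ) = 1 := by
  ext x y
  simp only [twoSite, Matrix.of_apply, Matrix.one_apply, Prod.mk.injEq]
  by_cases h : x = y
  · simp [h]
  · rw [if_neg h]
    split_ifs with h1 h2
    · exact absurd (funext fun m => by
        by_cases hi : m = i
        · rw [hi, h2.1]
        · by_cases hj : m = j
          · rw [hj, h2.2]
          · exact h1 m hi hj) h
    · rfl
    · rfl

theorem twoSite_conjTranspose (i j : S) (g : Matrix (Fin d × Fin d) (Fin d × Fin d) ℂ) :
    (twoSite i j g)ᴴ = twoSite i j gᴴ := by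
  ext x y
  simp only [twoSite, Matrix.of_apply, Matrix.conjTranspose_apply]
  split_ifs with h1 h2 h2
  · rfl
  · exact absurd (fun m hi hj => (h1 m hi hj).symm) h2
  · exact absurd (fun m hi hj => (h2 m hi hj).symm) h1
  · simp

theorem twoSite_mul {i j : S} (hij : i ≠ j) (g h : Matrix (Fin d × Fin d) (Fin d × Fin d) ℂ) :
    twoSite i j g * twoSite i j h = twoSite i j (g * h) := by
  ext x y
  simp only [twoSite, Matrix.mul_apply, Matrix.of_apply]
  split_ifs with hxy
  · symm
    -- Only intermediate configurations that agree with x off i and j contribute; they are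
    -- parametrized by the values at i and j.
    refine Finset.sum_of_injOn
      (fun p : Fin d × Fin d => Function.update (Function.update x i p.1) j p.2) ?_ ?_ ?_ ?_
    · intro p _ q _ hpq
      have h1 := congrFun hpq i
      have h2 := congrFun hpq j
      simp [Function.update_of_ne hij] at h1 h2
      exact Prod.ext h1 h2
    · simp [Set.MapsTo]
    · intro z _ hz
      rw [if_neg, zero_mul]
      intro hh
      refine hz ⟨(z i, z j), by simp, funext fun m => ?_⟩
      by_cases hj : m = j
      · subst hj; simp
      · by_cases hi : m = i
        · subst hi; simp [hij]
        · simp [hi, hj, hh m hi hj]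
    · intro p _
      have h1 : ∀ m, m ≠ i → m ≠ j →
          x m = Function.update (Function.update x i p.1) j p.2 m := by
        intro m hi hj; simp [hi, hj]
      have h2 : ∀ m, m ≠ i → m ≠ j →
          Function.update (Function.update x i p.1) j p.2 m = y m := by
        intro m hi hj; rw [← h1 m hi hj, hxy m hi hj]
      rw [if_pos h1, if_pos h2]
      simp [Function.update_of_ne hij]
  · refine Finset.sum_eq_zero fun z _ => ?_
    by_cases h1 : ∀ m, m ≠ i → m ≠ j → x m = z m
    · have h2 : ¬∀ m, m ≠ i → m ≠ j → z m = y m :=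
        fun h2 => hxy fun m hi hj => (h1 m hi hj).trans (h2 m hi hj)
      rw [if_neg h2, mul_zero]
    · rw [if_neg h1, zero_mul]

theorem twoSite_mem_unitaryGroup {i j : S} (hij : i ≠ j)
    {g : Matrix (Fin d × Fin d) (Fin d × Fin d) ℂ} (hg : g ∈ unitaryGroup (Fin d × Fin d) ℂ) :
    twoSite i j g ∈ unitaryGroup (S → Fin d) ℂ := by
  rw [mem_unitaryGroup_iff, star_eq_conjTranspose, twoSite_conjTranspose, twoSite_mul hij,
    ← star_eq_conjTranspose, mem_unitaryGroup_iff.1 hg, twoSite_one]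

end TwoSite

/-! ### Circuits -/

section QuantumCircuits

variable {G : SimpleGraph S} {d k : ℕ}

theorem Gate.mem_unitaryGroup (g : Gate G d) :
    twoSite g.fst g.snd g.op ∈ unitaryGroup (S → Fin d) ℂ :=
  twoSite_mem_unitaryGroup g.adj.ne g.unitary

theorem one_mem_Layer : (1 : Matrix (S → Fin d) (S → Fin d) ℂ) ∈ Layer G d :=
  ⟨[], List.Pairwise.nil, rfl⟩

theorem Layer_subset_unitaryGroup {V : Matrix (S → Fin d) (S → Fin d) ℂ} (hV : V ∈ Layer G d) :
    V ∈ unitaryGroup (S → Fin d) ℂ := by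
  obtain ⟨L, -, rfl⟩ := hV
  refine list_prod_mem fun A hA => ?_
  obtain ⟨g, -, rfl⟩ := List.mem_map.1 hA
  exact g.mem_unitaryGroup

theorem QC_subset_unitaryGroup : ∀ {ℓ : ℕ} {V : Matrix (S → Fin d) (S → Fin d) ℂ},
    V ∈ QC G d ℓ → V ∈ unitaryGroup (S → Fin d) ℂ
  | 0, _, hV => by rw [Set.mem_singleton_iff.1 hV]; exact one_mem _
  | _ + 1, _, ⟨_, hV, _, hW, h⟩ => by
    rw [h]; exact mul_mem (Layer_subset_unitaryGroup hV) (QC_subset_unitaryGroup hW)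

theorem one_mem_QC : ∀ {ℓ : ℕ}, (1 : Matrix (S → Fin d) (S → Fin d) ℂ) ∈ QC G d ℓ
  | 0 => rfl
  | _ + 1 => ⟨1, one_mem_Layer, 1, one_mem_QC, (one_mul 1).symm⟩

/-- Splitting of the configurations of spins and ancillas. -/
theorem config_ext {x y : S → Loc d k} (h₁ : (fun i => (x i).1) = fun i => (y i).1)
    (h₂ : ∀ i, (x i).2 = (y i).2) : x = y :=
  funext fun i => Prod.ext (congrFun h₁ i) (h₂ i)

theorem onSpins_one : onSpins (S := S) k (1 : Matrix (S → Fin d) (S → Fin d) ℂ) = 1 := by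
  ext x y
  simp only [onSpins, Matrix.of_apply, Matrix.one_apply]
  by_cases h : x = y
  · simp [h]
  · rw [if_neg h]
    split_ifs with h1 h2
    · exact absurd (config_ext h2 h1) h
    · rfl
    · rfl

theorem onSpins_mulVec (V : Matrix (S → Fin d) (S → Fin d) ℂ) (Ψ : (S → Loc d k) → ℂ)
    (x : S → Loc d k) :
    (onSpins k V *ᵥ Ψ) x =
      (V *ᵥ fun y => Ψ fun i => (y i, (x i).2)) fun i => (x i).1 := by
  simp only [onSpins, Matrix.mulVec, dotProduct, Matrix.of_apply]
  symm
  refine Finset.sum_of_injOn (fun (y : S → Fin d) i => (y i, (x i).2)) ?_ ?_ ?_ ?_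
  · intro y _ z _ hyz
    ext i
    have := congrArg Prod.fst (congrFun hyz i)
    simpa using congrArg Fin.val this
  · simp [Set.MapsTo]
  · intro z _ hz
    rw [if_neg, zero_mul]
    intro hh
    exact hz ⟨fun i => (z i).1, by simp, config_ext rfl hh⟩
  · intro y _
    simp

theorem onSpins_mul (V W : Matrix (S → Fin d) (S → Fin d) ℂ) :
    onSpins k (V * W) = onSpins k V * onSpins k W := by
  refine Matrix.ext_of_mulVec_single fun y => ?_
  ext x
  rw [← Matrix.mulVec_mulVec, onSpins_mulVec, onSpins_mulVec, ← Matrix.mulVec_mulVec]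
  simp_rw [onSpins_mulVec]

theorem mul_mem_QCAnc {ℓ : ℕ} {U V : Matrix (S → Loc d k) (S → Loc d k) ℂ}
    (hU : U ∈ LU S (Loc d k)) (hV : V ∈ QCAnc G d k ℓ) : U * V ∈ QCAnc G d k ℓ := by
  cases ℓ with
  | zero => exact mul_mem_LU hU hV
  | succ n =>
    obtain ⟨U', hU', V', hV', W, hW, rfl⟩ := hV
    exact ⟨U * U', mul_mem_LU hU hU', V', hV', W, hW, by rw [Matrix.mul_assoc]⟩

theorem onSpins_mul_mem_QCAnc {ℓ : ℕ} {V : Matrix (S → Fin d) (S → Fin d) ℂ}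
    {W : Matrix (S → Loc d k) (S → Loc d k) ℂ} (hV : V ∈ Layer G d) (hW : W ∈ QCAnc G d k ℓ) :
    onSpins k V * W ∈ QCAnc G d k (ℓ + 1) :=
  ⟨1, one_mem_LU, V, hV, W, hW, (Matrix.one_mul _).symm⟩

/-- Depth may be padded with empty layers. -/
theorem LU_subset_QCAnc {U : Matrix (S → Loc d k) (S → Loc d k) ℂ} (hU : U ∈ LU S (Loc d k)) :
    ∀ {ℓ : ℕ}, U ∈ QCAnc G d k ℓ
  | 0 => hU
  | ℓ + 1 => by
    have := onSpins_mul_mem_QCAnc (k := k) (one_mem_Layer (G := G)) (LU_subset_QCAnc (ℓ := ℓ) hU)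
    rwa [onSpins_one, Matrix.one_mul] at this

theorem onSpins_QC_mul_mem_QCAnc {ℓ : ℕ} {V : Matrix (S → Fin d) (S → Fin d) ℂ}
    {U : Matrix (S → Loc d k) (S → Loc d k) ℂ} (hV : V ∈ QC G d ℓ) (hU : U ∈ LU S (Loc d k)) :
    onSpins k V * U ∈ QCAnc G d k ℓ := by
  induction ℓ generalizing V with
  | zero => rw [Set.mem_singleton_iff.1 hV, onSpins_one, Matrix.one_mul]; exact hU
  | succ n ih =>
    obtain ⟨V', hV', W, hW, rfl⟩ := hV
    rw [onSpins_mul, Matrix.mul_assoc]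
    exact onSpins_mul_mem_QCAnc hV' (ih hW)

theorem QCAnc_mono {ℓ ℓ' : ℕ} (h : ℓ ≤ ℓ') : QCAnc G d k ℓ ⊆ QCAnc G d k ℓ' := by
  induction h with
  | refl => exact subset_rfl
  | step _ ih =>
    intro V hV
    have := onSpins_mul_mem_QCAnc (k := k) (one_mem_Layer (G := G)) (ih hV)
    rwa [onSpins_one, Matrix.one_mul] at this

theorem PreparedByQCcc.mono [NeZero d] {ℓ ℓ' : ℕ} (h : ℓ ≤ ℓ') {φ : (S → Fin d) → ℂ}
    (hφ : PreparedByQCcc G d ℓ φ) : PreparedByQCcc G d ℓ' φ := by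
  obtain ⟨h1, k, V, hV, hL⟩ := hφ
  exact ⟨h1, k, V, QCAnc_mono h hV, hL⟩

theorem QCcc_mono [NeZero d] {ℓ ℓ' : ℕ} (h : ℓ ≤ ℓ') : QCcc G d ℓ ⊆ QCcc G d ℓ' := by
  rintro U ⟨hU, φ, hφ, k, V, hV, hB⟩
  exact ⟨hU, φ, hφ.mono h, k, V, QCAnc_mono h hV, hB⟩

/-- `QCcc` does not see global phases. -/
theorem smul_mem_QCcc [NeZero d] {ℓ : ℕ} {U : Matrix (S → Fin d) (S → Fin d) ℂ}
    (hU : U ∈ QCcc G d ℓ) {c : ℂ} (hc : star c * c = 1) : c • U ∈ QCcc G d ℓ := by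
  obtain ⟨hU, φ, hφ, k, V, hV, B, hB, W, hW, h⟩ := hU
  refine ⟨?_, φ, hφ, k, V, hV, B, hB, W, hW, fun α => ?_⟩
  · rw [mem_unitaryGroup_iff', star_smul, smul_mul_smul_comm, hc, mem_unitaryGroup_iff'.1 hU,
      one_smul]
  · obtain ⟨c', h'⟩ := h α
    refine ⟨c' * star c, fun ψ => ?_⟩
    rw [h' ψ, Matrix.smul_mulVec, smul_smul, mul_assoc, hc, mul_one]

end QuantumCircuits

end Operators

/-! ### State preparation by measurement and correction -/

section Preparation

variable {S : Type} [Fintype S] [DecidableEq S] {G : SimpleGraph S} {d k : ℕ}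

open scoped Kronecker in
theorem onSpins_mem_LU {W : Matrix (S → Fin d) (S → Fin d) ℂ} (hW : W ∈ LU S (Fin d)) :
    onSpins k W ∈ LU S (Loc d k) := by
  obtain ⟨u, hu, rfl⟩ := hW
  refine ⟨fun i => u i ⊗ₖ (1 : Matrix (Fin k → Fin d) (Fin k → Fin d) ℂ),
    fun i => kronecker_mem_unitary (hu i) (one_mem _), ?_⟩
  ext x y
  simp only [onSpins, tensorOp, Matrix.of_apply, kroneckerMap_apply, Finset.prod_mul_distrib,
    Matrix.one_apply]
  rw [Finset.prod_ite_zero]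
  simp

/-- Measuring in the computational basis is no loss here: any change of basis can be absorbed into
the last local unitary of the circuit, at no cost in depth. -/
theorem collapse_one (i : S) (α : Fin k → Fin d) (Ψ : (S → Loc d k) → ℂ) :
    collapse i (fun a => (1 : Matrix (Fin k → Fin d) (Fin k → Fin d) ℂ) a α) Ψ =
      fun x => if (x i).2 = α then Ψ x else 0 := by
  ext x
  simp only [collapse, Matrix.one_apply, apply_ite star, star_one, star_zero, ite_mul, one_mul,
    zero_mul, Finset.sum_ite_eq', Finset.mem_univ, if_true]
  by_cases h : (x i).2 = α
  · rw [if_pos h, if_pos h, ← h, Prod.mk.eta, Function.update_eq_self]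
  · rw [if_neg h, if_neg h]

/-- Measuring all ancillas in the computational basis, and correcting by a local unitary after the
last measurement. -/
theorem LOCCTo_of_correctable {φ : (S → Fin d) → ℂ} :
    ∀ (i : S) (L : List S) {Ψ : (S → Loc d k) → ℂ},
      (∃ α₀ : S → Fin k → Fin d, ∀ x, Ψ x ≠ 0 → ∀ j, j ∉ i :: L → (x j).2 = α₀ j) →
      (∀ α : S → Fin k → Fin d, ∃ W ∈ LU S (Fin d), ∃ c : ℂ,
        W *ᵥ (fun x => Ψ fun i => (x i, α i)) = c • φ) →
      LOCCTo φ (i :: L) Ψ := by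
  intro i L
  induction L generalizing i with
  | nil =>
    rintro Ψ ⟨α₀, h₀⟩ h
    choose W hW c hc using fun α => h (Function.update α₀ i α)
    -- After the last measurement the whole outcome string is known, so the ancilla state is
    -- supported on it. The coefficient `c α` is allowed to vanish.
    refine ⟨1, one_mem _, fun α => onSpins k (W α), fun α => onSpins_mem_LU (hW α), fun α =>
      ⟨fun a => if a = Function.update α₀ i α then c α else 0, ?_⟩⟩
    ext x
    rw [collapse_one, onSpins_mulVec, withAnc]
    dsimp only
    by_cases hx : (fun j => (x j).2) = Function.update α₀ i α
    · rw [if_pos hx]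
      have hx' : ∀ j, (x j).2 = Function.update α₀ i α j := congrFun hx
      have := congrFun (hc α) fun i => (x i).1
      simp only [Pi.smul_apply, smul_eq_mul] at this
      rw [mul_comm, ← this]
      simp [hx']
    · rw [if_neg hx, mul_zero]
      have : (fun y : S → Fin d => if (x i).2 = α then Ψ fun j => (y j, (x j).2) else 0) = 0 := by
        ext y
        simp only [Pi.zero_apply, ite_eq_right_iff]
        intro hα
        by_contra hne
        refine hx (funext fun j => ?_)
        by_cases hj : j = i
        · subst hj; simpa using hα
        · simpa [hj] using h₀ _ hne j (by simpa using hj)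
      rw [this, Matrix.mulVec_zero, Pi.zero_apply]
  | cons j L ih =>
    rintro Ψ ⟨α₀, h₀⟩ h
    -- Earlier measurements need no correction; their outcomes are only recorded in the string of
    -- collapsed ancillas.
    refine ⟨1, one_mem _, fun α => 1, fun α => one_mem_LU, fun α => ?_⟩
    rw [collapse_one, Matrix.one_mulVec]
    refine ih j ⟨Function.update α₀ i α, fun x hx m hm => ?_⟩ fun β => ?_
    · rw [ite_ne_right_iff] at hx
      by_cases hmi : m = i
      · subst hmi; simpa using hx.1
      · simpa [hmi] using h₀ x hx.2 m (by simpa [hmi] using hm)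
    · by_cases hβ : β i = α
      · simpa [hβ] using h β
      -- A string that contradicts the outcome just obtained has amplitude zero.
      · refine ⟨1, one_mem_LU, 0, ?_⟩
        simp only [hβ, if_false, zero_smul]
        exact Matrix.mulVec_zero _

/-- `Ψ` is obtained from `|0⋯0⟩` by a circuit of depth `ℓ` with ancillas. -/
def Reachable (G : SimpleGraph S) (d k : ℕ) [NeZero d] (ℓ : ℕ) (Ψ : (S → Loc d k) → ℂ) : Prop :=
  ∃ V ∈ QCAnc G d k ℓ, Ψ = V *ᵥ withAnc (zeroSpins S d) (zeroAnc S d k)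

section Reachable

variable [NeZero d] {ℓ : ℕ} {Ψ : (S → Loc d k) → ℂ}

theorem Reachable.local {U : Matrix (S → Loc d k) (S → Loc d k) ℂ} (h : Reachable G d k ℓ Ψ)
    (hU : U ∈ LU S (Loc d k)) : Reachable G d k ℓ (U *ᵥ Ψ) := by
  obtain ⟨V, hV, rfl⟩ := h
  exact ⟨U * V, mul_mem_QCAnc hU hV, by rw [Matrix.mulVec_mulVec]⟩

theorem Reachable.layer {V : Matrix (S → Fin d) (S → Fin d) ℂ} (h : Reachable G d k ℓ Ψ)
    (hV : V ∈ Layer G d) : Reachable G d k (ℓ + 1) (onSpins k V *ᵥ Ψ) := by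
  obtain ⟨W, hW, rfl⟩ := h
  exact ⟨_, onSpins_mul_mem_QCAnc hV hW, by rw [Matrix.mulVec_mulVec]⟩

theorem reachable_zero :
    Reachable G d k ℓ (withAnc (zeroSpins S d) (zeroAnc S d k)) :=
  ⟨1, LU_subset_QCAnc one_mem_LU, by rw [Matrix.one_mulVec]⟩

/-- This reduces LOCC to one check per outcome string: the corresponding slice of `Ψ` must be a
multiple, possibly zero, of `φ` up to a local unitary on the spins. -/
theorem Reachable.prepared [Nonempty S] {φ : (S → Fin d) → ℂ} (hφ : ∑ x, ‖φ x‖ ^ 2 = 1)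
    (h : Reachable G d k ℓ Ψ)
    (hW : ∀ α : S → Fin k → Fin d, ∃ W ∈ LU S (Fin d), ∃ c : ℂ,
        W *ᵥ (fun x => Ψ fun i => (x i, α i)) = c • φ) : PreparedByQCcc G d ℓ φ := by
  obtain ⟨V, hV, rfl⟩ := h
  refine ⟨hφ, k, V, hV, Finset.univ.toList, Finset.nodup_toList _, fun i => by simp, ?_⟩
  have hne : (Finset.univ : Finset S).toList ≠ [] := by simp [Finset.univ_nonempty.ne_empty]
  obtain ⟨i, L, hL⟩ := List.exists_cons_of_ne_nil hne
  rw [hL]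
  -- The list contains every site, so no ancilla is collapsed beforehand and the reference string is
  -- arbitrary.
  refine LOCCTo_of_correctable i L ⟨fun _ _ => 0, fun x _ j hj => ?_⟩ hW
  rw [← hL] at hj
  simp at hj

end Reachable

theorem unitary_mulVec_norm_sq {κ : Type} [Fintype κ] [DecidableEq κ] {U : Matrix κ κ ℂ}
    (hU : U ∈ unitaryGroup κ ℂ) (φ : κ → ℂ) :
    ∑ x, ‖(U *ᵥ φ) x‖ ^ 2 = ∑ x, ‖φ x‖ ^ 2 := by
  have key : ∀ ψ : κ → ℂ, ((∑ x, ‖ψ x‖ ^ 2 : ℝ) : ℂ) = star ψ ⬝ᵥ ψ := by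
    intro ψ
    simp only [dotProduct, Pi.star_apply, Complex.ofReal_sum]
    refine Finset.sum_congr rfl fun x _ => ?_
    rw [mul_comm]
    simpa using (Complex.mul_conj' (ψ x)).symm
  have := mem_unitaryGroup_iff'.1 hU
  rw [star_eq_conjTranspose] at this
  rw [← Complex.ofReal_inj, key, key, Matrix.star_mulVec, Matrix.dotProduct_mulVec,
    Matrix.vecMul_vecMul, this, Matrix.vecMul_one]

theorem sum_norm_sq_zeroSpins [NeZero d] : ∑ x, ‖zeroSpins S d x‖ ^ 2 = 1 := by
  rw [Finset.sum_eq_single (fun _ => 0)]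
  · simp [zeroSpins]
  · intro x _ hx
    have : ¬∀ i, x i = 0 := fun h => hx (funext h)
    simp [zeroSpins, this]
  · simp

theorem prepared_zeroSpins [NeZero d] [Nonempty S] {ℓ : ℕ} :
    PreparedByQCcc G d ℓ (zeroSpins S d) := by
  refine (reachable_zero (k := 0)).prepared sum_norm_sq_zeroSpins fun α =>
    ⟨1, one_mem_LU, zeroAnc S d 0 α, ?_⟩
  rw [Matrix.one_mulVec]
  ext x
  simp [withAnc, mul_comm]

theorem braAnc_one (α : S → Fin k → Fin d) (Ψ : (S → Loc d k) → ℂ) :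
    braAnc (fun _ => 1) α Ψ = fun x => Ψ fun i => (x i, α i) := by
  ext x
  rw [braAnc, Finset.sum_eq_single α]
  · simp
  · intro a _ ha
    obtain ⟨i, hi⟩ := Function.ne_iff.1 ha
    rw [Finset.prod_eq_zero (Finset.mem_univ i), zero_mul]
    simp [hi]
  · simp

/-- A circuit of depth `ℓ` needs no assistance. -/
theorem QC_subset_QCcc [NeZero d] [Nonempty S] (ℓ : ℕ) : QC G d ℓ ⊆ QCcc G d ℓ := by
  intro U hU
  -- The resource state is trivial and is never touched. Outcomes other than zero have the constant
  -- c = 0.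
  refine ⟨QC_subset_unitaryGroup hU, zeroSpins S d, prepared_zeroSpins, 0,
    onSpins 1 U, ?_, fun _ => 1, fun _ => one_mem _, fun _ => 1, fun _ => one_mem_LU,
    fun α => ⟨loadAnc 0 (zeroSpins S d) α, fun ψ => ?_⟩⟩
  · simpa using onSpins_QC_mul_mem_QCAnc hU (one_mem_LU (S := S) (κ := Loc d 1))
  · rw [Matrix.one_mulVec, braAnc_one, ← Matrix.mulVec_smul]
    ext x
    rw [onSpins_mulVec]
    refine congrFun (congrArg _ (funext fun y => ?_)) _
    simp [withAnc, mul_comm]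

end Preparation

/-! ### Linear algebra over the field with two elements -/

/-- The ring structure of `Fin 2`. -/
@[reducible] def fin2CommRing : CommRing (Fin 2) := Fin.instCommRing 2

section Binary

attribute [local instance] fin2CommRing

theorem fin2_add_self (a : Fin 2) : a + a = 0 := by
  revert a; decide

theorem fin2_eq_zero_or_one (a : Fin 2) : a = 0 ∨ a = 1 := by
  revert a; decide

theorem fin2_pi_add_self {S : Type} (x : S → Fin 2) : x + x = 0 :=
  funext fun _ => fin2_add_self _

theorem fin2_add_eq_zero_iff {S : Type} {x y : S → Fin 2} : x + y = 0 ↔ x = y := by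
  constructor
  · intro h
    rw [← add_zero x, ← fin2_pi_add_self y, ← add_assoc, h, zero_add]
  · rintro rfl
    exact fin2_pi_add_self x

/-- The sign `(-1)^a` of a bit. -/
noncomputable def sgn (a : Fin 2) : ℂ := if a = 0 then 1 else -1

theorem sgn_zero : sgn 0 = 1 := rfl

theorem sgn_one : sgn 1 = -1 := by simp [sgn]

theorem sgn_add (a b : Fin 2) : sgn (a + b) = sgn a * sgn b := by
  rcases fin2_eq_zero_or_one a with rfl | rfl <;> rcases fin2_eq_zero_or_one b with rfl | rfl
  · rw [add_zero, sgn_zero, mul_one]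
  · rw [zero_add, sgn_zero, one_mul]
  · rw [add_zero, sgn_zero, mul_one]
  · rw [fin2_add_self, sgn_zero, sgn_one]; norm_num

theorem sgn_mul_self (a : Fin 2) : sgn a * sgn a = 1 := by
  rw [← sgn_add, fin2_add_self, sgn_zero]

theorem star_sgn (a : Fin 2) : star (sgn a) = sgn a := by
  rcases fin2_eq_zero_or_one a with rfl | rfl <;> simp [sgn]

theorem sgn_ne_zero (a : Fin 2) : sgn a ≠ 0 :=
  left_ne_zero_of_mul_eq_one (sgn_mul_self a)

variable {S : Type} [Fintype S] [DecidableEq S]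

theorem sgn_sum (f : S → Fin 2) (s : Finset S) : sgn (∑ i ∈ s, f i) = ∏ i ∈ s, sgn (f i) := by
  induction s using Finset.induction_on with
  | empty => simp [sgn]
  | insert i s hi ih => rw [Finset.sum_insert hi, Finset.prod_insert hi, sgn_add, ih]

theorem sgn_dotProduct (x y : S → Fin 2) : sgn (x ⬝ᵥ y) = ∏ i, sgn (x i * y i) := sgn_sum _ _

/-- A nontrivial character sums to zero. -/
theorem sum_sgn_eq_zero {f : (S → Fin 2) → Fin 2} (hf : ∀ a b, f (a + b) = f a + f b)
    {b : S → Fin 2} (hb : f b ≠ 0) : ∑ a, sgn (f a) = 0 := by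
  have h1 : f b = 1 := (fin2_eq_zero_or_one _).resolve_left hb
  -- Translation of the summation variable by `b` changes the sign of the sum.
  have := Equiv.sum_comp (Equiv.addRight b) fun a => sgn (f a)
  simp only [Equiv.coe_addRight, hf, sgn_add, h1, sgn_one, ← Finset.sum_mul] at this
  linear_combination (-1 / 2 : ℂ) * this

theorem dotProduct_single_fin2 (z : S → Fin 2) (i : S) : z ⬝ᵥ Pi.single i 1 = z i := by
  simp

/-- A subspace has a basis that is dual to a set of coordinates. -/
theorem exists_pivots (A : Submodule (Fin 2) (S → Fin 2)) :
    ∃ (I : Finset S) (b : S → S → Fin 2), (∀ i ∈ I, b i ∈ A) ∧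
      (∀ i ∈ I, ∀ j ∈ I, b i j = if j = i then 1 else 0) ∧
      ∀ a ∈ A, a = ∑ i ∈ I, a i • b i := by
  classical
  have hex : ∃ I : Finset S, ∀ a ∈ A, (∀ i ∈ I, a i = 0) → a = 0 :=
    ⟨Finset.univ, fun a _ h => funext fun i => h i (Finset.mem_univ i)⟩
  -- Take a minimal set of coordinates that separates the points of `A`. Without `i` it no longer
  -- does, and a nonzero element vanishing on the other coordinates must be 1 at `i`: this is the
  -- dual basis vector.
  obtain ⟨I, hI, hmin⟩ := exists_minimal_of_wellFoundedLT _ hex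
  have key : ∀ i, ∃ v : S → Fin 2, i ∈ I → v ∈ A ∧ ∀ j ∈ I, v j = if j = i then 1 else 0 := by
    intro i
    by_cases hi : i ∈ I
    · have : ¬∀ a ∈ A, (∀ j ∈ I.erase i, a j = 0) → a = 0 := fun h =>
        Finset.notMem_erase i I (hmin h (Finset.erase_subset i I) hi)
      push Not at this
      obtain ⟨a, ha, h0, hne⟩ := this
      refine ⟨a, fun _ => ⟨ha, fun j hj => ?_⟩⟩
      split_ifs with hji
      · subst hji
        refine (fin2_eq_zero_or_one _).resolve_left fun hz => hne (hI a ha fun m hm => ?_)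
        by_cases hmj : m = j
        · rw [hmj, hz]
        · exact h0 m (Finset.mem_erase.2 ⟨hmj, hm⟩)
      · exact h0 j (Finset.mem_erase.2 ⟨hji, hj⟩)
    · exact ⟨0, fun h => absurd h hi⟩
  choose b hb using key
  refine ⟨I, b, fun i hi => (hb i hi).1, fun i hi => (hb i hi).2, fun a ha => ?_⟩
  refine fin2_add_eq_zero_iff.1 (hI _ (A.add_mem ha
    (A.sum_mem fun i hi => A.smul_mem _ (hb i hi).1)) fun j hj => ?_)
  rw [Pi.add_apply, Finset.sum_apply, Finset.sum_eq_single j]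
  · rw [Pi.smul_apply, (hb j hj).2 j hj, if_pos rfl, smul_eq_mul, mul_one, fin2_add_self]
  · intro i hi hij
    rw [Pi.smul_apply, (hb i hi).2 j hj, if_neg (Ne.symm hij), smul_zero]
  · exact fun h => absurd hj h

/-- A functional that vanishes on the kernel of `δ` factors through `δ`. -/
theorem exists_dotProduct_eq (δ : (S → Fin 2) →ₗ[Fin 2] (S → Fin 2)) {m : S → Fin 2}
    (hm : ∀ a, δ a = 0 → m ⬝ᵥ a = 0) : ∃ z : S → Fin 2, ∀ a, m ⬝ᵥ a = z ⬝ᵥ δ a := by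
  obtain ⟨I, b, hb, -, hA⟩ := exists_pivots (LinearMap.range δ)
  have : ∀ i, ∃ g, i ∈ I → δ g = b i := fun i => by
    by_cases hi : i ∈ I
    · obtain ⟨g, hg⟩ := LinearMap.mem_range.1 (hb i hi)
      exact ⟨g, fun _ => hg⟩
    · exact ⟨0, fun h => absurd h hi⟩
  choose g hg using this
  -- The functional is defined on the range through preimages `g i` of a pivot basis. This is
  -- consistent because `a` and the sum of the `δ a i • g i` differ by an element of the kernel,
  -- where `m` vanishes.
  refine ⟨fun i => if i ∈ I then m ⬝ᵥ g i else 0, fun a => ?_⟩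
  have h1 : δ (a + ∑ i ∈ I, δ a i • g i) = 0 := by
    rw [map_add, map_sum, fin2_add_eq_zero_iff]
    refine (hA (δ a) ⟨a, rfl⟩).trans (Finset.sum_congr rfl fun i hi => ?_)
    rw [map_smul, hg i hi]
  have h2 := hm _ h1
  rw [dotProduct_add] at h2
  have h3 : m ⬝ᵥ a = m ⬝ᵥ ∑ i ∈ I, δ a i • g i := by
    rw [← add_zero (m ⬝ᵥ a), ← fin2_add_self (m ⬝ᵥ ∑ i ∈ I, δ a i • g i), ← add_assoc, h2,
      zero_add]
  rw [h3, dotProduct_sum]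
  rw [dotProduct.eq_1 (fun i => if i ∈ I then m ⬝ᵥ g i else 0)]
  simp only [dotProduct_smul, smul_eq_mul, ite_mul, zero_mul, Finset.sum_ite_mem,
    Finset.univ_inter]
  exact Finset.sum_congr rfl fun i _ => mul_comm _ _

/-- The indicator function of a subspace. -/
noncomputable def indicator (A : Submodule (Fin 2) (S → Fin 2)) : (S → Fin 2) → ℂ :=
  Set.indicator A 1

/-- The fibres of `δ` over its range are cosets of the kernel, hence equally large; c is their
common size. -/
theorem exists_sum_eq_smul_indicator (δ : (S → Fin 2) →ₗ[Fin 2] (S → Fin 2)) :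
    ∃ c : ℂ, c ≠ 0 ∧
      (fun x => ∑ a, if x = δ a then (1 : ℂ) else 0) = c • indicator (LinearMap.range δ) := by
  refine ⟨∑ a, if 0 = δ a then 1 else 0, ?_, ?_⟩
  · rw [Finset.sum_boole, Nat.cast_ne_zero]
    exact (Finset.card_pos.2 ⟨0, by simp⟩).ne'
  · ext x
    rw [Pi.smul_apply, indicator, smul_eq_mul]
    by_cases hx : x ∈ LinearMap.range δ
    · rw [Set.indicator_of_mem (by exact hx), Pi.one_apply, mul_one]
      obtain ⟨b, rfl⟩ := LinearMap.mem_range.1 hx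
      rw [← Equiv.sum_comp (Equiv.addRight b)]
      refine Finset.sum_congr rfl fun a _ => if_congr ?_ rfl rfl
      simp [eq_comm]
    · rw [Set.indicator_of_notMem (by exact hx), mul_zero]
      refine Finset.sum_eq_zero fun a _ => if_neg ?_
      rintro rfl
      exact hx ⟨a, rfl⟩

/-! ### Hadamard gates and Pauli operators -/

/-- The Hadamard matrix. -/
noncomputable def hadGate : Matrix (Fin 2) (Fin 2) ℂ :=
  ((Real.sqrt 2 : ℝ) : ℂ)⁻¹ • Matrix.of fun a b => sgn (a * b)

theorem inv_sqrt_two_mul_self : ((Real.sqrt 2 : ℝ) : ℂ)⁻¹ * ((Real.sqrt 2 : ℝ) : ℂ)⁻¹ = 2⁻¹ := by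
  rw [← mul_inv, ← Complex.ofReal_mul, Real.mul_self_sqrt (by norm_num)]
  norm_num

theorem hadGate_mem_unitaryGroup : hadGate ∈ unitaryGroup (Fin 2) ℂ := by
  rw [mem_unitaryGroup_iff]
  have h : star hadGate = hadGate := by
    ext a b
    simp only [hadGate, star_apply, Matrix.smul_apply, of_apply, smul_eq_mul, star_mul', star_sgn,
      mul_comm b a]
    rw [star_inv₀]
    simp
  rw [h, hadGate, smul_mul_smul_comm, inv_sqrt_two_mul_self]
  ext a b
  simp only [Matrix.smul_apply, Matrix.mul_apply, of_apply, Fin.sum_univ_two, smul_eq_mul,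
    mul_zero, zero_mul, sgn_zero, mul_one, one_mul, Matrix.one_apply]
  rcases fin2_eq_zero_or_one a with rfl | rfl <;> rcases fin2_eq_zero_or_one b with rfl | rfl <;>
    norm_num [sgn]

/-- The global normalization of the Hadamard transformation. -/
noncomputable def hadamardScale (S : Type) [Fintype S] : ℂ :=
  ((Real.sqrt 2 : ℝ) : ℂ)⁻¹ ^ Fintype.card S

theorem hadamardScale_ne_zero : hadamardScale S ≠ 0 := by
  simp [hadamardScale]

theorem tensorOp_hadGate_apply (x y : S → Fin 2) :
    tensorOp (fun _ : S => hadGate) x y = hadamardScale S * sgn (x ⬝ᵥ y) := by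
  simp [tensorOp, hadGate, Finset.prod_mul_distrib, sgn_dotProduct, hadamardScale]

theorem hadamardAll_mem_LU : tensorOp (fun _ : S => hadGate) ∈ LU S (Fin 2) :=
  tensorOp_mem_LU fun _ => hadGate_mem_unitaryGroup

/-- The diagonal operator `Z^z`. -/
noncomputable def signOp (z : S → Fin 2) : Matrix (S → Fin 2) (S → Fin 2) ℂ :=
  Matrix.diagonal fun x => sgn (z ⬝ᵥ x)

/-- The translation operator `X^γ`. -/
noncomputable def shiftOp (γ : S → Fin 2) : Matrix (S → Fin 2) (S → Fin 2) ℂ :=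
  compOp fun x => x + γ

theorem signOp_mem_LU (z : S → Fin 2) : signOp z ∈ LU S (Fin 2) := by
  refine ⟨fun i => Matrix.diagonal fun a => sgn (z i * a), fun i => ?_, ?_⟩
  · rw [mem_unitaryGroup_iff, star_eq_conjTranspose, diagonal_conjTranspose, diagonal_mul_diagonal,
      ← diagonal_one]
    congr 1
    ext a
    rw [Pi.star_apply, star_sgn, sgn_mul_self]
  · ext x y
    simp only [signOp, tensorOp, of_apply, diagonal_apply, sgn_dotProduct]
    rw [Finset.prod_ite_zero]
    simp [funext_iff]

theorem shiftOp_mem_LU (γ : S → Fin 2) : shiftOp γ ∈ LU S (Fin 2) := by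
  refine ⟨fun i => compOp fun a => a + γ i, fun i => compOp_mem_unitaryGroup fun a => ?_, ?_⟩
  · rw [add_assoc, fin2_add_self, add_zero]
  · rw [tensorOp_compOp]; rfl

end Binary

/-! ### CNOT networks controlled by ancillas, and the states they prepare -/

section Networks

attribute [local instance] fin2CommRing

variable {S : Type} [Fintype S] [DecidableEq S] {G : SimpleGraph S}

/-! ### Layers of CNOT gates -/

/-- Adding the bits `a (p i)` to the bits `x i`, for all `i ∈ T`. -/
def addFrom (T : Finset S) (p : S → S) (a x : S → Fin 2) : S → Fin 2 :=
  fun i => if i ∈ T then x i + a (p i) else x i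

/-- The CNOT gate. -/
def cnot : Matrix (Fin 2 × Fin 2) (Fin 2 × Fin 2) ℂ := compOp fun p => (p.1, p.2 + p.1)

theorem cnot_mem_unitaryGroup : cnot ∈ unitaryGroup (Fin 2 × Fin 2) ℂ :=
  compOp_mem_unitaryGroup fun p => by simp [add_assoc, fin2_add_self]

theorem twoSite_cnot {i j : S} (hij : i ≠ j) :
    twoSite i j cnot = compOp fun x => Function.update x j (x j + x i) := by
  ext x y
  simp only [twoSite, cnot, compOp, of_apply, Prod.mk.injEq]
  rw [← ite_and]
  refine if_congr ?_ rfl rfl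
  constructor
  · rintro ⟨h, hi, hj⟩
    ext m
    by_cases hmj : m = j
    · subst hmj; rw [Function.update_self, hj]
    · rw [Function.update_of_ne hmj]
      by_cases hmi : m = i
      · rw [hmi, hi]
      · rw [h m hmi hmj]
  · rintro rfl
    refine ⟨fun m _ hj => by rw [Function.update_of_ne hj], by rw [Function.update_of_ne hij], ?_⟩
    rw [Function.update_self]

/-- The CNOT gates along a matching form a layer. -/
theorem compOp_addFrom_mem_Layer {T : Finset S} {p : S → S} (hadj : ∀ t ∈ T, G.Adj (p t) t)
    (hp : ∀ t ∈ T, p t ∉ T) (hinj : Set.InjOn p T) :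
    compOp (fun x => addFrom T p x x) ∈ Layer G 2 := by
  -- The induction must remember which targets and controls occur in the list, since this is what
  -- shows a new gate to be disjoint from the old ones.
  suffices ∃ L : List (Gate G 2), L.Pairwise Gate.Apart ∧
      (∀ g ∈ L, g.snd ∈ T ∧ g.fst = p g.snd) ∧
      (L.map fun g => twoSite g.fst g.snd g.op).prod = compOp (fun x => addFrom T p x x) by
    obtain ⟨L, h1, -, h2⟩ := this
    exact ⟨L, h1, h2.symm⟩
  induction T using Finset.induction_on with
  | empty =>
    have : (fun x => addFrom ∅ p x x) = id := by
      ext x i : 2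
      simp [addFrom]
    exact ⟨[], List.Pairwise.nil, by simp, by rw [this, compOp_id]; rfl⟩
  | insert t T ht ih =>
    obtain ⟨L, hL, hT, hprod⟩ := ih (fun s hs => hadj s (Finset.mem_insert_of_mem hs))
      (fun s hs h => hp s (Finset.mem_insert_of_mem hs) (Finset.mem_insert_of_mem h))
      (hinj.mono (by simp))
    have htt := hadj t (Finset.mem_insert_self t T)
    refine ⟨⟨p t, t, htt, cnot, cnot_mem_unitaryGroup⟩ :: L, ?_, ?_, ?_⟩
    · refine List.pairwise_cons.2 ⟨fun g hg => ?_, hL⟩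
      obtain ⟨h1, h2⟩ := hT g hg
      refine ⟨fun h => ?_, fun h => ?_, fun h => ?_, fun h => ?_⟩
      · rw [h2] at h
        exact ht (hinj (by simp) (by simp [h1]) h ▸ h1)
      · exact hp t (Finset.mem_insert_self t T) (by
          change p t = g.snd at h
          rw [h]; exact Finset.mem_insert_of_mem h1)
      · refine hp g.snd (Finset.mem_insert_of_mem h1) ?_
        rw [← h2, ← h]
        exact Finset.mem_insert_self t T
      · change t = g.snd at h
        exact ht (h ▸ h1)
    · intro g hg
      rcases List.mem_cons.1 hg with rfl | hg
      · exact ⟨Finset.mem_insert_self t T, rfl⟩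
      · exact ⟨Finset.mem_insert_of_mem (hT g hg).1, (hT g hg).2⟩
    · rw [List.map_cons, List.prod_cons, hprod, twoSite_cnot htt.ne, compOp_mul]
      congr 1
      ext x i : 2
      simp only [Function.comp_apply, addFrom, Finset.mem_insert]
      by_cases hi : i = t
      · subst hi
        rw [if_neg ht, if_pos (Or.inl rfl), Function.update_self]
      · rw [Function.update_of_ne hi]
        by_cases hiT : i ∈ T
        · have : p i ≠ t := fun h =>
            hp i (Finset.mem_insert_of_mem hiT) (h ▸ Finset.mem_insert_self t T)
          rw [if_pos hiT, if_pos (Or.inr hiT), Function.update_of_ne this]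
        · rw [if_neg hiT, if_neg (not_or.2 ⟨hi, hiT⟩)]

/-! ### States of one spin and one ancilla per site -/

/-- A vector in terms of the configurations of the spins and of the ancillas. -/
def pairState (Φ : (S → Fin 2) → (S → Fin 2) → ℂ) : (S → Loc 2 1) → ℂ :=
  fun x => Φ (fun i => (x i).1) fun i => (x i).2 0

/-- A change of the basis states of one site. -/
def locMap (F : Fin 2 × Fin 2 → Fin 2 × Fin 2) : Loc 2 1 → Loc 2 1 :=
  fun q => ((F (q.1, q.2 0)).1, fun _ => (F (q.1, q.2 0)).2)

theorem compOp_locMap_mem_LU {F : S → Fin 2 × Fin 2 → Fin 2 × Fin 2}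
    (hF : ∀ i, Function.Involutive (F i)) :
    compOp (fun (x : S → Loc 2 1) i => locMap (F i) (x i)) ∈ LU S (Loc 2 1) := by
  refine ⟨fun i => compOp (locMap (F i)), fun i => compOp_mem_unitaryGroup fun q => ?_,
    (tensorOp_compOp _).symm⟩
  simp only [locMap]
  rw [Prod.mk.eta, hF i (q.1, q.2 0)]
  refine Prod.ext rfl (funext fun j => ?_)
  rw [Subsingleton.elim j 0]

theorem compOp_locMap_mulVec (F : S → Fin 2 × Fin 2 → Fin 2 × Fin 2)
    (Φ : (S → Fin 2) → (S → Fin 2) → ℂ) :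
    compOp (fun (x : S → Loc 2 1) i => locMap (F i) (x i)) *ᵥ pairState Φ =
      pairState fun x a => Φ (fun i => (F i (x i, a i)).1) fun i => (F i (x i, a i)).2 :=
  compOp_mulVec _ _

theorem onSpins_mulVec_pairState (V : Matrix (S → Fin 2) (S → Fin 2) ℂ)
    (Φ : (S → Fin 2) → (S → Fin 2) → ℂ) :
    onSpins 1 V *ᵥ pairState Φ = pairState fun x a => (V *ᵥ fun y => Φ y a) x := by
  ext x
  rw [onSpins_mulVec]
  rfl

/-- The exchange of the spin and the ancilla, at the sites in `Q`. -/
def swapAt (Q : Finset S) (i : S) (q : Fin 2 × Fin 2) : Fin 2 × Fin 2 :=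
  if i ∈ Q then q.swap else q

theorem swapAt_involutive (Q : Finset S) (i : S) : Function.Involutive (swapAt Q i) := by
  intro q
  unfold swapAt
  split_ifs <;> simp

/-- Gates act on spins only, so the control bits are first swapped from the ancillas into the spins
and swapped back afterwards. The swaps are local, and they leave the targets alone because no
control site is a target. -/
theorem Reachable.addFrom_ancilla {n : ℕ} {Φ : (S → Fin 2) → (S → Fin 2) → ℂ}
    (h : Reachable G 2 1 n (pairState Φ)) {T : Finset S} {p : S → S}
    (hadj : ∀ t ∈ T, G.Adj (p t) t) (hp : ∀ t ∈ T, p t ∉ T) (hinj : Set.InjOn p T) :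
    Reachable G 2 1 (n + 1) (pairState fun x a => Φ (addFrom T p a x) a) := by
  have hs := compOp_locMap_mem_LU (swapAt_involutive (T.image p))
  have := (((h.local hs).layer (compOp_addFrom_mem_Layer hadj hp hinj)).local hs)
  rw [compOp_locMap_mulVec, onSpins_mulVec_pairState, compOp_locMap_mulVec] at this
  simp only [compOp_mulVec] at this
  convert this using 2
  ext x a
  rw [Function.comp_apply]
  congr 1
  · ext i : 1
    by_cases hQ : i ∈ T.image p
    · have hi : i ∉ T := by
        rintro hi
        obtain ⟨t, ht, rfl⟩ := Finset.mem_image.1 hQ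
        exact hp t ht hi
      simp [addFrom, swapAt, hQ, hi]
    · by_cases hi : i ∈ T
      · have : p i ∈ T.image p := Finset.mem_image_of_mem p hi
        simp [addFrom, swapAt, hQ, hi, this]
      · simp [addFrom, swapAt, hQ, hi]
  · ext i : 1
    by_cases hQ : i ∈ T.image p
    · have hi : i ∉ T := by
        rintro hi
        obtain ⟨t, ht, rfl⟩ := Finset.mem_image.1 hQ
        exact hp t ht hi
      simp [addFrom, swapAt, hQ, hi]
    · simp [swapAt, hQ]

theorem Reachable.addFrom_spin {n : ℕ} {Φ : (S → Fin 2) → (S → Fin 2) → ℂ}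
    (h : Reachable G 2 1 n (pairState Φ)) {T : Finset S} {p : S → S}
    (hadj : ∀ t ∈ T, G.Adj (p t) t) (hp : ∀ t ∈ T, p t ∉ T) (hinj : Set.InjOn p T) :
    Reachable G 2 1 (n + 1) (pairState fun x a => Φ (addFrom T p x x) a) := by
  have := h.layer (compOp_addFrom_mem_Layer hadj hp hinj)
  rw [onSpins_mulVec_pairState] at this
  simpa only [compOp_mulVec, Function.comp_def] using this

/-- A CNOT from an ancilla to the spin of the same site is a local unitary and costs no depth. -/
theorem Reachable.addFrom_own {n : ℕ} {Φ : (S → Fin 2) → (S → Fin 2) → ℂ}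
    (h : Reachable G 2 1 n (pairState Φ)) (T : Finset S) :
    Reachable G 2 1 n (pairState fun x a => Φ (addFrom T id a x) a) := by
  have hF : ∀ i : S, Function.Involutive
      fun q : Fin 2 × Fin 2 => if i ∈ T then (q.1 + q.2, q.2) else q := by
    intro i q
    dsimp only
    split_ifs <;> simp [add_assoc, fin2_add_self]
  have := h.local (compOp_locMap_mem_LU hF)
  rw [compOp_locMap_mulVec] at this
  convert this using 2
  ext x a
  congr 1
  · ext i : 1
    simp only [addFrom, id]
    split_ifs <;> rfl
  · ext i : 1
    split_ifs <;> rfl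

/-! ### Ancilla operators -/

theorem mem_unitaryGroup_submatrix {κ ι : Type} [Fintype κ] [DecidableEq κ] [Fintype ι]
    [DecidableEq ι] (e : ι ≃ κ) {u : Matrix κ κ ℂ} (hu : u ∈ unitaryGroup κ ℂ) :
    u.submatrix e e ∈ unitaryGroup ι ℂ := by
  rw [mem_unitaryGroup_iff, star_eq_conjTranspose, conjTranspose_submatrix, submatrix_mul_equiv,
    ← star_eq_conjTranspose, mem_unitaryGroup_iff.1 hu, submatrix_one_equiv]

open scoped Kronecker in
/-- Hadamard gates on all ancillas. -/
noncomputable def hadAncillas (S : Type) [Fintype S] [DecidableEq S] :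
    Matrix (S → Loc 2 1) (S → Loc 2 1) ℂ :=
  tensorOp fun _ => (1 : Matrix (Fin 2) (Fin 2) ℂ) ⊗ₖ
    hadGate.submatrix (Equiv.funUnique (Fin 1) (Fin 2)) (Equiv.funUnique (Fin 1) (Fin 2))

theorem hadAncillas_mem_LU : hadAncillas S ∈ LU S (Loc 2 1) :=
  tensorOp_mem_LU fun _ => kronecker_mem_unitary (one_mem _)
    (mem_unitaryGroup_submatrix _ hadGate_mem_unitaryGroup)

theorem hadAncillas_mulVec (Φ : (S → Fin 2) → (S → Fin 2) → ℂ) :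
    hadAncillas S *ᵥ pairState Φ =
      pairState fun x a => hadamardScale S * ∑ b, sgn (a ⬝ᵥ b) * Φ x b := by
  ext x
  simp only [pairState, hadAncillas, mulVec, dotProduct, tensorOp, of_apply, kroneckerMap_apply]
  rw [Finset.mul_sum]
  symm
  refine Finset.sum_of_injOn (fun (b : S → Fin 2) i => ((x i).1, fun _ => b i)) ?_ ?_ ?_ ?_
  · intro b _ c _ hbc
    ext i
    have := congrFun (congrArg Prod.snd (congrFun hbc i)) 0
    simpa using congrArg Fin.val this
  · simp [Set.MapsTo]
  · intro z _ hz
    have : ∃ i, (x i).1 ≠ (z i).1 := by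
      by_contra! hh
      refine hz ⟨fun i => (z i).2 0, by simp, config_ext (funext hh) fun i => funext fun j => ?_⟩
      rw [Subsingleton.elim j 0]
    obtain ⟨i, hi⟩ := this
    rw [Finset.prod_eq_zero (Finset.mem_univ i), zero_mul]
    rw [one_apply_ne hi, zero_mul]
  · intro b _
    simp only [one_apply_eq, one_mul, submatrix_apply, Equiv.funUnique_apply]
    rw [← mul_assoc]
    congr 1
    have := tensorOp_hadGate_apply (fun i => (x i).2 0) b
    exact this.symm

/-! ### Preparation of subspace states -/

/-- The starting point of every preparation: spins at zero and ancillas in the uniform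
superposition, so that the amplitude does not depend on the ancilla bits. -/
theorem reachable_plus :
    Reachable G 2 1 0 (pairState fun x (_ : S → Fin 2) => hadamardScale S * if x = 0 then 1 else 0) := by
  have := (reachable_zero (G := G) (d := 2) (k := 1) (ℓ := 0)).local hadAncillas_mem_LU
  have h0 : withAnc (zeroSpins S 2) (zeroAnc S 2 1) =
      pairState fun x a => if x = 0 then if a = 0 then 1 else 0 else 0 := by
    ext x
    simp only [withAnc, zeroSpins, zeroAnc, pairState, funext_iff, Pi.zero_apply, Fin.forall_fin_one]
    by_cases h1 : ∀ i, (x i).1 = 0 <;> by_cases h2 : ∀ i, (x i).2 0 = 0 <;> simp [h1, h2]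
  rw [h0, hadAncillas_mulVec] at this
  convert this using 4 with x a
  by_cases hx : x = 0
  · simp [hx, sgn_zero]
  · simp [hx]

/-- The map `x ↦ x + δ a`, for ancillas in the configuration `a`, can be implemented with depth
`ℓ`. -/
def Realizes (G : SimpleGraph S) (ℓ : ℕ) (δ : (S → Fin 2) →ₗ[Fin 2] (S → Fin 2)) : Prop :=
  ∀ (n : ℕ) (Φ : (S → Fin 2) → (S → Fin 2) → ℂ), Reachable G 2 1 n (pairState Φ) →
    Reachable G 2 1 (n + ℓ) (pairState fun x a => Φ (x + δ a) a)

/-- The uniform superposition of the elements of the range of `δ` can be prepared. -/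
theorem Realizes.prepared [Nonempty S] {ℓ : ℕ} {δ : (S → Fin 2) →ₗ[Fin 2] (S → Fin 2)}
    (hδ : Realizes G ℓ δ) {V : Matrix (S → Fin 2) (S → Fin 2) ℂ} (hV : V ∈ LU S (Fin 2))
    {φ : (S → Fin 2) → ℂ} (hφ : ∑ x, ‖φ x‖ ^ 2 = 1) {c : ℂ}
    (hc : φ = c • (V *ᵥ indicator (LinearMap.range δ))) : PreparedByQCcc G 2 ℓ φ := by
  have hc0 : c ≠ 0 := by
    rintro rfl
    simp [hc] at hφ
  -- The final Hadamard gates turn the computational measurement of the ancillas into one in the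
  -- Hadamard basis.
  have h := (hδ 0 _ reachable_plus).local hadAncillas_mem_LU
  rw [hadAncillas_mulVec, Nat.zero_add] at h
  obtain ⟨κ, hκ, hsum⟩ := exists_sum_eq_smul_indicator δ
  refine h.prepared hφ fun α => ?_
  -- If the outcome is trivial on the kernel of `δ`, its sign is a function `z` of the spin
  -- configuration `δ a`, and `signOp z` cancels it.
  by_cases hα : ∀ a, δ a = 0 → (fun i => α i 0) ⬝ᵥ a = 0
  · obtain ⟨z, hz⟩ := exists_dotProduct_eq δ hα
    refine ⟨V * signOp z, mul_mem_LU hV (signOp_mem_LU z),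
      hadamardScale S * hadamardScale S * κ * c⁻¹, ?_⟩
    have : (signOp z *ᵥ fun x => pairState (fun x a => hadamardScale S * ∑ b, sgn (a ⬝ᵥ b) *
        (hadamardScale S * if x + δ b = 0 then 1 else 0)) fun i => (x i, α i)) =
        (hadamardScale S * hadamardScale S * κ) • indicator (LinearMap.range δ) := by
      rw [mul_smul, ← hsum]
      ext x
      simp only [signOp, mulVec_diagonal, pairState, hz, Pi.smul_apply, smul_eq_mul,
        Finset.mul_sum]
      refine Finset.sum_congr rfl fun b _ => ?_
      change sgn (z ⬝ᵥ x) * (hadamardScale S * (sgn (z ⬝ᵥ δ b) *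
        (hadamardScale S * if x + δ b = 0 then 1 else 0))) = _
      by_cases hx : x = δ b
      · rw [if_pos (fin2_add_eq_zero_iff.2 hx), if_pos hx, hx]
        linear_combination (hadamardScale S * hadamardScale S) * sgn_mul_self (z ⬝ᵥ δ b)
      · rw [if_neg (mt fin2_add_eq_zero_iff.1 hx), if_neg hx]
        simp
    rw [← mulVec_mulVec, this, mulVec_smul, hc, smul_smul, mul_assoc _ _ c, inv_mul_cancel₀ hc0,
      mul_one]
  -- Otherwise translation by a kernel element with sign -1 leaves the spin configuration fixed and
  -- negates the amplitude, so this outcome has probability zero.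
  · push Not at hα
    obtain ⟨a, ha, hne⟩ := hα
    refine ⟨1, one_mem_LU, 0, ?_⟩
    rw [one_mulVec, zero_smul]
    ext x
    simp only [pairState, Pi.zero_apply, mul_eq_zero]
    right
    set m : S → Fin 2 := fun i => α i 0
    have key := Equiv.sum_comp (Equiv.addRight a) fun b =>
      sgn (m ⬝ᵥ b) * (hadamardScale S * if x + δ b = 0 then 1 else 0)
    have h1 : m ⬝ᵥ a = 1 := (fin2_eq_zero_or_one _).resolve_left hne
    simp only [Equiv.coe_addRight, map_add, ha, add_zero, dotProduct_add, sgn_add, h1, sgn_one,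
      mul_neg, mul_one, neg_mul, Finset.sum_neg_distrib] at key
    exact self_eq_neg.1 key.symm

end Networks

/-! ### Clifford combinations of bit flips, and their implementation from a resource state -/

section TranslationInvariant

attribute [local instance] fin2CommRing

variable {S : Type} [Fintype S] [DecidableEq S] {G : SimpleGraph S}

/-! ### Pauli strings -/

theorem shiftOp_mul (γ δ : S → Fin 2) : shiftOp γ * shiftOp δ = shiftOp (γ + δ) := by
  rw [shiftOp, shiftOp, shiftOp, compOp_mul]
  congr 1
  ext x i : 2
  simp [add_assoc]

theorem shiftOp_zero : shiftOp (0 : S → Fin 2) = 1 := by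
  rw [shiftOp, ← compOp_id]
  congr 1
  ext x i : 2
  simp

theorem shiftOp_mul_self (γ : S → Fin 2) : shiftOp γ * shiftOp γ = 1 := by
  rw [shiftOp_mul, fin2_pi_add_self, shiftOp_zero]

theorem shiftOp_mul_signOp_apply (γ β x y : S → Fin 2) :
    (shiftOp γ * signOp β) x y = if y = x + γ then sgn (β ⬝ᵥ y) else 0 := by
  simp [signOp, shiftOp, compOp, mul_diagonal]

/-- The translation part of a Pauli matrix. -/
def pauliShift : Fin 4 → Fin 2 := ![0, 1, 1, 0]

/-- The sign part of a Pauli matrix. -/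
def pauliSign : Fin 4 → Fin 2 := ![0, 0, 1, 1]

/-- The phase of a Pauli matrix. -/
noncomputable def pauliPhase : Fin 4 → ℂ := ![1, 1, Complex.I, 1]

theorem pauli_apply (s : Fin 4) (a b : Fin 2) :
    pauli s a b = pauliPhase s * if b = a + pauliShift s then sgn (pauliSign s * b) else 0 := by
  fin_cases s <;> fin_cases a <;> fin_cases b <;>
    simp [pauli, pauliPhase, pauliShift, pauliSign, sgn]

theorem pauliPhase_ne_zero (s : Fin 4) : pauliPhase s ≠ 0 := by
  fin_cases s <;> simp [pauliPhase]

/-- Pauli strings are translations times characters up to a phase, so the Clifford property can be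
tested on these two kinds of operators. -/
theorem pauliString_eq (s : S → Fin 4) :
    pauliString s = (∏ i, pauliPhase (s i)) •
      (shiftOp (fun i => pauliShift (s i)) * signOp fun i => pauliSign (s i)) := by
  ext x y
  rw [Matrix.smul_apply, shiftOp_mul_signOp_apply, sgn_dotProduct, pauliString, tensorOp, of_apply]
  simp only [pauli_apply, Finset.prod_mul_distrib, smul_eq_mul]
  rw [Finset.prod_ite_zero]
  simp [funext_iff]

theorem exists_shiftOp_mul_signOp_eq (γ β : S → Fin 2) :
    ∃ (s : S → Fin 4) (c : ℂ), shiftOp γ * signOp β = c • pauliString s := by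
  have : ∀ a b : Fin 2, ∃ s, pauliShift s = a ∧ pauliSign s = b := by decide
  choose s h1 h2 using fun i => this (γ i) (β i)
  refine ⟨s, (∏ i, pauliPhase (s i))⁻¹, ?_⟩
  rw [pauliString_eq, smul_smul, inv_mul_cancel₀, one_smul]
  · simp only [h1, h2]
  · exact Finset.prod_ne_zero_iff.2 fun i _ => pauliPhase_ne_zero _

theorem pauliString_shift (T : Finset S) :
    (pauliString fun i => if i ∈ T then 1 else 0) = shiftOp fun i => if i ∈ T then 1 else 0 := by
  have h1 : ∀ i, pauliPhase (if i ∈ T then 1 else 0) = 1 := fun i => by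
    split_ifs <;> simp [pauliPhase]
  have h2 : (fun i => pauliShift (if i ∈ T then 1 else 0)) = fun i => if i ∈ T then 1 else 0 := by
    ext i : 1
    split_ifs <;> simp [pauliShift]
  have h3 : (fun i => pauliSign (if i ∈ T then 1 else 0)) = 0 := by
    ext i : 1
    split_ifs <;> simp [pauliSign]
  rw [pauliString_eq, h2, h3]
  simp only [h1, Finset.prod_const_one, one_smul]
  have : signOp (0 : S → Fin 2) = 1 := by
    rw [signOp, ← diagonal_one]
    congr 1
    ext x
    rw [zero_dotProduct, sgn_zero]
  rw [this, Matrix.mul_one]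

/-! ### Translation-invariant operators -/

/-- The operator `∑ a, φ a X^a`. -/
def convOp (φ : (S → Fin 2) → ℂ) : Matrix (S → Fin 2) (S → Fin 2) ℂ :=
  Matrix.of fun x y => φ (x + y)

/-- Multiplication of `φ` by a character has the same effect as a translation, up to a factor. -/
def IsQuadratic (φ : (S → Fin 2) → ℂ) : Prop :=
  ∀ β : S → Fin 2, ∃ (γ : S → Fin 2) (c : ℂ), ∀ t, sgn (β ⬝ᵥ t) * φ t = c * φ (t + γ)

theorem convOp_mul_shiftOp (φ : (S → Fin 2) → ℂ) (γ : S → Fin 2) :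
    convOp φ * shiftOp γ = shiftOp γ * convOp φ := by
  ext x y
  have h : ∀ z : S → Fin 2, y = z + γ ↔ z = y + γ := by
    intro z
    constructor <;> rintro rfl <;> rw [add_assoc, fin2_pi_add_self, add_zero]
  simp only [convOp, shiftOp, compOp, Matrix.mul_apply, of_apply, ite_mul, one_mul, zero_mul,
    mul_ite, mul_one, mul_zero, h, Finset.sum_ite_eq', Finset.mem_univ, if_true]
  congr 1
  abel

/-- Moving Z^β past X^a produces the sign (-1)^(β·a), that is, φ gets multiplied by a character; by
hypothesis this amounts to a translation of φ, which factors out as X^γ. -/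
theorem signOp_mul_convOp {φ : (S → Fin 2) → ℂ} {β γ : S → Fin 2} {c : ℂ}
    (h : ∀ t, sgn (β ⬝ᵥ t) * φ t = c * φ (t + γ)) :
    signOp β * convOp φ = c • (convOp φ * (shiftOp γ * signOp β)) := by
  rw [← Matrix.mul_assoc, convOp_mul_shiftOp]
  ext x y
  rw [signOp, diagonal_mul, Matrix.smul_apply, mul_diagonal]
  simp only [convOp, shiftOp, compOp, Matrix.mul_apply, of_apply, ite_mul, one_mul, zero_mul,
    Finset.sum_ite_eq', Finset.mem_univ, if_true, smul_eq_mul]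
  have h1 := h (x + y)
  rw [dotProduct_add, sgn_add, show x + y + γ = x + γ + y by abel] at h1
  linear_combination sgn (β ⬝ᵥ y) * h1 - sgn (β ⬝ᵥ x) * φ (x + y) * sgn_mul_self (β ⬝ᵥ y)

theorem convOp_conj_signOp {φ : (S → Fin 2) → ℂ} (hU : convOp φ ∈ unitaryGroup (S → Fin 2) ℂ)
    {β γ : S → Fin 2} {c : ℂ} (h : ∀ t, sgn (β ⬝ᵥ t) * φ t = c * φ (t + γ)) :
    (convOp φ)ᴴ * signOp β * convOp φ = c • (shiftOp γ * signOp β) := by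
  rw [Matrix.mul_assoc, signOp_mul_convOp h, mul_smul_comm, ← Matrix.mul_assoc,
    ← star_eq_conjTranspose, mem_unitaryGroup_iff'.1 hU, Matrix.one_mul]

/-- The X part of a Pauli string commutes with the operator, and the Z part only acquires a further
X part. -/
theorem convOp_isClifford {φ : (S → Fin 2) → ℂ} (hU : convOp φ ∈ unitaryGroup (S → Fin 2) ℂ)
    (hφ : IsQuadratic φ) : IsClifford (convOp φ) := by
  refine ⟨hU, fun s => ?_⟩
  rw [pauliString_eq]
  generalize (∏ i, pauliPhase (s i)) = e
  generalize (fun i => pauliShift (s i)) = δ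
  generalize (fun i => pauliSign (s i)) = β
  obtain ⟨γ, c, h⟩ := hφ β
  obtain ⟨s', c', h'⟩ := exists_shiftOp_mul_signOp_eq (δ + γ) β
  refine ⟨s', e * (c * c'), ?_⟩
  rw [mul_smul, mul_smul, ← h', mul_smul_comm, smul_mul_assoc]
  congr 1
  rw [Matrix.mul_assoc, Matrix.mul_assoc (shiftOp δ), signOp_mul_convOp h, mul_smul_comm,
    ← Matrix.mul_assoc (shiftOp δ), ← convOp_mul_shiftOp, mul_smul_comm]
  congr 1
  rw [← shiftOp_mul, Matrix.mul_assoc (convOp φ), ← Matrix.mul_assoc, ← star_eq_conjTranspose,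
    mem_unitaryGroup_iff'.1 hU, Matrix.one_mul, Matrix.mul_assoc]

/-- The circuit that applies `V` to the ancillas, adds the ancillas to the spins, and applies
Hadamard gates to the ancillas. -/
theorem exists_circuit_of_QC {ℓ : ℕ} {V : Matrix (S → Fin 2) (S → Fin 2) ℂ}
    (hV : V ∈ QC G 2 ℓ) : ∃ V' ∈ QCAnc G 2 1 ℓ, ∀ ψ φ : (S → Fin 2) → ℂ,
      V' *ᵥ (pairState fun x a => ψ x * φ a) = pairState fun x a =>
        hadamardScale S * ∑ b, sgn (a ⬝ᵥ b) * (ψ (x + b) * (V *ᵥ φ) b) := by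
  have hadd : ∀ _ : S, Function.Involutive fun q : Fin 2 × Fin 2 => (q.1 + q.2, q.2) := by
    intro i q
    simp [add_assoc, fin2_add_self]
  have hs := compOp_locMap_mem_LU (swapAt_involutive (Finset.univ : Finset S))
  -- The order of operations is: swap, `V` on the spins, swap back, add ancillas to spins, Hadamard.
  -- All but `V` are local, so the depth is that of `V`.
  have hF := mul_mem_LU hadAncillas_mem_LU (mul_mem_LU (compOp_locMap_mem_LU hadd) hs)
  refine ⟨_, mul_mem_QCAnc hF (onSpins_QC_mul_mem_QCAnc hV hs), fun ψ φ => ?_⟩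
  rw [← mulVec_mulVec, ← mulVec_mulVec, ← mulVec_mulVec, ← mulVec_mulVec,
    compOp_locMap_mulVec, onSpins_mulVec_pairState, compOp_locMap_mulVec,
    compOp_locMap_mulVec, hadAncillas_mulVec]
  simp only [swapAt, Finset.mem_univ, if_true, Prod.swap]
  congr 1
  ext x a
  congr 1
  refine Finset.sum_congr rfl fun b _ => ?_
  congr 1
  have : (fun y : S → Fin 2 => ψ (x + b) * φ y) = ψ (x + b) • φ := rfl
  exact (congrFun (congrArg _ this) b).trans (congrFun (mulVec_smul V (ψ (x + b)) φ) b)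

/-- A translation-invariant operator with a quadratic symbol `φ` consumes the state `φ`, to which
a circuit can be applied before. -/
theorem convOp_mem_QCcc {ℓ : ℕ} {φ : (S → Fin 2) → ℂ} (hprep : PreparedByQCcc G 2 ℓ φ)
    {V : Matrix (S → Fin 2) (S → Fin 2) ℂ} (hV : V ∈ QC G 2 ℓ)
    (hU : convOp (V *ᵥ φ) ∈ unitaryGroup (S → Fin 2) ℂ) (hφ : IsQuadratic (V *ᵥ φ)) :
    convOp (V *ᵥ φ) ∈ QCcc G 2 ℓ := by
  obtain ⟨V', hV', h⟩ := exists_circuit_of_QC hV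
  choose γ c hγ using hφ
  refine ⟨hU, φ, hprep, 0, V', hV', fun _ => 1, fun _ => one_mem _,
    fun α => shiftOp (γ fun i => α i 0), fun α => shiftOp_mem_LU _, fun α =>
    ⟨hadamardScale S * c fun i => α i 0, fun ψ => ?_⟩⟩
  have h0 : withAnc ψ (loadAnc 0 φ) = pairState fun x a => ψ x * φ a := by
    ext x
    simp [withAnc, loadAnc, pairState]
  rw [braAnc_one, h0]
  set m : S → Fin 2 := fun i => α i 0 with hm
  -- The outcome `m` multiplies the symbol by the character `m`, so the spins carry a translate of
  -- the desired vector. The translation `γ m` depends only on the outcome, not on the input `ψ`.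
  have key : (fun x : S → Fin 2 => (V' *ᵥ pairState fun x a => ψ x * φ a) fun i => (x i, α i)) =
      (hadamardScale S * c m) • (shiftOp (γ m) *ᵥ (convOp (V *ᵥ φ) *ᵥ ψ)) := by
    ext x
    rw [h ψ φ, shiftOp, compOp_mulVec, Pi.smul_apply, smul_eq_mul, mul_assoc]
    change hadamardScale S * ∑ b, sgn (m ⬝ᵥ b) * (ψ (x + b) * (V *ᵥ φ) b) =
      hadamardScale S * (c m * ∑ y, (V *ᵥ φ) (x + γ m + y) * ψ y)
    congr 1
    -- The substitution b = x + y makes the sum an application of the convolution operator.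
    rw [← Equiv.sum_comp (Equiv.addLeft x), Finset.mul_sum]
    refine Finset.sum_congr rfl fun y _ => ?_
    have h2 := hγ m (x + y)
    rw [Equiv.coe_addLeft, ← add_assoc, fin2_pi_add_self, zero_add, add_right_comm x (γ m) y]
    linear_combination ψ y * h2
  exact (congrArg _ key).trans (by
    rw [mulVec_smul, mulVec_mulVec, shiftOp_mul_self, one_mulVec])

end TranslationInvariant

section LightCone

variable {S : Type} [Fintype S] [DecidableEq S] {G : SimpleGraph S} {d : ℕ}

/-! ### Light cones -/

/-- The algebra generated by the operators acting on one or two sites in `R`. -/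
def localAlg (d : ℕ) (R : Set S) : Subalgebra ℂ (Matrix (S → Fin d) (S → Fin d) ℂ) :=
  Algebra.adjoin ℂ {A | ∃ i ∈ R, ∃ j ∈ R, ∃ g, A = twoSite i j g}

theorem twoSite_mem_localAlg {R : Set S} {i j : S} (hi : i ∈ R) (hj : j ∈ R)
    (g : Matrix (Fin d × Fin d) (Fin d × Fin d) ℂ) : twoSite i j g ∈ localAlg d R :=
  Algebra.subset_adjoin ⟨i, hi, j, hj, g, rfl⟩

theorem localAlg_mono {R R' : Set S} (h : R ⊆ R') : localAlg d R ≤ localAlg d R' :=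
  Algebra.adjoin_mono fun _ ⟨i, hi, j, hj, g, hA⟩ => ⟨i, h hi, j, h hj, g, hA⟩

theorem twoSite_mul_apply {i j k l : S} (hik : i ≠ k) (hil : i ≠ l) (hjk : j ≠ k) (hjl : j ≠ l)
    (g h : Matrix (Fin d × Fin d) (Fin d × Fin d) ℂ) (x y : S → Fin d) :
    (twoSite i j g * twoSite k l h) x y =
      if ∀ m, m ≠ i → m ≠ j → m ≠ k → m ≠ l → x m = y m then
        g (x i, x j) (y i, y j) * h (x k, x l) (y k, y l) else 0 := by
  simp only [twoSite, Matrix.mul_apply, of_apply]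
  rw [Finset.sum_eq_single fun m => if m = i ∨ m = j then y m else x m]
  · have h1 : ∀ m, m ≠ i → m ≠ j → x m = if m = i ∨ m = j then y m else x m := by
      intro m hi hj; rw [if_neg (not_or.2 ⟨hi, hj⟩)]
    rw [if_pos h1]
    simp only [true_or, or_true, if_true, if_neg (not_or.2 ⟨hik.symm, hjk.symm⟩),
      if_neg (not_or.2 ⟨hil.symm, hjl.symm⟩)]
    rw [mul_ite, mul_zero]
    refine if_congr ⟨fun hh m hi hj hk hl => ?_, fun hh m hk hl => ?_⟩ rfl rfl
    · simpa [hi, hj] using hh m hk hl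
    · by_cases hij : m = i ∨ m = j
      · rw [if_pos hij]
      · rw [if_neg hij]
        exact hh m (not_or.1 hij).1 (not_or.1 hij).2 hk hl
  · intro z _ hz
    by_cases h1 : ∀ m, m ≠ i → m ≠ j → x m = z m
    · have h2 : ¬∀ m, m ≠ k → m ≠ l → z m = y m := by
        intro h2
        refine hz (funext fun m => ?_)
        split_ifs with hm
        · rcases hm with rfl | rfl
          · exact h2 _ hik hil
          · exact h2 _ hjk hjl
        · exact (h1 m (not_or.1 hm).1 (not_or.1 hm).2).symm
      rw [if_neg h2, mul_zero]
    · rw [if_neg h1, zero_mul]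
  · simp

theorem twoSite_commute {i j k l : S} (hik : i ≠ k) (hil : i ≠ l) (hjk : j ≠ k) (hjl : j ≠ l)
    (g h : Matrix (Fin d × Fin d) (Fin d × Fin d) ℂ) :
    Commute (twoSite i j g) (twoSite k l h) := by
  ext x y
  rw [twoSite_mul_apply hik hil hjk hjl,
    twoSite_mul_apply hik.symm hjk.symm hil.symm hjl.symm, mul_comm]
  exact if_congr ⟨fun hh m hk hl hi hj => hh m hi hj hk hl,
    fun hh m hi hj hk hl => hh m hk hl hi hj⟩ rfl rfl

theorem commute_twoSite_of_mem_localAlg {R : Set S} {i j : S} (hi : i ∉ R) (hj : j ∉ R)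
    (g : Matrix (Fin d × Fin d) (Fin d × Fin d) ℂ) {A : Matrix (S → Fin d) (S → Fin d) ℂ}
    (hA : A ∈ localAlg d R) : Commute A (twoSite i j g) := by
  have : localAlg d R ≤ Subalgebra.centralizer ℂ {twoSite i j g} := by
    refine Algebra.adjoin_le ?_
    rintro _ ⟨k, hk, l, hl, h, rfl⟩
    rw [SetLike.mem_coe, Subalgebra.mem_centralizer_iff]
    rintro _ rfl
    have hne : ∀ {a b : S}, a ∉ R → b ∈ R → a ≠ b := fun ha hb h => ha (h ▸ hb)
    exact (twoSite_commute (hne hi hk) (hne hi hl) (hne hj hk) (hne hj hl) _ _).eq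
  have := Subalgebra.mem_centralizer_iff ℂ |>.1 (this hA) _ rfl
  exact this.symm

/-- Conjugation by one gate. -/
theorem Gate.conj_mem_localAlg (g : Gate G d) {R : Set S}
    {A : Matrix (S → Fin d) (S → Fin d) ℂ} (hA : A ∈ localAlg d R) :
    (twoSite g.fst g.snd g.op)ᴴ * A * twoSite g.fst g.snd g.op ∈
      localAlg d (R ∪ {x | (g.fst ∈ R ∨ g.snd ∈ R) ∧ (x = g.fst ∨ x = g.snd)}) := by
  by_cases h : g.fst ∈ R ∨ g.snd ∈ R
  · have h1 : g.fst ∈ R ∪ {x | (g.fst ∈ R ∨ g.snd ∈ R) ∧ (x = g.fst ∨ x = g.snd)} :=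
      Or.inr ⟨h, Or.inl rfl⟩
    have h2 : g.snd ∈ R ∪ {x | (g.fst ∈ R ∨ g.snd ∈ R) ∧ (x = g.fst ∨ x = g.snd)} :=
      Or.inr ⟨h, Or.inr rfl⟩
    rw [twoSite_conjTranspose]
    exact mul_mem (mul_mem (twoSite_mem_localAlg h1 h2 _)
      (localAlg_mono Set.subset_union_left hA)) (twoSite_mem_localAlg h1 h2 _)
  · have hc := commute_twoSite_of_mem_localAlg (not_or.1 h).1 (not_or.1 h).2 g.op hA
    rw [Matrix.mul_assoc, hc.eq, ← Matrix.mul_assoc, ← star_eq_conjTranspose,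
      mem_unitaryGroup_iff'.1 g.mem_unitaryGroup, Matrix.one_mul]
    exact localAlg_mono Set.subset_union_left hA

/-- Conjugation by a list of gates on disjoint pairs. -/
theorem conj_gates_mem_localAlg {L : List (Gate G d)} (hL : L.Pairwise Gate.Apart) {R : Set S}
    {A : Matrix (S → Fin d) (S → Fin d) ℂ} (hA : A ∈ localAlg d R) :
    ((L.map fun g => twoSite g.fst g.snd g.op).prod)ᴴ * A *
        (L.map fun g => twoSite g.fst g.snd g.op).prod ∈
      localAlg d (R ∪ {x | ∃ g ∈ L, (g.fst ∈ R ∨ g.snd ∈ R) ∧ (x = g.fst ∨ x = g.snd)}) := by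
  induction L generalizing R A with
  | nil => simpa using hA
  | cons g L ih =>
    obtain ⟨h1, h2⟩ := List.pairwise_cons.1 hL
    have := ih h2 (g.conj_mem_localAlg hA)
    rw [List.map_cons, List.prod_cons, conjTranspose_mul]
    refine localAlg_mono ?_ (by simpa only [Matrix.mul_assoc] using this)
    rintro x ((hx | ⟨hg, hx⟩) | ⟨g', hg', hR, hx⟩)
    · exact Or.inl hx
    · exact Or.inr ⟨g, List.mem_cons_self, hg, hx⟩
    · obtain ⟨ha, hb, hc, hd⟩ := h1 g' hg'
      refine Or.inr ⟨g', List.mem_cons_of_mem _ hg', ?_, hx⟩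
      rcases hR with (h | ⟨-, h | h⟩) | (h | ⟨-, h | h⟩)
      · exact Or.inl h
      · exact absurd h.symm ha
      · exact absurd h.symm hc
      · exact Or.inr h
      · exact absurd h.symm hb
      · exact absurd h.symm hd

/-- The light cone of a circuit, in terms of a function that varies by at most one along edges. -/
theorem QC_conj_mem_localAlg {f : S → ℕ} (hf : ∀ i j, G.Adj i j → f i ≤ f j + 1) {n : ℕ} :
    ∀ {W : Matrix (S → Fin d) (S → Fin d) ℂ}, W ∈ QC G d n →
    ∀ {m : ℕ} {A : Matrix (S → Fin d) (S → Fin d) ℂ}, A ∈ localAlg d {x | m + n ≤ f x} →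
      Wᴴ * A * W ∈ localAlg d {x | m ≤ f x} := by
  induction n with
  | zero =>
    intro W hW m A hA
    rw [Set.mem_singleton_iff.1 hW]
    simpa using hA
  | succ n ih =>
    rintro W ⟨V, ⟨L, hL, rfl⟩, W', hW', rfl⟩ m A hA
    have h1 := conj_gates_mem_localAlg hL hA
    have h2 := ih hW' (m := m) (localAlg_mono (fun x hx => ?_) h1)
    · rw [conjTranspose_mul]
      simpa only [Matrix.mul_assoc] using h2
    · rcases hx with hx | ⟨g, -, hg, hx⟩
      · simp only [Set.mem_ofPred_eq] at hx ⊢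
        omega
      · have ha := hf _ _ g.adj
        have hb := hf _ _ g.adj.symm
        simp only [Set.mem_ofPred_eq] at hg hx ⊢
        rcases hx with rfl | rfl <;> omega

/-- In the first layer, the light cone of a site grows by at most one site. -/
theorem exists_conj_mem_localAlg {n : ℕ} {W : Matrix (S → Fin d) (S → Fin d) ℂ}
    (hW : W ∈ QC G d (n + 1)) (i : S) : ∃ j, (j = i ∨ G.Adj i j) ∧
      ∀ f : S → ℕ, (∀ i j, G.Adj i j → f i ≤ f j + 1) → n + 1 ≤ f i → n + 1 ≤ f j →
        ∀ g, Wᴴ * twoSite i i g * W ∈ localAlg d {x | 1 ≤ f x} := by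
  obtain ⟨V, ⟨L, hL, rfl⟩, W', hW', rfl⟩ := hW
  -- At most one gate of a layer touches `i`; j is its other end, or `i` itself if there is no such
  -- gate.
  have key : ∃ j, (j = i ∨ G.Adj i j) ∧
      ∀ g ∈ L, (g.fst = i ∨ g.snd = i) → (g.fst = i ∨ g.fst = j) ∧ (g.snd = i ∨ g.snd = j) := by
    by_cases h : ∃ g ∈ L, g.fst = i ∨ g.snd = i
    · obtain ⟨g, hg, hi⟩ := h
      have huniq : ∀ g' ∈ L, (g'.fst = i ∨ g'.snd = i) → g' = g := by
        intro g' hg' hi'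
        by_contra hne
        have : Std.Symm (Gate.Apart (G := G) (d := d)) :=
          ⟨fun a b h => ⟨h.1.symm, h.2.2.1.symm, h.2.1.symm, h.2.2.2.symm⟩⟩
        have hap := hL.forall hg' hg hne
        obtain ⟨ha, hb, hc, hd⟩ := hap
        rcases hi with h | h <;> rcases hi' with h' | h' <;> simp_all
      rcases hi with h | h
      · exact ⟨g.snd, Or.inr (h ▸ g.adj), fun g' hg' hi' => by
          rw [huniq g' hg' hi']; exact ⟨Or.inl h, Or.inr rfl⟩⟩
      · exact ⟨g.fst, Or.inr (h ▸ g.adj.symm), fun g' hg' hi' => by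
          rw [huniq g' hg' hi']; exact ⟨Or.inr rfl, Or.inl h⟩⟩
    · exact ⟨i, Or.inl rfl, fun g hg hi => absurd ⟨g, hg, hi⟩ h⟩
  obtain ⟨j, hj, hcov⟩ := key
  refine ⟨j, hj, fun f hf hi hfj g => ?_⟩
  have h1 := conj_gates_mem_localAlg hL
    (twoSite_mem_localAlg (Set.mem_singleton i) (Set.mem_singleton i) g)
  have h2 := QC_conj_mem_localAlg hf hW' (m := 1) (localAlg_mono (fun x hx => ?_) h1)
  · rw [conjTranspose_mul]
    simpa only [Matrix.mul_assoc] using h2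
  · simp only [Set.mem_ofPred_eq]
    rcases hx with rfl | ⟨g', hg', ht, hx⟩
    · omega
    · obtain ⟨h3, h4⟩ := hcov g' hg' ht
      rcases hx with rfl | rfl
      · rcases h3 with h | h <;> rw [h] <;> omega
      · rcases h4 with h | h <;> rw [h] <;> omega

attribute [local instance] fin2CommRing

theorem signOp_single (i : S) : signOp (Pi.single i 1) =
    twoSite i i (diagonal fun p : Fin 2 × Fin 2 => sgn p.1) := by
  ext x y
  simp only [signOp, twoSite, of_apply, diagonal_apply, single_one_dotProduct, Prod.mk.injEq,
    and_self]
  rw [← ite_and]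
  refine if_congr ⟨?_, fun h => funext fun m => ?_⟩ rfl rfl
  · rintro rfl; simp
  · by_cases hm : m = i
    · rw [hm, h.2]
    · exact h.1 m hm hm

/-- An operator that moves the bit at `y` does not act trivially on this site. -/
theorem shift_eq_zero_of_mem_localAlg {R : Set S} {γ β : S → Fin 2} {c : ℂ} (hc : c ≠ 0)
    (h : c • (shiftOp γ * signOp β) ∈ localAlg 2 R) {y : S} (hy : y ∉ R) : γ y = 0 := by
  have hcomm := commute_twoSite_of_mem_localAlg hy hy (diagonal fun p => sgn p.1) h
  rw [← signOp_single] at hcomm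
  -- At the entry (0, γ) the operator is nonzero, and commuting with Z at `y` forces (-1)^(γ y) = 1
  -- there.
  have := congrFun (congrFun hcomm.eq 0) γ
  rw [signOp.eq_1 (Pi.single y 1), mul_diagonal, diagonal_mul, Matrix.smul_apply, shiftOp_mul_signOp_apply,
    if_pos (zero_add γ).symm, dotProduct_zero, sgn_zero, one_mul, smul_eq_mul,
    single_one_dotProduct] at this
  have h1 : sgn (γ y) = 1 := by
    refine mul_left_cancel₀ (mul_ne_zero hc (sgn_ne_zero (β ⬝ᵥ γ))) ?_
    rw [this, mul_one]
  refine (fin2_eq_zero_or_one _).resolve_right fun h2 => ?_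
  rw [h2, sgn_one] at h1
  norm_num at h1

end LightCone

section GHZ

attribute [local instance] fin2CommRing

variable {S : Type} [Fintype S] [DecidableEq S] {G : SimpleGraph S}

/-! ### GHZ unitaries -/

/-- The configuration with ones on `T`. -/
def onesOn (T : Finset S) : S → Fin 2 := fun i => if i ∈ T then 1 else 0

theorem onesOn_ne_zero {T : Finset S} (hT : T.Nonempty) : onesOn T ≠ 0 := by
  obtain ⟨i, hi⟩ := hT
  intro h
  have := congrFun h i
  simp [onesOn, hi] at this

/-- The GHZ state `(|0⟩ + i |1⟩) / √2` on `T`, with zeros elsewhere. -/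
noncomputable def ghzVec (T : Finset S) : (S → Fin 2) → ℂ := fun t =>
  ((Real.sqrt 2 : ℝ) : ℂ)⁻¹ * if t = 0 then 1 else if t = onesOn T then Complex.I else 0

theorem convOp_ghzVec {T : Finset S} (hT : T.Nonempty) :
    convOp (ghzVec T) =
      ((Real.sqrt 2 : ℝ) : ℂ)⁻¹ • (1 + Complex.I • shiftOp (onesOn T)) := by
  ext x y
  simp only [convOp, ghzVec, shiftOp, compOp, Matrix.smul_apply, Matrix.add_apply, of_apply,
    smul_eq_mul, Matrix.one_apply]
  congr 1
  have h0 := onesOn_ne_zero hT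
  have h1 : ∀ γ : S → Fin 2, x + y = γ ↔ y = x + γ := by
    intro γ
    constructor
    · rintro rfl; rw [← add_assoc, fin2_pi_add_self, zero_add]
    · rintro rfl; rw [← add_assoc, fin2_pi_add_self, zero_add]
  simp only [h1, add_zero]
  by_cases hxy : y = x
  · subst hxy; simp [h0]
  · simp [hxy, Ne.symm hxy]

theorem UGHZ_eq_convOp [Nonempty S] : UGHZ S = convOp (ghzVec Finset.univ) := by
  rw [convOp_ghzVec Finset.univ_nonempty, UGHZ]
  congr 3
  change _ = shiftOp fun i => if i ∈ (Finset.univ : Finset S) then 1 else 0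
  simpa using pauliString_shift (Finset.univ : Finset S)

theorem conjTranspose_shiftOp (γ : S → Fin 2) : (shiftOp γ)ᴴ = shiftOp γ := by
  ext x y
  simp only [shiftOp, compOp, conjTranspose_apply, of_apply, apply_ite star, star_one, star_zero]
  refine if_congr ?_ rfl rfl
  constructor <;> rintro rfl <;> rw [add_assoc, fin2_pi_add_self, add_zero]

theorem convOp_ghzVec_mem_unitaryGroup {T : Finset S} (hT : T.Nonempty) :
    convOp (ghzVec T) ∈ unitaryGroup (S → Fin 2) ℂ := by
  have h1 : star (((Real.sqrt 2 : ℝ) : ℂ)⁻¹) = ((Real.sqrt 2 : ℝ) : ℂ)⁻¹ := by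
    rw [star_inv₀]; simp
  rw [mem_unitaryGroup_iff, convOp_ghzVec hT, star_eq_conjTranspose, conjTranspose_smul,
    conjTranspose_add, conjTranspose_smul, conjTranspose_shiftOp, conjTranspose_one, h1,
    smul_mul_smul_comm, inv_sqrt_two_mul_self]
  have h2 : (1 + Complex.I • shiftOp (onesOn T)) * (1 + star Complex.I • shiftOp (onesOn T)) =
      (2 : ℂ) • (1 : Matrix (S → Fin 2) (S → Fin 2) ℂ) := by
    have : Complex.I * star Complex.I = 1 := by simp
    rw [add_mul, mul_add, mul_add, smul_mul_smul_comm, shiftOp_mul_self, this]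
    have : star Complex.I = -Complex.I := by simp
    rw [this]
    simp only [Matrix.one_mul, Matrix.mul_one, neg_smul, one_smul, two_smul]
    abel
  rw [h2, smul_smul, inv_mul_cancel₀ two_ne_zero, one_smul]

/-- The sign takes the amplitudes (1, i) to (1, -i) = -i (i, 1), which is an exchange of the two
branches. The relative phase i is what makes this possible. -/
theorem ghzVec_mul_sgn {T : Finset S} (hT : T.Nonempty) {β : S → Fin 2}
    (hβ : β ⬝ᵥ onesOn T = 1) (t : S → Fin 2) :
    sgn (β ⬝ᵥ t) * ghzVec T t = -Complex.I * ghzVec T (t + onesOn T) := by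
  have h0 := onesOn_ne_zero hT
  unfold ghzVec
  by_cases h1 : t = 0
  · subst h1
    rw [if_pos rfl, zero_add, if_neg h0, if_pos rfl, dotProduct_zero, sgn_zero]
    linear_combination ((Real.sqrt 2 : ℝ) : ℂ)⁻¹ * Complex.I_mul_I
  · by_cases h2 : t = onesOn T
    · subst h2
      rw [if_neg h0, if_pos rfl, fin2_pi_add_self, if_pos rfl, hβ, sgn_one]
      ring
    · have h3 : t + onesOn T ≠ 0 := fun h => h2 (fin2_add_eq_zero_iff.1 h)
      have h4 : t + onesOn T ≠ onesOn T := fun h => h1 (by simpa using h)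
      rw [if_neg h1, if_neg h2, if_neg h3, if_neg h4]
      ring

theorem ghzVec_isQuadratic {T : Finset S} (hT : T.Nonempty) : IsQuadratic (ghzVec T) := by
  intro β
  rcases fin2_eq_zero_or_one (β ⬝ᵥ onesOn T) with h | h
  · refine ⟨0, 1, fun t => ?_⟩
    rw [add_zero, one_mul]
    unfold ghzVec
    by_cases h1 : t = 0
    · rw [h1, dotProduct_zero, sgn_zero, one_mul]
    · by_cases h2 : t = onesOn T
      · rw [h2, h, sgn_zero, one_mul]
      · rw [if_neg h1, if_neg h2]; ring
  · exact ⟨_, _, ghzVec_mul_sgn hT h⟩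

theorem single_dotProduct_onesOn {T : Finset S} {i : S} (hi : i ∈ T) :
    Pi.single i 1 ⬝ᵥ onesOn T = 1 := by
  rw [single_one_dotProduct, onesOn, if_pos hi]

/-- A circuit for the GHZ unitary has a light cone that contains `T`. -/
theorem exists_of_convOp_ghzVec_mem_QC {T : Finset S} {n : ℕ}
    (h : convOp (ghzVec T) ∈ QC G 2 (n + 1)) {i : S} (hi : i ∈ T) :
    ∃ j, (j = i ∨ G.Adj i j) ∧
      ∀ f : S → ℕ, (∀ i j, G.Adj i j → f i ≤ f j + 1) → n + 1 ≤ f i → n + 1 ≤ f j →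
        ∀ y ∈ T, f y ≠ 0 := by
  obtain ⟨j, hj, hcone⟩ := exists_conj_mem_localAlg h i
  refine ⟨j, hj, fun f hf hi' hj' y hy hfy => ?_⟩
  have hT : T.Nonempty := ⟨i, hi⟩
  have := hcone f hf hi' hj' (diagonal fun p => sgn p.1)
  -- The conjugate of Z at `i` is -i X^T Z_i, which acts nontrivially on every site of `T`.
  rw [← signOp_single, convOp_conj_signOp (convOp_ghzVec_mem_unitaryGroup hT)
    (ghzVec_mul_sgn hT (single_dotProduct_onesOn hi))] at this
  have h0 := shift_eq_zero_of_mem_localAlg (by simp) this (y := y) (by simp [hfy])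
  simp [onesOn, hy] at h0

theorem sum_norm_sq_ghzVec {T : Finset S} (hT : T.Nonempty) :
    ∑ x, ‖ghzVec T x‖ ^ 2 = 1 := by
  rw [Fintype.sum_eq_add 0 (onesOn T) (onesOn_ne_zero hT).symm]
  · simp only [ghzVec, if_true, if_neg (onesOn_ne_zero hT), norm_mul, norm_inv, mul_pow, inv_pow,
      Complex.norm_real, Complex.norm_I, norm_one, Real.norm_eq_abs, sq_abs]
    rw [Real.sq_sqrt (by norm_num)]
    norm_num
  · rintro x ⟨h1, h2⟩
    simp [ghzVec, h1, h2]

/-- The phase gate at the site `i`. -/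
noncomputable def phaseAt (i : S) : Matrix (S → Fin 2) (S → Fin 2) ℂ :=
  diagonal fun x => if x i = 0 then 1 else Complex.I

theorem phaseAt_mem_LU (i : S) : phaseAt i ∈ LU S (Fin 2) := by
  refine ⟨fun j => diagonal fun a => if j = i then if a = 0 then 1 else Complex.I else 1,
    fun j => ?_, ?_⟩
  · rw [mem_unitaryGroup_iff, star_eq_conjTranspose, diagonal_conjTranspose,
      diagonal_mul_diagonal, ← diagonal_one]
    congr 1
    ext a
    rw [Pi.star_apply]
    split_ifs <;> simp
  · ext x y
    simp only [phaseAt, tensorOp, of_apply, diagonal_apply]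
    rw [Finset.prod_ite_zero]
    by_cases h : x = y
    · simp [h]
    · have : ¬∀ i, x i = y i := fun hh => h (funext hh)
      simp [h, this]

/-! ### Preparation of GHZ states -/

/-- The sites in the order of a Hamiltonian path. -/
structure PathOrder (G : SimpleGraph S) where
  pos : S → ℕ
  prev : S → S
  root : S
  pos_injective : Function.Injective pos
  pos_root : pos root = 0
  pos_prev : ∀ u, pos u ≠ 0 → pos (prev u) + 1 = pos u
  adj_prev : ∀ u, pos u ≠ 0 → G.Adj (prev u) u

namespace PathOrder

variable (P : PathOrder G)

/-- The sites that are not last. -/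
noncomputable def init : Finset S := by
  classical exact Finset.univ.filter fun u => ∃ w, P.pos w = P.pos u + 1

/-- The boundary map of the path, with edges represented by their first vertices. -/
noncomputable def boundary : (S → Fin 2) →ₗ[Fin 2] (S → Fin 2) where
  toFun a u := (if u ∈ P.init then a u else 0) + if P.pos u ≠ 0 then a (P.prev u) else 0
  map_add' a b := by
    ext u : 1
    simp only [Pi.add_apply]
    split_ifs <;> simp [add_add_add_comm]
  map_smul' c a := by
    ext u : 1
    simp only [Pi.smul_apply, smul_eq_mul, RingHom.id_apply]
    split_ifs <;> simp [mul_add]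

theorem boundary_apply (a : S → Fin 2) (u : S) :
    P.boundary a u =
      (if u ∈ P.init then a u else 0) + if P.pos u ≠ 0 then a (P.prev u) else 0 := rfl

theorem prev_injOn : Set.InjOn P.prev {u | P.pos u ≠ 0} := by
  intro u hu v hv h
  apply P.pos_injective
  rw [← P.pos_prev u hu, ← P.pos_prev v hv, h]

/-- The ancilla of a site serves the edge to its successor. Its own end is added locally; the other
ends form two matchings, according to the parity of the position, hence two layers. -/
theorem realizes_boundary : Realizes G 2 P.boundary := by
  intro n Φ h
  have h1 := h.addFrom_own P.init
  have h2 := h1.addFrom_ancilla (T := Finset.univ.filter fun u => P.pos u % 2 = 1) (p := P.prev)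
    (fun t ht => P.adj_prev t (by simp at ht; omega))
    (fun t ht ht' => by
      simp only [Finset.mem_filter, Finset.mem_univ, true_and] at ht ht'
      have := P.pos_prev t (by omega)
      omega)
    (P.prev_injOn.mono fun t ht => by
      simp only [Finset.coe_filter, Finset.mem_univ, true_and, Set.mem_ofPred_eq] at ht ⊢
      omega)
  have h3 := h2.addFrom_ancilla
    (T := Finset.univ.filter fun u => P.pos u % 2 = 0 ∧ P.pos u ≠ 0) (p := P.prev)
    (fun t ht => P.adj_prev t (by simp at ht; omega))
    (fun t ht ht' => by
      simp only [Finset.mem_filter, Finset.mem_univ, true_and] at ht ht'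
      have := P.pos_prev t (by omega)
      omega)
    (P.prev_injOn.mono fun t ht => by
      simp only [Finset.coe_filter, Finset.mem_univ, true_and, Set.mem_ofPred_eq] at ht ⊢
      omega)
  convert h3 using 2
  ext x a
  congr 1
  ext u : 1
  rw [Pi.add_apply, boundary_apply]
  simp only [addFrom, Finset.mem_filter, Finset.mem_univ, true_and, id]
  rcases Nat.mod_two_eq_zero_or_one (P.pos u) with hp | hp
  · by_cases h0 : P.pos u = 0 <;> by_cases hi : u ∈ P.init <;>
      simp [hp, h0, hi, add_comm, add_left_comm]
  · have h0 : P.pos u ≠ 0 := by omega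
    by_cases hi : u ∈ P.init <;> simp [hp, h0, hi, add_comm, add_left_comm]

theorem sum_boundary (a : S → Fin 2) : ∑ u, P.boundary a u = 0 := by
  simp only [boundary_apply, Finset.sum_add_distrib]
  rw [← Finset.sum_filter, ← Finset.sum_filter, Finset.filter_mem_eq_inter, Finset.univ_inter]
  have : P.init = (Finset.univ.filter fun u => P.pos u ≠ 0).image P.prev := by
    ext u
    simp only [init, Finset.mem_filter, Finset.mem_univ, true_and, Finset.mem_image]
    constructor
    · rintro ⟨w, hw⟩
      refine ⟨w, by omega, P.pos_injective ?_⟩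
      have := P.pos_prev w (by omega)
      omega
    · rintro ⟨w, hw, rfl⟩
      exact ⟨w, (P.pos_prev w hw).symm⟩
  rw [this, Finset.sum_image (P.prev_injOn.mono fun t ht => by simpa using ht), fin2_add_self]

theorem boundary_single {w : S} (hw : P.pos w ≠ 0) :
    P.boundary (Pi.single (P.prev w) 1) = Pi.single (P.prev w) 1 + Pi.single w 1 := by
  ext u : 1
  rw [boundary_apply, Pi.add_apply]
  congr 1
  · by_cases h : u = P.prev w
    · subst h
      rw [if_pos]
      simp only [init, Finset.mem_filter, Finset.mem_univ, true_and]
      exact ⟨w, (P.pos_prev w hw).symm⟩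
    · simp [Pi.single_eq_of_ne h]
  · by_cases h : u = w
    · subst h
      simp [hw]
    · rw [Pi.single_eq_of_ne h]
      split_ifs with h0
      · rw [Pi.single_eq_of_ne]
        exact fun hh => h (P.prev_injOn h0 hw hh)
      · rfl

theorem eq_zero_or_eq_onesOn {y : S → Fin 2} (h : ∀ w, P.pos w ≠ 0 → y w = y (P.prev w)) :
    y = 0 ∨ y = onesOn Finset.univ := by
  have key : ∀ n u, P.pos u = n → y u = y P.root := by
    intro n
    induction n with
    | zero => intro u hu; rw [P.pos_injective (hu.trans P.pos_root.symm)]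
    | succ n ih =>
      intro u hu
      rw [h u (by omega)]
      refine ih _ ?_
      have := P.pos_prev u (by omega)
      omega
  rcases fin2_eq_zero_or_one (y P.root) with h0 | h0
  · exact Or.inl (funext fun u => (key _ u rfl).trans h0)
  · exact Or.inr (funext fun u => (key _ u rfl).trans (by rw [h0]; simp [onesOn]))

/-- The character `y` is trivial on the range of the boundary map exactly if `y` agrees along every
edge, i.e. is constant. So the Hadamard transform of the range is supported on the two GHZ branches.
-/
theorem sum_sgn_boundary (y : S → Fin 2) :
    ∑ a, sgn (y ⬝ᵥ P.boundary a) =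
      if y = 0 ∨ y = onesOn Finset.univ then (2 : ℂ) ^ Fintype.card S else 0 := by
  split_ifs with h
  · have : ∀ a, y ⬝ᵥ P.boundary a = 0 := by
      intro a
      rcases h with rfl | rfl
      · exact zero_dotProduct _
      · simpa [dotProduct, onesOn] using P.sum_boundary a
    simp [this, sgn_zero]
  · have : ∃ w, P.pos w ≠ 0 ∧ y w ≠ y (P.prev w) := by
      by_contra! hh
      exact h (P.eq_zero_or_eq_onesOn hh)
    obtain ⟨w, hw, hne⟩ := this
    refine sum_sgn_eq_zero (fun a b => by rw [map_add, dotProduct_add])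
      (b := Pi.single (P.prev w) 1) ?_
    rw [P.boundary_single hw, dotProduct_add, dotProduct_single_fin2, dotProduct_single_fin2]
    revert hne
    generalize y w = p
    generalize y (P.prev w) = q
    revert p q
    decide

/-- The GHZ state can be prepared with depth two. -/
theorem prepared_ghzVec [Nonempty S] (P : PathOrder G) :
    PreparedByQCcc G 2 2 (ghzVec (Finset.univ : Finset S)) := by
  obtain ⟨κ, hκ, hsum⟩ := exists_sum_eq_smul_indicator P.boundary
  -- Hadamard gates give the two branches equal amplitudes, and a phase gate at one site supplies
  -- the factor i; the constant only normalizes.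
  refine P.realizes_boundary.prepared
    (mul_mem_LU (phaseAt_mem_LU P.root) hadamardAll_mem_LU)
    (sum_norm_sq_ghzVec Finset.univ_nonempty)
    (c := ((Real.sqrt 2 : ℝ) : ℂ)⁻¹ * κ * (hadamardScale S * 2 ^ Fintype.card S)⁻¹) ?_
  have h1 : tensorOp (fun _ => hadGate) *ᵥ (κ • indicator (LinearMap.range P.boundary)) =
      fun y => hadamardScale S *
        if y = 0 ∨ y = onesOn Finset.univ then (2 : ℂ) ^ Fintype.card S else 0 := by
    rw [← hsum]
    ext y
    rw [← P.sum_sgn_boundary, Finset.mul_sum]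
    change ∑ x, tensorOp (fun _ => hadGate) y x * ∑ a, (if x = P.boundary a then 1 else 0) = _
    simp only [tensorOp_hadGate_apply, Finset.mul_sum]
    rw [Finset.sum_comm]
    refine Finset.sum_congr rfl fun a _ => ?_
    rw [Finset.sum_eq_single (P.boundary a)]
    · simp
    · intro x _ hx
      simp [hx]
    · simp
  have h2 : hadamardScale S * 2 ^ Fintype.card S ≠ 0 :=
    mul_ne_zero hadamardScale_ne_zero (pow_ne_zero _ two_ne_zero)
  rw [mul_right_comm, mul_smul, ← mulVec_smul, ← mulVec_mulVec, h1]
  ext y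
  rw [Pi.smul_apply, smul_eq_mul, phaseAt, mulVec_diagonal, ghzVec, mul_assoc]
  congr 1
  by_cases h0 : y = 0
  · subst h0
    simp only [Pi.zero_apply, if_true, true_or, one_mul]
    exact (inv_mul_cancel₀ h2).symm
  · by_cases h1 : y = onesOn Finset.univ
    · subst h1
      rw [if_neg h0, if_pos rfl, if_pos (Or.inr rfl), if_neg (by simp [onesOn])]
      rw [mul_left_comm, inv_mul_cancel₀ h2, mul_one]
    · rw [if_neg h0, if_neg h1, if_neg (not_or.2 ⟨h0, h1⟩)]
      simp

end PathOrder

end GHZ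

section Strictness

attribute [local instance] fin2CommRing

variable {S : Type} [Fintype S] [DecidableEq S] {G : SimpleGraph S}

/-! ### The inclusion is strict at depth zero and one -/

/-- At depth zero the only circuit is the identity, without global phases, whereas the assisted
class is closed under them. -/
theorem exists_mem_QCcc_zero_notMem_QC [Nonempty S] : ∃ U ∈ QCcc G 2 0, U ∉ QC G 2 0 := by
  refine ⟨Complex.I • 1, smul_mem_QCcc (QC_subset_QCcc 0 one_mem_QC) (by simp), fun h => ?_⟩
  have := congrFun (congrFun (Set.mem_singleton_iff.1 h) 0) 0
  rw [Matrix.smul_apply, Matrix.one_apply_eq, smul_eq_mul, mul_one] at this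
  simpa using congrArg Complex.im this

/-- Only the ancilla bit at `a` is used: it is added to `a` locally and to `b` by one gate. -/
theorem prepared_ghzVec_pair [Nonempty S] {a b : S} (hab : G.Adj a b) :
    PreparedByQCcc G 2 1 (ghzVec {a, b}) := by
  have hne := hab.ne
  set δ : (S → Fin 2) →ₗ[Fin 2] (S → Fin 2) :=
    (LinearMap.proj a : (S → Fin 2) →ₗ[Fin 2] Fin 2).smulRight (onesOn {a, b}) with hδ
  have happly : ∀ z, δ z = z a • onesOn {a, b} := fun z => rfl
  have hreal : Realizes G 1 δ := by
    intro n Φ h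
    have h2 := (h.addFrom_own {a}).addFrom_ancilla (T := {b}) (p := fun _ => a)
      (fun t ht => by rw [Finset.mem_singleton.1 ht]; exact hab)
      (fun t _ ht' => hne (Finset.mem_singleton.1 ht'))
      (fun s hs t ht _ => by
        rw [Finset.mem_coe, Finset.mem_singleton] at hs ht; rw [hs, ht])
    convert h2 using 2
    ext x z
    congr 1
    ext u : 1
    rw [happly]
    simp only [addFrom, Finset.mem_singleton, onesOn, Pi.add_apply, Pi.smul_apply,
      Finset.mem_insert, smul_eq_mul, id]
    by_cases h1 : u = a
    · subst h1; simp [hne]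
    · by_cases h2 : u = b
      · subst h2; simp [h1]
      · simp [h1, h2]
  have hmem : ∀ x, x ∈ LinearMap.range δ ↔ x = 0 ∨ x = onesOn {a, b} := by
    intro x
    rw [LinearMap.mem_range]
    constructor
    · rintro ⟨z, rfl⟩
      rw [happly]
      rcases fin2_eq_zero_or_one (z a) with h | h <;> simp [h]
    · rintro (rfl | rfl)
      · exact ⟨0, map_zero _⟩
      · exact ⟨Pi.single a 1, by rw [happly]; simp⟩
  have h0 : onesOn {a, b} ≠ 0 := onesOn_ne_zero ⟨a, by simp⟩
  refine hreal.prepared (phaseAt_mem_LU a) (sum_norm_sq_ghzVec ⟨a, by simp⟩)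
    (c := ((Real.sqrt 2 : ℝ) : ℂ)⁻¹) ?_
  ext x
  rw [ghzVec, Pi.smul_apply, smul_eq_mul, phaseAt, mulVec_diagonal]
  congr 1
  by_cases h1 : x = 0
  · subst h1
    rw [indicator, Set.indicator_of_mem ((hmem 0).2 (Or.inl rfl))]
    simp
  · by_cases h2 : x = onesOn {a, b}
    · subst h2
      rw [indicator, Set.indicator_of_mem ((hmem _).2 (Or.inr rfl)), if_neg h1, if_pos rfl]
      simp [onesOn]
    · rw [indicator, Set.indicator_of_notMem (fun h => ?_), if_neg h1, if_neg h2, mul_zero]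
      exact ((hmem x).1 h).elim h1 h2

/-- The two halves of the protocol have depth one each: the first prepares a GHZ state on `a`, `b`,
the second extends it to `c` by a CNOT before it is consumed. Without assistance, one layer couples
`b` to only one of its two neighbours. -/
theorem exists_mem_QCcc_one_notMem_QC [Nonempty S] {a b c : S} (hab : G.Adj a b)
    (hbc : G.Adj b c) (hac : a ≠ c) : ∃ U ∈ QCcc G 2 1, U ∉ QC G 2 1 := by
  have hadj : ∀ t ∈ ({c} : Finset S), G.Adj b t := fun t ht => by
    rw [Finset.mem_singleton.1 ht]; exact hbc
  have hlayer : compOp (fun x : S → Fin 2 => addFrom {c} (fun _ => b) x x) ∈ Layer G 2 :=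
    compOp_addFrom_mem_Layer hadj (fun t _ ht' => hbc.ne (Finset.mem_singleton.1 ht'))
      fun s hs t ht _ => by rw [Finset.mem_coe, Finset.mem_singleton] at hs ht; rw [hs, ht]
  have hQC : compOp (fun x : S → Fin 2 => addFrom {c} (fun _ => b) x x) ∈ QC G 2 1 :=
    ⟨_, hlayer, 1, rfl, (Matrix.mul_one _).symm⟩
  have hT : ({a, b, c} : Finset S).Nonempty := ⟨a, by simp⟩
  have hval : compOp (fun x : S → Fin 2 => addFrom {c} (fun _ => b) x x) *ᵥ ghzVec {a, b} =
      ghzVec {a, b, c} := by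
    have hinv : ∀ x : S → Fin 2,
        addFrom {c} (fun _ => b) (addFrom {c} (fun _ => b) x x) (addFrom {c} (fun _ => b) x x) =
          x := by
      intro x
      ext u : 1
      by_cases hu : u = c
      · subst hu
        simp [addFrom, hbc.ne, add_assoc, fin2_add_self]
      · simp [addFrom, hu]
    have h0 : addFrom {c} (fun _ => b) (0 : S → Fin 2) 0 = 0 := by
      ext u : 1
      simp [addFrom]
    have h1 : addFrom {c} (fun _ => b) (onesOn {a, b, c}) (onesOn {a, b, c}) = onesOn {a, b} := by
      ext u : 1
      by_cases hu : u = c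
      · subst hu
        simp [addFrom, onesOn, hac.symm, hbc.ne.symm, fin2_add_self]
      · simp [addFrom, onesOn, hu]
    have hiff : ∀ x y : S → Fin 2, addFrom {c} (fun _ => b) x x = addFrom {c} (fun _ => b) y y ↔
        x = y := fun x y => ⟨fun h => by rw [← hinv x, h, hinv], fun h => by rw [h]⟩
    rw [compOp_mulVec]
    ext x
    rw [Function.comp_apply, ghzVec, ghzVec]
    congr 1
    refine if_congr ?_ rfl (if_congr ?_ rfl rfl)
    · rw [← hiff x 0, h0]
    · rw [← hiff x (onesOn {a, b, c}), h1]
  have hmem := convOp_mem_QCcc (prepared_ghzVec_pair hab) hQC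
    (by rw [hval]; exact convOp_ghzVec_mem_unitaryGroup hT)
    (by rw [hval]; exact ghzVec_isQuadratic hT)
  rw [hval] at hmem
  refine ⟨_, hmem, fun h => ?_⟩
  obtain ⟨j, -, hj⟩ := exists_of_convOp_ghzVec_mem_QC (n := 0) h (i := b) (by simp)
  have : ∃ y ∈ ({a, b, c} : Finset S), b ≠ y ∧ j ≠ y := by
    by_cases h : j = a
    · exact ⟨c, by simp, hbc.ne, h ▸ hac⟩
    · exact ⟨a, by simp, hab.ne.symm, h⟩
  obtain ⟨y, hy, hby, hjy⟩ := this
  -- For a single layer a function with values 0 and 1 is enough, and it is trivially Lipschitz.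
  refine hj (fun x => if x = y then 0 else 1) (fun i j _ => ?_) ?_ ?_ y hy (if_pos rfl)
  · split_ifs <;> omega
  · simp [hby]
  · simp [hjy]

theorem UGHZ_ne_one [Nonempty S] : UGHZ S ≠ 1 := by
  intro h
  rw [UGHZ_eq_convOp] at h
  have := congrFun (congrFun h 0) 0
  simp only [convOp, of_apply, add_zero, ghzVec, if_true, mul_one, Matrix.one_apply_eq] at this
  have h2 := inv_sqrt_two_mul_self
  rw [this] at h2
  norm_num at h2

/-- A Hamiltonian path, given as a list. -/
noncomputable def PathOrder.ofList {L : List S} (hne : L ≠ []) (hnd : L.Nodup) (hmem : ∀ x, x ∈ L)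
    (hch : L.IsChain G.Adj) : PathOrder G where
  pos u := L.idxOf u
  prev u := L[L.idxOf u - 1]'(by have := List.idxOf_lt_length_of_mem (hmem u); omega)
  root := L.head hne
  pos_injective u v h := (List.idxOf_inj (hmem u)).1 h
  pos_root := by
    obtain ⟨a, L, rfl⟩ := List.exists_cons_of_ne_nil hne
    simp
  pos_prev u hu := by
    rw [hnd.idxOf_getElem]
    omega
  adj_prev u hu := by
    have h1 := List.idxOf_lt_length_of_mem (hmem u)
    have h2 := List.isChain_iff_getElem.1 hch (L.idxOf u - 1) (by omega)
    have h3 : L[L.idxOf u - 1 + 1]'(by omega) = u := by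
      have : L.idxOf u - 1 + 1 = L.idxOf u := by omega
      simp only [this, List.getElem_idxOf]
    rwa [h3] at h2

end Strictness

/-! ### Geometry of the lattice -/

section Lattice

/-! ### Hamiltonian paths of the lattice -/

/-- Sites that differ by one in one coordinate. -/
def GridStep {D N : ℕ} (i j : Site D N) : Prop :=
  ∃ k, (j k : ℕ) = (i k : ℕ) + 1 ∧ ∀ m, m ≠ k → j m = i m

theorem fin_val_add_one {N : ℕ} [NeZero N] (u : Fin N) :
    ((u + 1 : Fin N) : ℕ) = if (u : ℕ) + 1 = N then 0 else (u : ℕ) + 1 := by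
  have hu := u.isLt
  rw [Fin.val_add, Fin.val_one', Nat.add_mod_mod]
  split_ifs with h
  · rw [h, Nat.mod_self]
  · exact Nat.mod_eq_of_lt (by omega)

theorem GridStep.adj {D N : ℕ} [NeZero N] (b : Boundary) {i j : Site D N} (h : GridStep i j) :
    (lattice b D N).Adj i j := by
  obtain ⟨k, hk, hm⟩ := h
  have hne : i ≠ j := by
    rintro rfl
    omega
  cases b with
  | free => exact (SimpleGraph.fromRel_adj _ _ _).2 ⟨hne, Or.inl ⟨k, hk, hm⟩⟩
  | periodic =>
    refine (SimpleGraph.fromRel_adj _ _ _).2 ⟨hne, Or.inl ⟨k, funext fun m => ?_⟩⟩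
    by_cases hmk : m = k
    · subst hmk
      apply Fin.ext
      have := (j m).isLt
      rw [Pi.add_apply, Pi.single_eq_same, fin_val_add_one, if_neg (by omega), hk]
    · rw [Pi.add_apply, Pi.single_eq_of_ne hmk, add_zero, hm m hmk]

/-- A list of all sites in which neighbours differ by one in one coordinate. -/
def IsSnake {D N : ℕ} (L : List (Site D N)) : Prop :=
  L.Nodup ∧ (∀ x, x ∈ L) ∧ L.IsChain fun i j => GridStep i j ∨ GridStep j i

theorem IsSnake.reverse {D N : ℕ} {L : List (Site D N)} (h : IsSnake L) : IsSnake L.reverse :=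
  ⟨List.nodup_reverse.2 h.1, fun x => List.mem_reverse.2 (h.2.1 x),
    List.isChain_reverse.2 (h.2.2.imp fun _ _ => Or.symm)⟩

theorem gridStep_cons {D N : ℕ} {c : Fin N} {i j : Site D N} (h : GridStep i j) :
    GridStep (Fin.cons c i : Site (D + 1) N) (Fin.cons c j) := by
  obtain ⟨k, hk, hm⟩ := h
  refine ⟨k.succ, by simpa using hk, fun m => ?_⟩
  refine Fin.cases (fun _ => rfl) (fun m hmk => ?_) m
  simpa using hm m fun h => hmk (by rw [h])

theorem IsSnake.isChain_cons {D N : ℕ} {L : List (Site D N)} (h : IsSnake L) (c : Fin N) :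
    (L.map fun x => (Fin.cons c x : Site (D + 1) N)).IsChain
      fun i j => GridStep i j ∨ GridStep j i :=
  (List.isChain_map _).2 (h.2.2.imp fun _ _ hh => hh.imp gridStep_cons gridStep_cons)

/-- Slices of fixed first coordinate are traversed by the same lower-dimensional path, alternately
forwards and backwards, so that consecutive slices join at equal remaining coordinates. -/
theorem exists_isSnake (D N : ℕ) [NeZero N] : ∃ L : List (Site D N), IsSnake L := by
  induction D with
  | zero =>
    exact ⟨[fun _ => 0], by simp, fun x => by simp [Subsingleton.elim x fun _ => 0], by simp⟩
  | succ D ih =>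
    obtain ⟨K₀, hK₀⟩ := ih
    have hN : 0 < N := Nat.pos_of_ne_zero (NeZero.ne N)
    -- `K` records the direction in which the last slice was traversed; only its end point matters
    -- for the next step.
    have key : ∀ n (hn : n < N), ∃ (K : List (Site D N)) (L : List (Site (D + 1) N)),
        IsSnake K ∧ L.Nodup ∧ (∀ x, x ∈ L ↔ (x 0 : ℕ) ≤ n) ∧
        (L.IsChain fun i j => GridStep i j ∨ GridStep j i) ∧
        L.getLast? = (K.map fun x => (Fin.cons ⟨n, hn⟩ x : Site (D + 1) N)).getLast? := by
      have hmap : ∀ {K : List (Site D N)}, IsSnake K → ∀ (c : Fin N),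
          (K.map fun x => (Fin.cons c x : Site (D + 1) N)).Nodup ∧
          ∀ x, x ∈ (K.map fun x => (Fin.cons c x : Site (D + 1) N)) ↔ x 0 = c := by
        intro K hK c
        refine ⟨hK.1.map fun x y h => (Fin.cons_inj.1 h).2, fun x => ?_⟩
        rw [List.mem_map]
        constructor
        · rintro ⟨y, -, rfl⟩
          rfl
        · rintro rfl
          exact ⟨Fin.tail x, hK.2.1 _, Fin.cons_self_tail x⟩
      intro n
      induction n with
      | zero =>
        intro hn
        refine ⟨K₀, _, hK₀, (hmap hK₀ ⟨0, hn⟩).1, fun x => ?_, hK₀.isChain_cons _, rfl⟩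
        rw [(hmap hK₀ _).2, Fin.ext_iff]
        simp
      | succ n ih =>
        intro hn
        obtain ⟨K, L, hK, hnd, hmem, hch, hlast⟩ := ih (by omega)
        have h1 := hmap hK.reverse ⟨n + 1, hn⟩
        refine ⟨K.reverse, L ++ K.reverse.map fun x => Fin.cons ⟨n + 1, hn⟩ x, hK.reverse,
          hnd.append h1.1 ?_, fun x => ?_, List.isChain_append.2 ⟨hch, hK.reverse.isChain_cons _, ?_⟩,
          ?_⟩
        · intro x hx hx'
          rw [hmem] at hx
          rw [h1.2] at hx'
          rw [hx'] at hx
          simp at hx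
        · rw [List.mem_append, hmem, h1.2, Fin.ext_iff]
          dsimp only
          omega
        · intro x hx y hy
          rw [hlast, List.getLast?_map, Option.mem_def, Option.map_eq_some_iff] at hx
          rw [List.head?_map, List.head?_reverse, Option.mem_def, Option.map_eq_some_iff] at hy
          obtain ⟨z, hz, rfl⟩ := hx
          obtain ⟨z', hz', rfl⟩ := hy
          obtain rfl : z = z' := Option.some.inj (hz.symm.trans hz')
          refine Or.inl ⟨0, rfl, fun m => ?_⟩
          exact Fin.cases (fun h => absurd rfl h) (fun m _ => rfl) m
        · have hne : (K.reverse.map fun x => (Fin.cons ⟨n + 1, hn⟩ x : Site (D + 1) N)) ≠ [] := by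
            intro h
            have := (h1.2 (fun _ => ⟨n + 1, hn⟩)).2 rfl
            rw [h] at this
            simp at this
          rw [List.getLast?_append_of_ne_nil _ hne]
    obtain ⟨-, L, -, hnd, hmem, hch, -⟩ := key (N - 1) (by omega)
    exact ⟨L, hnd, fun x => (hmem x).2 (by have := (x 0).isLt; omega), hch⟩

theorem exists_hamiltonian_path (b : Boundary) (D N : ℕ) [NeZero N] :
    ∃ L : List (Site D N), L ≠ [] ∧ L.Nodup ∧ (∀ x, x ∈ L) ∧
      L.IsChain (lattice b D N).Adj := by
  obtain ⟨L, hnd, hmem, hch⟩ := exists_isSnake D N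
  exact ⟨L, List.ne_nil_of_mem (hmem fun _ => 0), hnd, hmem,
    hch.imp fun _ _ h => h.elim (fun h => h.adj b) fun h => (h.adj b).symm⟩

theorem nonempty_pathOrder (b : Boundary) (D N : ℕ) [NeZero N] :
    Nonempty (PathOrder (lattice b D N)) := by
  obtain ⟨L, hne, hnd, hmem, hch⟩ := exists_hamiltonian_path b D N
  exact ⟨PathOrder.ofList hne hnd hmem hch⟩

theorem exists_path_of_three (b : Boundary) (D N : ℕ) [NeZero N] (h : 3 ≤ N ^ D) :
    ∃ u v w, (lattice b D N).Adj u v ∧ (lattice b D N).Adj v w ∧ u ≠ w := by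
  obtain ⟨L, -, hnd, hmem, hch⟩ := exists_hamiltonian_path b D N
  have hlen : 3 ≤ L.length := by
    have h1 : L.toFinset = Finset.univ := by
      ext x
      simp [hmem x]
    have h2 := List.toFinset_card_of_nodup hnd
    rw [h1, Finset.card_univ] at h2
    simp only [Fintype.card_pi, Fintype.card_fin, Finset.prod_const, Finset.card_univ] at h2
    omega
  rw [List.isChain_iff_getElem] at hch
  refine ⟨L[0], L[1], L[2], hch 0 (by omega), hch 1 (by omega), fun h => ?_⟩
  have := (hnd.getElem_inj_iff).1 h
  omega

/-! ### Distances -/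

theorem sum_le_sum_of_eq_off {D N : ℕ} {w : Fin D → Fin N → ℕ} {i j : Site D N} (k : Fin D)
    (hm : ∀ m, m ≠ k → j m = i m) {c c' : ℕ} (hk : w k (i k) + c ≤ w k (j k) + c') :
    ∑ m, w m (i m) + c ≤ ∑ m, w m (j m) + c' := by
  rw [← Finset.add_sum_erase _ _ (Finset.mem_univ k),
    ← Finset.add_sum_erase _ (fun m => w m (j m)) (Finset.mem_univ k)]
  have : ∑ m ∈ Finset.univ.erase k, w m (j m) = ∑ m ∈ Finset.univ.erase k, w m (i m) :=
    Finset.sum_congr rfl fun m h => by rw [hm m (Finset.ne_of_mem_erase h)]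
  omega

theorem lattice_free_lipschitz {D N : ℕ} [NeZero N] {i j : Site D N}
    (h : (lattice Boundary.free D N).Adj i j) :
    ∑ m, (N - 1 - (i m : ℕ)) ≤ ∑ m, (N - 1 - (j m : ℕ)) + 1 := by
  obtain ⟨-, ⟨k, hk, hm⟩ | ⟨k, hk, hm⟩⟩ := (SimpleGraph.fromRel_adj _ _ _).1 h
  · refine sum_le_sum_of_eq_off (w := fun _ u => N - 1 - (u : ℕ)) (c := 0) k hm ?_
    omega
  · refine sum_le_sum_of_eq_off (w := fun _ u => N - 1 - (u : ℕ)) (c := 0) k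
      (fun m h => (hm m h).symm) ?_
    omega

/-- The distance from zero in the cycle. -/
def cycleDist {N : ℕ} (u : Fin N) : ℕ := min (u : ℕ) (N - u)

theorem cycleDist_add_one {N : ℕ} [NeZero N] (u : Fin N) :
    cycleDist (u + 1) ≤ cycleDist u + 1 ∧ cycleDist u ≤ cycleDist (u + 1) + 1 := by
  have := u.isLt
  unfold cycleDist
  rw [fin_val_add_one]
  split_ifs <;> omega

/-- With all weights 1 this is the distance from the site `-s`; with a single weight 1 it is the
distance from a line or hyperplane. GHZ uses the former, the toric code the latter. -/
theorem lattice_periodic_lipschitz {D N : ℕ} [NeZero N] (s : Fin D → Fin N)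
    (w : Fin D → ℕ) (hw : ∀ k, w k ≤ 1) {i j : Site D N}
    (h : (lattice Boundary.periodic D N).Adj i j) :
    ∑ m, w m * cycleDist (i m + s m) ≤ ∑ m, w m * cycleDist (j m + s m) + 1 := by
  have key : ∀ {i j : Site D N} (k : Fin D), j = i + Pi.single k 1 →
      (∀ m, m ≠ k → j m = i m) ∧ j k + s k = i k + s k + 1 := by
    rintro i j k rfl
    exact ⟨fun m hm => by simp [hm], by simp [add_right_comm]⟩
  have hw' : ∀ k a b, a ≤ b + 1 → w k * a ≤ w k * b + 1 := by
    intro k a b hab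
    have : w k = 0 ∨ w k = 1 := by have := hw k; omega
    rcases this with h | h <;> rw [h] <;> omega
  obtain ⟨-, ⟨k, hk⟩ | ⟨k, hk⟩⟩ := (SimpleGraph.fromRel_adj _ _ _).1 h
  · obtain ⟨hm, hs⟩ := key k hk
    refine sum_le_sum_of_eq_off (w := fun m u => w m * cycleDist (u + s m)) (c := 0) k hm ?_
    rw [hs]
    exact hw' k _ _ (cycleDist_add_one _).2
  · obtain ⟨hm, hs⟩ := key k hk
    refine sum_le_sum_of_eq_off (w := fun m u => w m * cycleDist (u + s m)) (c := 0) k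
      (fun m h => (hm m h).symm) ?_
    rw [hs]
    exact hw' k _ _ (cycleDist_add_one _).1

end Lattice

section LatticeGHZ

/-! ### GHZ unitaries on the lattice -/

/-- The origin is compared with the opposite corner, at distance D(N - 1); a neighbour loses at most
one unit. -/
theorem exists_far_free {D N n : ℕ} [NeZero N]
    (h : (2 ≤ D ∧ n + 1 < N) ∨ (D = 1 ∧ n + 1 + 1 < N)) {j : Site D N}
    (hj : j = (fun _ => 0) ∨ (lattice Boundary.free D N).Adj (fun _ => 0) j) :
    ∃ f : Site D N → ℕ, (∀ i j, (lattice Boundary.free D N).Adj i j → f i ≤ f j + 1) ∧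
      n + 1 ≤ f (fun _ => 0) ∧ n + 1 ≤ f j ∧ ∃ y, f y = 0 := by
  set f : Site D N → ℕ := fun x => ∑ m, (N - 1 - (x m : ℕ)) with hf
  have hlip : ∀ i j, (lattice Boundary.free D N).Adj i j → f i ≤ f j + 1 :=
    fun i j => lattice_free_lipschitz
  have h0 : f (fun _ => 0) = D * (N - 1) := by
    simp [hf]
  have hj' : f (fun _ => 0) ≤ f j + 1 := by
    rcases hj with rfl | hj
    · omega
    · exact hlip _ _ hj
  have hb : n + 2 ≤ D * (N - 1) := by
    rcases h with ⟨hD, hn⟩ | ⟨rfl, hn⟩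
    · have := Nat.mul_le_mul_right (N - 1) hD
      omega
    · omega
  have hN : 0 < N := Nat.pos_of_ne_zero (NeZero.ne N)
  exact ⟨f, hlip, by omega, by omega, fun _ => ⟨N - 1, by omega⟩, by simp [hf]⟩

theorem sum_cycleDist_const {D N : ℕ} [NeZero N] {s : Fin N} {m : ℕ} (x : Site D N)
    (hx : ∀ k, cycleDist (x k + s) = m) : ∑ k, 1 * cycleDist (x k + s) = D * m := by
  simp [hx]

theorem exists_far_periodic {D N n : ℕ} [NeZero N]
    (h : (2 ≤ D ∧ n + 1 < N) ∨ (D = 1 ∧ 2 * (n + 1) < N)) {j : Site D N}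
    (hj : j = (fun _ => 0) ∨ (lattice Boundary.periodic D N).Adj (fun _ => 0) j) :
    ∃ f : Site D N → ℕ, (∀ i j, (lattice Boundary.periodic D N).Adj i j → f i ≤ f j + 1) ∧
      n + 1 ≤ f (fun _ => 0) ∧ n + 1 ≤ f j ∧ ∃ y, f y = 0 := by
  have hN : 0 < N := Nat.pos_of_ne_zero (NeZero.ne N)
  have hlip : ∀ s : Fin N, ∀ i j, (lattice Boundary.periodic D N).Adj i j →
      ∑ k, 1 * cycleDist (i k + s) ≤ ∑ k, 1 * cycleDist (j k + s) + 1 :=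
    fun s i j => lattice_periodic_lipschitz (fun _ => s) (fun _ => 1) fun _ => le_rfl
  have hzero : ∀ s : Fin N, ∃ y : Site D N, ∑ k, 1 * cycleDist (y k + s) = 0 := fun s =>
    ⟨fun _ => -s, by simp [cycleDist]⟩
  obtain ⟨m, hm⟩ : ∃ m, N = 2 * m ∨ N = 2 * m + 1 := ⟨N / 2, by omega⟩
  have hm1 : 1 ≤ m := by omega
  -- For even N the antipode has one unit to spare for the neighbour `j`. For odd N it may not (D =
  -- 2, n + 1 = 2m), and then `j` must be as far away as the origin.
  have hDm : (n + 2 ≤ D * m ∧ N = 2 * m) ∨ (n + 1 ≤ D * m ∧ N = 2 * m + 1) := by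
    rcases h with ⟨hD, hn⟩ | ⟨rfl, hn⟩
    · have := Nat.mul_le_mul_right m hD
      omega
    · omega
  have hdist : ∀ (u : Fin N), cycleDist u = min (u : ℕ) (N - u) := fun u => rfl
  rcases hDm with ⟨hb, hN2⟩ | ⟨hb, hN2⟩
  · have h0 := sum_cycleDist_const (D := D) (s := (⟨m, by omega⟩ : Fin N)) (m := m) (fun _ => 0)
      fun k => by rw [zero_add, hdist]; dsimp only; omega
    have hj' : D * m ≤ ∑ k, 1 * cycleDist (j k + ⟨m, by omega⟩) + 1 := by
      rw [← h0]
      rcases hj with rfl | hj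
      · exact Nat.le_succ _
      · exact hlip _ _ _ hj
    exact ⟨_, hlip ⟨m, by omega⟩, by rw [h0]; omega, by omega, hzero _⟩
  -- In an odd cycle both m and m + 1 are at the maximal distance m from zero. So s can be chosen,
  -- depending on the direction of the step from the origin to `j`, with both sites equally far from
  -- `-s`.
  · suffices ∃ s : Fin N, cycleDist s = m ∧ ∀ k, cycleDist (j k + s) = m by
      obtain ⟨s, hs0, hs⟩ := this
      exact ⟨_, hlip s, by rw [sum_cycleDist_const (m := m) _ fun k => by rw [zero_add, hs0]]; omega,
        by rw [sum_cycleDist_const (m := m) _ hs]; omega, hzero s⟩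
    have hv : ∀ (a : ℕ) (ha : a < N), (((⟨a, ha⟩ : Fin N) + 1 : Fin N) : ℕ) =
        if a + 1 = N then 0 else a + 1 := fun a ha => fin_val_add_one _
    rcases hj with rfl | hj
    · refine ⟨⟨m, by omega⟩, ?_, fun k => ?_⟩
      · rw [hdist]; dsimp only; omega
      · rw [zero_add, hdist]; dsimp only; omega
    · obtain ⟨-, ⟨k₀, hk⟩ | ⟨k₀, hk⟩⟩ := (SimpleGraph.fromRel_adj _ _ _).1 hj
      · refine ⟨⟨m, by omega⟩, ?_, fun k => ?_⟩
        · rw [hdist]; dsimp only; omega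
        · by_cases h : k = k₀
          · subst h
            rw [hk, Pi.add_apply, Pi.single_eq_same, zero_add, add_comm, hdist, hv,
              if_neg (by omega)]
            omega
          · rw [hk, Pi.add_apply, Pi.single_eq_of_ne h, zero_add, zero_add, hdist]
            dsimp only
            omega
      · have hs : (⟨m + 1, by omega⟩ : Fin N) = ⟨m, by omega⟩ + 1 := by
          apply Fin.ext
          rw [hv, if_neg (by omega)]
        refine ⟨⟨m + 1, by omega⟩, ?_, fun k => ?_⟩
        · rw [hdist]; dsimp only; omega
        · have hk' := congrFun hk k
          rw [Pi.add_apply] at hk'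
          by_cases h : k = k₀
          · subst h
            rw [Pi.single_eq_same] at hk'
            rw [hs, add_comm _ (1 : Fin N), ← add_assoc, ← hk', zero_add, hdist]
            dsimp only
            omega
          · rw [Pi.single_eq_of_ne h, add_zero] at hk'
            rw [← hk', zero_add, hdist]
            dsimp only
            omega

theorem UGHZ_notMem_QC (b : Boundary) (D N : ℕ) [NeZero N] (ℓ : ℕ)
    (h : (2 ≤ D ∧ ℓ < N) ∨ (D = 1 ∧ b = Boundary.free ∧ ℓ + 1 < N) ∨
      (D = 1 ∧ b = Boundary.periodic ∧ 2 * ℓ < N)) :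
    UGHZ (Site D N) ∉ QC (lattice b D N) 2 ℓ := by
  intro hU
  cases ℓ with
  | zero => exact UGHZ_ne_one hU
  | succ n =>
    rw [UGHZ_eq_convOp] at hU
    obtain ⟨j, hj, hcone⟩ := exists_of_convOp_ghzVec_mem_QC hU (i := fun _ => 0)
      (Finset.mem_univ _)
    have : ∃ f : Site D N → ℕ, (∀ i j, (lattice b D N).Adj i j → f i ≤ f j + 1) ∧
        n + 1 ≤ f (fun _ => 0) ∧ n + 1 ≤ f j ∧ ∃ y, f y = 0 := by
      cases b with
      | free => exact exists_far_free (by simpa using h) hj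
      | periodic => exact exists_far_periodic (by simpa using h) hj
    obtain ⟨f, hf, h1, h2, y, hy⟩ := this
    exact hcone f hf h1 h2 y (Finset.mem_univ y) hy

theorem UGHZ_isClifford (S : Type) [Fintype S] [DecidableEq S] [Nonempty S] :
    IsClifford (UGHZ S) := by
  rw [UGHZ_eq_convOp]
  exact convOp_isClifford (convOp_ghzVec_mem_unitaryGroup Finset.univ_nonempty)
    (ghzVec_isQuadratic Finset.univ_nonempty)

theorem UGHZ_mem_QCcc (b : Boundary) (D N : ℕ) [NeZero N] :
    UGHZ (Site D N) ∈ QCcc (lattice b D N) 2 2 := by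
  obtain ⟨P⟩ := nonempty_pathOrder b D N
  have := convOp_mem_QCcc P.prepared_ghzVec one_mem_QC
    (by rw [one_mulVec]; exact convOp_ghzVec_mem_unitaryGroup Finset.univ_nonempty)
    (by rw [one_mulVec]; exact ghzVec_isQuadratic Finset.univ_nonempty)
  rw [one_mulVec] at this
  rwa [UGHZ_eq_convOp]

/-- From depth two on, the GHZ unitary separates the classes; depths zero and one need witnesses of
their own. -/
theorem QC_ssubset_QCcc (b : Boundary) (D N : ℕ) [NeZero N] (ℓ : ℕ)
    (h : (2 ≤ D ∧ ℓ < N) ∨ (D = 1 ∧ b = Boundary.free ∧ ℓ + 1 < N) ∨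
      (D = 1 ∧ b = Boundary.periodic ∧ 2 * ℓ < N)) :
    QC (lattice b D N) 2 ℓ ⊂ QCcc (lattice b D N) 2 ℓ := by
  refine (Set.ssubset_iff_of_subset (QC_subset_QCcc ℓ)).2 ?_
  match ℓ, h with
  | 0, _ => exact exists_mem_QCcc_zero_notMem_QC
  | 1, h =>
    have h3 : 3 ≤ N ^ D := by
      rcases h with ⟨hD, hN⟩ | ⟨rfl, -, hN⟩ | ⟨rfl, -, hN⟩
      · calc 3 ≤ N ^ 2 := by nlinarith
          _ ≤ N ^ D := Nat.pow_le_pow_right (by omega) hD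
      · rw [pow_one]; omega
      · rw [pow_one]; omega
    obtain ⟨u, v, w, huv, hvw, huw⟩ := exists_path_of_three b D N h3
    exact exists_mem_QCcc_one_notMem_QC huv hvw huw
  | n + 2, h =>
    exact ⟨_, QCcc_mono (by omega) (UGHZ_mem_QCcc b D N), UGHZ_notMem_QC b D N (n + 2) h⟩

end LatticeGHZ

section CodeUnitary

attribute [local instance] fin2CommRing

variable {S : Type} [Fintype S] [DecidableEq S] {G : SimpleGraph S}

/-! ### Operators that are diagonal in the Hadamard basis -/

/-- The symbol of the operator with the eigenvalues `D` in the Hadamard basis. -/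
noncomputable def hadSymbol (D : (S → Fin 2) → ℂ) : (S → Fin 2) → ℂ :=
  hadamardScale S • (tensorOp (fun _ : S => hadGate) *ᵥ D)

theorem hadSymbol_apply (D : (S → Fin 2) → ℂ) (t : S → Fin 2) :
    hadSymbol D t = hadamardScale S * hadamardScale S * ∑ z, sgn (t ⬝ᵥ z) * D z := by
  rw [hadSymbol, Pi.smul_apply, smul_eq_mul, mul_assoc]
  congr 1
  change ∑ z, tensorOp (fun _ => hadGate) t z * D z = _
  simp only [tensorOp_hadGate_apply, mul_assoc, Finset.mul_sum]

theorem convOp_hadSymbol (D : (S → Fin 2) → ℂ) :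
    convOp (hadSymbol D) =
      tensorOp (fun _ => hadGate) * diagonal D * tensorOp fun _ => hadGate := by
  ext x y
  rw [Matrix.mul_apply, convOp, of_apply, hadSymbol_apply, Finset.mul_sum]
  refine Finset.sum_congr rfl fun z _ => ?_
  rw [mul_diagonal, tensorOp_hadGate_apply, tensorOp_hadGate_apply, add_dotProduct, sgn_add,
    dotProduct_comm y z]
  ring

theorem convOp_hadSymbol_mem_unitaryGroup {D : (S → Fin 2) → ℂ} (hD : ∀ z, D z * star (D z) = 1) :
    convOp (hadSymbol D) ∈ unitaryGroup (S → Fin 2) ℂ := by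
  have h := LU_subset_unitaryGroup (hadamardAll_mem_LU (S := S))
  rw [convOp_hadSymbol]
  refine mul_mem (mul_mem h ?_) h
  rw [mem_unitaryGroup_iff, star_eq_conjTranspose, diagonal_conjTranspose, diagonal_mul_diagonal,
    ← diagonal_one]
  exact congrArg _ (funext hD)

/-- The Hadamard transform exchanges translations and characters, so eigenvalues that turn
translations into characters have a quadratic symbol. -/
theorem hadSymbol_mul_sgn {D : (S → Fin 2) → ℂ} {β γ : S → Fin 2} {c : ℂ}
    (h : ∀ z, D (z + β) = c * sgn (γ ⬝ᵥ z) * D z) (t : S → Fin 2) :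
    sgn (β ⬝ᵥ t) * hadSymbol D t = c * hadSymbol D (t + γ) := by
  rw [hadSymbol_apply, hadSymbol_apply, mul_left_comm, mul_left_comm c]
  congr 1
  rw [← Equiv.sum_comp (Equiv.addRight β), Finset.mul_sum, Finset.mul_sum]
  refine Finset.sum_congr rfl fun z _ => ?_
  rw [Equiv.coe_addRight, h, dotProduct_add, add_dotProduct, sgn_add, sgn_add,
    dotProduct_comm β t]
  linear_combination (sgn (t ⬝ᵥ z) * c * sgn (γ ⬝ᵥ z) * D z) * sgn_mul_self (t ⬝ᵥ β)

theorem convOp_mulVec_zeroSpins (φ : (S → Fin 2) → ℂ) :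
    convOp φ *ᵥ zeroSpins S 2 = φ := by
  ext x
  change ∑ y, φ (x + y) * zeroSpins S 2 y = _
  rw [Finset.sum_eq_single 0]
  · simp [zeroSpins]
  · intro y _ hy
    have : ¬∀ i, y i = 0 := fun h => hy (funext h)
    simp [zeroSpins, this]
  · simp

theorem smul_mem_LU [Nonempty S] {U : Matrix (S → Fin 2) (S → Fin 2) ℂ} (hU : U ∈ LU S (Fin 2))
    {c : ℂ} (hc : c * star c = 1) : c • U ∈ LU S (Fin 2) := by
  obtain ⟨i₀⟩ := ‹Nonempty S›
  have h : c • (1 : Matrix (S → Fin 2) (S → Fin 2) ℂ) ∈ LU S (Fin 2) := by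
    refine ⟨fun i => (if i = i₀ then c else 1) • 1, fun i => ?_, ?_⟩
    · rw [mem_unitaryGroup_iff, star_smul, star_one, smul_mul_smul_comm, Matrix.one_mul]
      split_ifs
      · rw [hc, one_smul]
      · rw [star_one, mul_one, one_smul]
    · rw [← tensorOp_one]
      ext x y
      simp only [tensorOp, of_apply, Matrix.smul_apply, smul_eq_mul, Finset.prod_mul_distrib,
        Finset.prod_ite_eq', Finset.mem_univ, if_true]
  simpa using mul_mem_LU h hU

/-! ### The unitary of a binary code -/

/-- A subspace with a set of pivots and the corresponding linear retraction. -/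
structure PivotData (A : Submodule (Fin 2) (S → Fin 2)) where
  pivots : Finset S
  vec : S → S → Fin 2
  vec_mem : ∀ i ∈ pivots, vec i ∈ A
  vec_apply : ∀ i ∈ pivots, ∀ j ∈ pivots, vec i j = if j = i then 1 else 0
  eq_sum : ∀ a ∈ A, a = ∑ i ∈ pivots, a i • vec i

theorem nonempty_pivotData (A : Submodule (Fin 2) (S → Fin 2)) : Nonempty (PivotData A) := by
  obtain ⟨I, b, h1, h2, h3⟩ := exists_pivots A
  exact ⟨⟨I, b, h1, h2, h3⟩⟩

namespace PivotData

variable {A : Submodule (Fin 2) (S → Fin 2)} (P : PivotData A)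

/-- The codeword with given values at the pivots. -/
def encode : (S → Fin 2) →ₗ[Fin 2] (S → Fin 2) :=
  ∑ i ∈ P.pivots, (LinearMap.proj i : (S → Fin 2) →ₗ[Fin 2] Fin 2).smulRight (P.vec i)

theorem encode_apply (z : S → Fin 2) : P.encode z = ∑ i ∈ P.pivots, z i • P.vec i := by
  simp [encode, LinearMap.sum_apply]

theorem encode_mem (z : S → Fin 2) : P.encode z ∈ A := by
  rw [encode_apply]
  exact A.sum_mem fun i hi => A.smul_mem _ (P.vec_mem i hi)

theorem encode_eq {a : S → Fin 2} (ha : a ∈ A) : P.encode a = a := by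
  rw [encode_apply]
  exact (P.eq_sum a ha).symm

theorem encode_apply_pivot (z : S → Fin 2) {i : S} (hi : i ∈ P.pivots) : P.encode z i = z i := by
  rw [encode_apply, Finset.sum_apply, Finset.sum_eq_single i]
  · rw [Pi.smul_apply, P.vec_apply i hi i hi, if_pos rfl, smul_eq_mul, mul_one]
  · intro j hj hji
    rw [Pi.smul_apply, P.vec_apply j hj i hi, if_neg (Ne.symm hji), smul_zero]
  · exact fun h => absurd hi h

theorem encode_single {j : S} (hj : j ∉ P.pivots) : P.encode (Pi.single j 1) = 0 := by
  rw [encode_apply]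
  refine Finset.sum_eq_zero fun i hi => ?_
  have : i ≠ j := fun h => hj (h ▸ hi)
  rw [Pi.single_eq_of_ne this, zero_smul]

/-- The bilinear form of the code. -/
def form (z w : S → Fin 2) : Fin 2 := ∑ j ∈ P.pivotsᶜ, z j * P.encode w j

theorem form_add_left (z z' w : S → Fin 2) : P.form (z + z') w = P.form z w + P.form z' w := by
  simp [form, add_mul, Finset.sum_add_distrib]

theorem form_add_right (z w w' : S → Fin 2) : P.form z (w + w') = P.form z w + P.form z w' := by
  simp [form, mul_add, Finset.sum_add_distrib]

/-- The eigenvalues of the unitary of the code. -/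
noncomputable def eigenvalue (z : S → Fin 2) : ℂ := sgn (P.form z z)

/-- The symbol of the unitary of the code. -/
noncomputable def symbol : (S → Fin 2) → ℂ := hadSymbol P.eigenvalue

/-- Polarization: a translation changes the quadratic form by a constant and an additive function.
-/
theorem eigenvalue_add (z β : S → Fin 2) : P.eigenvalue (z + β) =
    P.eigenvalue β * sgn (P.form z β + P.form β z) * P.eigenvalue z := by
  simp only [eigenvalue, form_add_left, form_add_right, sgn_add]
  ring

theorem convOp_symbol_mem_unitaryGroup : convOp P.symbol ∈ unitaryGroup (S → Fin 2) ℂ :=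
  convOp_hadSymbol_mem_unitaryGroup fun z => by rw [eigenvalue, star_sgn, sgn_mul_self]

theorem exists_dotProduct_of_add {f : (S → Fin 2) → Fin 2} (hf : ∀ a b, f (a + b) = f a + f b) :
    ∃ γ : S → Fin 2, ∀ z, f z = γ ⬝ᵥ z := by
  have h0 : f 0 = 0 := by simpa using hf 0 0
  let g : (S → Fin 2) →ₗ[Fin 2] Fin 2 :=
    { toFun := f
      map_add' := hf
      map_smul' := fun c a => by
        rcases fin2_eq_zero_or_one c with rfl | rfl
        · simp [h0]
        · simp }
  refine ⟨fun i => g (Pi.single i 1), fun z => ?_⟩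
  change g z = _
  rw [LinearMap.pi_apply_eq_sum_univ g z]
  refine Finset.sum_congr rfl fun i _ => ?_
  rw [smul_eq_mul, mul_comm]
  congr 2
  ext j : 1
  simp [Pi.single_apply, eq_comm]

theorem symbol_isQuadratic : IsQuadratic P.symbol := by
  intro β
  obtain ⟨γ, hγ⟩ := exists_dotProduct_of_add (f := fun z => P.form z β + P.form β z)
    fun a b => by rw [form_add_left, form_add_right, add_add_add_comm]
  exact ⟨γ, P.eigenvalue β, hadSymbol_mul_sgn fun z => by
    rw [eigenvalue_add, ← hγ]⟩

/-- Conjugation of `Z_j`, for a site `j` that is no pivot. -/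
theorem exists_conj_signOp {j : S} (hj : j ∉ P.pivots) : ∃ (γ : S → Fin 2) (c : ℂ), c ≠ 0 ∧
    (∀ z, P.encode z j = γ ⬝ᵥ z) ∧
    (convOp P.symbol)ᴴ * signOp (Pi.single j 1) * convOp P.symbol =
      c • (shiftOp γ * signOp (Pi.single j 1)) := by
  obtain ⟨γ, hγ⟩ := exists_dotProduct_of_add (f := fun z => P.encode z j)
    fun a b => by rw [map_add, Pi.add_apply]
  refine ⟨γ, P.eigenvalue (Pi.single j 1), sgn_ne_zero _, hγ,
    convOp_conj_signOp P.convOp_symbol_mem_unitaryGroup (hadSymbol_mul_sgn fun z => ?_)⟩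
  rw [eigenvalue_add, ← hγ]
  congr 3
  -- As `j` is no pivot, its unit vector encodes to zero, and of the two mixed terms only bit `j` of
  -- the encoding of `z` remains.
  simp only [form, P.encode_single hj, Pi.zero_apply, mul_zero, Finset.sum_const_zero, zero_add]
  rw [Finset.sum_eq_single j]
  · simp
  · intro i _ hij
    rw [Pi.single_eq_of_ne hij, zero_mul]
  · simp [hj]

/-- Hadamard gates on the sites that are no pivots. -/
noncomputable def hadOff : Matrix (S → Fin 2) (S → Fin 2) ℂ :=
  tensorOp fun i => if i ∈ P.pivots then 1 else hadGate

theorem hadOff_mem_LU : P.hadOff ∈ LU S (Fin 2) :=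
  tensorOp_mem_LU fun i => by
    split_ifs
    · exact one_mem _
    · exact hadGate_mem_unitaryGroup

/-- The bits of `z` at the pivots select the single codeword `P.encode z`, and the Hadamard gates
elsewhere contribute its pairing with `z`, which is the quadratic form. -/
theorem hadOff_mulVec_indicator : P.hadOff *ᵥ indicator A =
    (((Real.sqrt 2 : ℝ) : ℂ)⁻¹ ^ P.pivotsᶜ.card) • P.eigenvalue := by
  ext z
  change ∑ x, P.hadOff z x * indicator A x = _
  have hprod : ∀ x, P.hadOff z x = (∏ i ∈ P.pivots, if z i = x i then 1 else 0) *
      ∏ j ∈ P.pivotsᶜ, ((Real.sqrt 2 : ℝ) : ℂ)⁻¹ * sgn (z j * x j) := by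
    intro x
    rw [hadOff, tensorOp, of_apply, ← Finset.prod_mul_prod_compl P.pivots]
    congr 1
    · exact Finset.prod_congr rfl fun i hi => by rw [if_pos hi, Matrix.one_apply]
    · exact Finset.prod_congr rfl fun i hi => by
        rw [if_neg (Finset.mem_compl.1 hi), hadGate, Matrix.smul_apply, of_apply, smul_eq_mul]
  rw [Finset.sum_eq_single (P.encode z)]
  · rw [hprod, indicator, Set.indicator_of_mem (P.encode_mem z), Pi.one_apply, mul_one,
      Finset.prod_mul_distrib, Finset.prod_const, Pi.smul_apply, smul_eq_mul, ← sgn_sum,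
      Finset.prod_eq_one fun i hi => if_pos (P.encode_apply_pivot z hi).symm, one_mul]
    rfl
  · intro x _ hx
    by_cases hA : x ∈ A
    · have : ∃ i ∈ P.pivots, z i ≠ x i := by
        by_contra! h
        refine hx ?_
        rw [← P.encode_eq hA, encode_apply, encode_apply]
        exact Finset.sum_congr rfl fun i hi => by rw [h i hi]
      obtain ⟨i, hi, hne⟩ := this
      rw [hprod, Finset.prod_eq_zero hi (if_neg hne), zero_mul, zero_mul]
    · rw [indicator, Set.indicator_of_notMem (by exact hA), mul_zero]
  · simp

theorem exists_symbol_eq : ∃ V₀ ∈ LU S (Fin 2), ∃ c : ℂ,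
    P.symbol = c • (V₀ *ᵥ indicator A) := by
  have h : ((Real.sqrt 2 : ℝ) : ℂ)⁻¹ ^ P.pivotsᶜ.card ≠ 0 := by simp
  refine ⟨_, mul_mem_LU hadamardAll_mem_LU P.hadOff_mem_LU,
    hadamardScale S * (((Real.sqrt 2 : ℝ) : ℂ)⁻¹ ^ P.pivotsᶜ.card)⁻¹, ?_⟩
  rw [← mulVec_mulVec, hadOff_mulVec_indicator, mulVec_smul, smul_smul, mul_assoc,
    inv_mul_cancel₀ h, mul_one]
  rfl

theorem sum_norm_sq_symbol : ∑ x, ‖P.symbol x‖ ^ 2 = 1 := by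
  rw [← convOp_mulVec_zeroSpins P.symbol, unitary_mulVec_norm_sq P.convOp_symbol_mem_unitaryGroup,
    sum_norm_sq_zeroSpins]

theorem convOp_symbol_mem_QCcc [Nonempty S] {ℓ : ℕ} {δ : (S → Fin 2) →ₗ[Fin 2] (S → Fin 2)}
    (P : PivotData (LinearMap.range δ)) (hδ : Realizes G ℓ δ) :
    convOp P.symbol ∈ QCcc G 2 ℓ := by
  obtain ⟨V₀, hV₀, c, hc⟩ := P.exists_symbol_eq
  have := convOp_mem_QCcc (hδ.prepared hV₀ P.sum_norm_sq_symbol hc) one_mem_QC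
    (by rw [one_mulVec]; exact P.convOp_symbol_mem_unitaryGroup)
    (by rw [one_mulVec]; exact P.symbol_isQuadratic)
  rwa [one_mulVec] at this

/-- The unitary of the code prepares the uniform superposition of the codewords, up to local
unitaries. -/
theorem exists_LU_convOp_symbol [Nonempty S] {ψ : (S → Fin 2) → ℂ} (hψ : ∑ x, ‖ψ x‖ ^ 2 = 1)
    {κ : ℂ} (h : indicator A = κ • ψ) : ∃ V₀ ∈ LU S (Fin 2),
      convOp P.symbol *ᵥ zeroSpins S 2 = V₀ *ᵥ ψ := by
  obtain ⟨V₀, hV₀, c, hc⟩ := P.exists_symbol_eq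
  rw [h, mulVec_smul, smul_smul] at hc
  refine ⟨(c * κ) • V₀, smul_mem_LU hV₀ ?_, ?_⟩
  -- Both vectors are normalized, so the scalar has modulus one and can be absorbed into the local
  -- unitary.
  · have h1 := P.sum_norm_sq_symbol
    simp only [hc, Pi.smul_apply, smul_eq_mul, norm_mul _ ((V₀ *ᵥ ψ) _), mul_pow] at h1
    rw [← Finset.mul_sum, unitary_mulVec_norm_sq (LU_subset_unitaryGroup hV₀), hψ, mul_one] at h1
    have h2 := Complex.mul_conj' (c * κ)
    rw [← Complex.ofReal_pow, h1] at h2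
    simpa using h2
  · rw [convOp_mulVec_zeroSpins, hc, smul_mulVec]

end PivotData

end CodeUnitary

section Toric

attribute [local instance] fin2CommRing

/-! ### The chess board -/

variable {N : ℕ} [NeZero N]

/-- The unit vectors of the square lattice. -/
def unitVec (N : ℕ) [NeZero N] (k : Fin 2) : Site 2 N := Pi.single k 1

/-- The even sites. -/
def EvenSite (v : Site 2 N) : Prop := Even ((v 0 : ℕ) + (v 1 : ℕ))

instance (v : Site 2 N) : Decidable (EvenSite v) :=
  inferInstanceAs (Decidable (Even ((v 0 : ℕ) + (v 1 : ℕ))))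

theorem even_fin_add_one (hN : Even N) (u : Fin N) :
    Even ((u + 1 : Fin N) : ℕ) ↔ ¬Even (u : ℕ) := by
  rw [fin_val_add_one]
  split_ifs with h
  · rw [← h] at hN
    have := Nat.even_add_one.1 hN
    simp [this]
  · exact Nat.even_add_one

/-- The colouring is consistent across the periodic boundary because N is even. -/
theorem evenSite_add_unitVec (hN : Even N) (v : Site 2 N) (k : Fin 2) :
    EvenSite (v + unitVec N k) ↔ ¬EvenSite v := by
  unfold EvenSite unitVec
  fin_cases k
  · simp only [Fin.zero_eta, Pi.add_apply, Pi.single_eq_same, ne_eq, one_ne_zero,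
      not_false_eq_true, Pi.single_eq_of_ne, add_zero, Nat.even_add, even_fin_add_one hN]
    tauto
  · simp only [Fin.mk_one, Pi.add_apply, Pi.single_eq_same, ne_eq, zero_ne_one,
      not_false_eq_true, Pi.single_eq_of_ne, add_zero, Nat.even_add, even_fin_add_one hN]
    tauto

theorem evenSite_sub_unitVec (hN : Even N) (v : Site 2 N) (k : Fin 2) :
    EvenSite (v - unitVec N k) ↔ ¬EvenSite v := by
  have := evenSite_add_unitVec hN (v - unitVec N k) k
  rw [sub_add_cancel] at this
  tauto

theorem unitVec_ne_zero (hN : Even N) (k : Fin 2) : unitVec N k ≠ 0 := by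
  intro h
  have := evenSite_add_unitVec hN 0 k
  rw [h, add_zero] at this
  tauto

theorem adj_sub_unitVec (hN : Even N) (v : Site 2 N) (k : Fin 2) :
    (lattice Boundary.periodic 2 N).Adj (v - unitVec N k) v := by
  refine (SimpleGraph.fromRel_adj _ _ _).2 ⟨fun h => ?_, Or.inl ⟨k, (sub_add_cancel _ _).symm⟩⟩
  have := evenSite_sub_unitVec hN v k
  rw [h] at this
  tauto

/-! ### The boundary map of the plaquettes -/

/-- The plaquettes of type A, represented by their upper-left corners, are mapped to the sums of
their vertices. -/
def plaquetteMap (N : ℕ) [NeZero N] :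
    (Site 2 N → Fin 2) →ₗ[Fin 2] (Site 2 N → Fin 2) where
  toFun a u := if EvenSite u then a u + a (u - unitVec N 1 - unitVec N 0)
    else a (u - unitVec N 0) + a (u - unitVec N 1)
  map_add' a b := by
    ext u : 1
    simp only [Pi.add_apply]
    split_ifs <;> exact add_add_add_comm _ _ _ _
  map_smul' c a := by
    ext u : 1
    simp only [Pi.smul_apply, smul_eq_mul, RingHom.id_apply]
    split_ifs <;> rw [mul_add]

theorem plaquetteMap_apply (a : Site 2 N → Fin 2) (u : Site 2 N) :
    plaquetteMap N a u = if EvenSite u then a u + a (u - unitVec N 1 - unitVec N 0)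
      else a (u - unitVec N 0) + a (u - unitVec N 1) := rfl

/-- The far corner of a plaquette is not adjacent to the site of its ancilla, so the bit is relayed
through an odd site: CNOTs from this site before and after the bit is added to it cancel its old
content. One more layer serves the remaining odd corners; the own corner is local. -/
theorem realizes_plaquetteMap (hN : Even N) :
    Realizes (lattice Boundary.periodic 2 N) 4 (plaquetteMap N) := by
  intro n Φ h
  have hodd : ∀ k, ∀ t ∈ Finset.univ.filter (fun u : Site 2 N => ¬EvenSite u),
      t - unitVec N k ∉ Finset.univ.filter (fun u : Site 2 N => ¬EvenSite u) := by
    intro k t ht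
    simpa [evenSite_sub_unitVec hN] using ht
  have heven : ∀ k, ∀ t ∈ Finset.univ.filter (fun u : Site 2 N => EvenSite u),
      t - unitVec N k ∉ Finset.univ.filter (fun u : Site 2 N => EvenSite u) := by
    intro k t ht
    simpa [evenSite_sub_unitVec hN] using ht
  have hinj : ∀ k, ∀ T : Finset (Site 2 N), Set.InjOn (fun u => u - unitVec N k) T :=
    fun k T => (sub_left_injective).injOn
  have h1 := h.addFrom_spin (fun t _ => adj_sub_unitVec hN t 1) (heven 1) (hinj 1 _)
  have h2 := h1.addFrom_ancilla (fun t _ => adj_sub_unitVec hN t 0) (hodd 0) (hinj 0 _)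
  have h3 := h2.addFrom_spin (fun t _ => adj_sub_unitVec hN t 1) (heven 1) (hinj 1 _)
  have h4 := h3.addFrom_ancilla (fun t _ => adj_sub_unitVec hN t 1) (hodd 1) (hinj 1 _)
  have h5 := h4.addFrom_own (Finset.univ.filter fun u : Site 2 N => EvenSite u)
  convert h5 using 2
  ext x a
  congr 1
  ext u : 1
  rw [Pi.add_apply, plaquetteMap_apply]
  simp only [addFrom, Finset.mem_filter, Finset.mem_univ, true_and, id, evenSite_sub_unitVec hN]
  by_cases hu : EvenSite u
  · simp only [hu, if_true, not_true, not_false_eq_true, if_false]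
    generalize x u = p
    generalize a u = q
    generalize x (u - unitVec N 1) = r
    generalize a (u - unitVec N 1 - unitVec N 0) = s
    generalize a (u - unitVec N 1 - unitVec N 1) = t
    revert p q r s t
    decide
  · simp only [hu, if_true, not_false_eq_true, if_false]
    generalize x u = p
    generalize a (u - unitVec N 0) = q
    generalize a (u - unitVec N 1) = r
    revert p q r
    decide

theorem plaquette_eq (v : Site 2 N) :
    plaquette v = {v, v + unitVec N 0, v + unitVec N 1, v + unitVec N 0 + unitVec N 1} := rfl

theorem mem_plaquettesA {v : Site 2 N} : v ∈ plaquettesA N ↔ EvenSite v := by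
  simp [plaquettesA, EvenSite]

theorem unitVec_ne (hN : Even N) : unitVec N 0 ≠ unitVec N 1 := by
  intro h
  have h1 := congrFun h 0
  have h2 := unitVec_ne_zero hN 0
  refine h2 (funext fun m => ?_)
  fin_cases m
  · simpa [unitVec] using h1
  · simp [unitVec]

theorem unitVec_add_ne_zero (hN : Even N) : unitVec N 0 + unitVec N 1 ≠ 0 := by
  intro h
  refine unitVec_ne_zero hN 0 (funext fun m => ?_)
  have := congrFun h 0
  fin_cases m
  · simpa [unitVec] using this
  · simp [unitVec]

theorem plaquetteMap_single_even (hN : Even N) {p : Site 2 N} (hp : EvenSite p) :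
    plaquetteMap N (Pi.single p 1) = onesOn (plaquette p) := by
  ext u : 1
  rw [plaquetteMap_apply, onesOn, plaquette_eq]
  simp only [Pi.single_apply, Finset.mem_insert, Finset.mem_singleton, sub_eq_iff_eq_add]
  have hcomm : p + unitVec N 0 + unitVec N 1 = p + (unitVec N 0 + unitVec N 1) := add_assoc _ _ _
  by_cases hu : EvenSite u
  · have h0 : u ≠ p + unitVec N 0 := by
      rintro rfl
      exact (evenSite_add_unitVec hN p 0).1 hu hp
    have h1 : u ≠ p + unitVec N 1 := by
      rintro rfl
      exact (evenSite_add_unitVec hN p 1).1 hu hp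
    have h2 : ¬(u = p ∧ u = p + unitVec N 0 + unitVec N 1) := by
      rintro ⟨rfl, h⟩
      rw [hcomm] at h
      exact unitVec_add_ne_zero hN (by simpa using h)
    by_cases h3 : u = p <;> by_cases h4 : u = p + unitVec N 0 + unitVec N 1 <;>
      simp_all
  · have h0 : u ≠ p := by
      rintro rfl
      exact hu hp
    have h1 : u ≠ p + unitVec N 0 + unitVec N 1 := by
      rintro rfl
      rw [evenSite_add_unitVec hN, evenSite_add_unitVec hN] at hu
      tauto
    have h2 : ¬(u = p + unitVec N 0 ∧ u = p + unitVec N 1) := by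
      rintro ⟨rfl, h⟩
      exact unitVec_ne hN (by simpa using h)
    by_cases h3 : u = p + unitVec N 0 <;> by_cases h4 : u = p + unitVec N 1 <;>
      simp_all

theorem plaquetteMap_single_odd (hN : Even N) {p : Site 2 N} (hp : ¬EvenSite p) :
    plaquetteMap N (Pi.single p 1) = 0 := by
  ext u : 1
  rw [plaquetteMap_apply]
  simp only [Pi.single_apply, sub_eq_iff_eq_add, Pi.zero_apply]
  by_cases hu : EvenSite u
  · have h0 : u ≠ p := by
      rintro rfl
      exact hp hu
    have h1 : u ≠ p + unitVec N 0 + unitVec N 1 := by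
      rintro rfl
      rw [evenSite_add_unitVec hN, evenSite_add_unitVec hN] at hu
      tauto
    simp [hu, h0, h1]
  · have h0 : u ≠ p + unitVec N 0 := by
      rintro rfl
      exact hu ((evenSite_add_unitVec hN p 0).2 hp)
    have h1 : u ≠ p + unitVec N 1 := by
      rintro rfl
      exact hu ((evenSite_add_unitVec hN p 1).2 hp)
    simp [hu, h0, h1]

theorem range_plaquetteMap (hN : Even N) : LinearMap.range (plaquetteMap N) =
    Submodule.span (Fin 2) {x | ∃ p ∈ (plaquettesA N).toList, x = onesOn (plaquette p)} := by
  apply le_antisymm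
  · rintro _ ⟨a, rfl⟩
    rw [LinearMap.pi_apply_eq_sum_univ]
    refine Submodule.sum_mem _ fun p _ => Submodule.smul_mem _ _ ?_
    have : (fun j => if p = j then 1 else 0) = (Pi.single p 1 : Site 2 N → Fin 2) := by
      ext j : 1
      simp [Pi.single_apply, eq_comm]
    rw [this]
    by_cases hp : EvenSite p
    · rw [plaquetteMap_single_even hN hp]
      exact Submodule.subset_span ⟨p, by simpa [mem_plaquettesA] using hp, rfl⟩
    · rw [plaquetteMap_single_odd hN hp]
      exact zero_mem _
  · rw [Submodule.span_le]
    rintro _ ⟨p, hp, rfl⟩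
    refine ⟨Pi.single p 1, plaquetteMap_single_even hN ?_⟩
    simpa [mem_plaquettesA] using hp

/-! ### The toric-code state -/

/-- A factor 1 + X^γ doubles the indicator of a subspace that contains γ, and otherwise adds the
indicator of the disjoint coset by γ. -/
theorem prod_one_add_shiftOp_mulVec {S : Type} [Fintype S] [DecidableEq S]
    (L : List (S → Fin 2)) : ∃ κ : ℂ, κ ≠ 0 ∧
      (L.map fun γ => 1 + shiftOp γ).prod *ᵥ zeroSpins S 2 =
        κ • indicator (Submodule.span (Fin 2) {x | x ∈ L}) := by
  induction L with
  | nil =>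
    refine ⟨1, one_ne_zero, ?_⟩
    rw [List.map_nil, List.prod_nil, one_mulVec, one_smul]
    ext x
    simp only [List.not_mem_nil, indicator, zeroSpins]
    rw [show {x : S → Fin 2 | False} = ∅ from rfl, Submodule.span_empty]
    by_cases hx : x = 0
    · subst hx
      simp
    · rw [Set.indicator_of_notMem (by simpa using hx), if_neg]
      exact fun h => hx (funext h)
  | cons γ L ih =>
    obtain ⟨κ, hκ, h⟩ := ih
    set B := Submodule.span (Fin 2) {x | x ∈ L} with hB
    have hspan : Submodule.span (Fin 2) {x | x ∈ γ :: L} =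
        Submodule.span (Fin 2) (insert γ {x | x ∈ L}) := by
      congr 1
      ext x
      simp
    have hmem : ∀ x, x ∈ Submodule.span (Fin 2) {x | x ∈ γ :: L} ↔ x ∈ B ∨ x + γ ∈ B := by
      intro x
      rw [hspan, Submodule.mem_span_insert]
      constructor
      · rintro ⟨a, z, hz, rfl⟩
        rcases fin2_eq_zero_or_one a with rfl | rfl
        · left; simpa using hz
        · right
          rw [one_smul, add_right_comm, fin2_pi_add_self, zero_add]
          exact hz
      · rintro (hx | hx)
        · exact ⟨0, x, hx, by simp⟩
        · exact ⟨1, _, hx, by rw [one_smul, add_left_comm, fin2_pi_add_self, add_zero]⟩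
    have hval : ∀ x, ((1 + shiftOp γ) *ᵥ indicator B) x = indicator B x + indicator B (x + γ) := by
      intro x
      rw [add_mulVec, one_mulVec, shiftOp, compOp_mulVec]
      rfl
    rw [List.map_cons, List.prod_cons, ← mulVec_mulVec, h, mulVec_smul]
    have hind : ∀ (C : Submodule (Fin 2) (S → Fin 2)) x, x ∈ C → indicator C x = 1 := fun C x hx =>
      Set.indicator_of_mem (by exact hx) _
    have hind' : ∀ (C : Submodule (Fin 2) (S → Fin 2)) x, x ∉ C → indicator C x = 0 := fun C x hx =>
      Set.indicator_of_notMem (by exact hx) _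
    by_cases hγ : γ ∈ B
    · refine ⟨κ * 2, mul_ne_zero hκ two_ne_zero, ?_⟩
      rw [mul_smul]
      congr 1
      ext x
      rw [hval, Pi.smul_apply, smul_eq_mul]
      have hiff : x + γ ∈ B ↔ x ∈ B := B.add_mem_iff_left hγ
      by_cases hx : x ∈ B
      · rw [hind _ _ hx, hind _ _ (hiff.2 hx), hind _ _ ((hmem x).2 (Or.inl hx))]
        norm_num
      · rw [hind' _ _ hx, hind' _ _ (mt hiff.1 hx), hind' _ _ (mt (hmem x).1 (not_or.2
          ⟨hx, mt hiff.1 hx⟩))]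
        norm_num
    · refine ⟨κ, hκ, ?_⟩
      congr 1
      ext x
      rw [hval]
      by_cases hx : x ∈ B
      · have hx' : x + γ ∉ B := fun h => hγ ((B.add_mem_iff_right hx).1 h)
        rw [hind _ _ hx, hind' _ _ hx', hind _ _ ((hmem x).2 (Or.inl hx)), add_zero]
      · by_cases hx' : x + γ ∈ B
        · rw [hind' _ _ hx, hind _ _ hx', hind _ _ ((hmem x).2 (Or.inr hx')), zero_add]
        · rw [hind' _ _ hx, hind' _ _ hx', hind' _ _ (mt (hmem x).1 (not_or.2 ⟨hx, hx'⟩)), zero_add]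

theorem exists_toricVec_eq (hN : Even N) : ∃ κ : ℂ, κ ≠ 0 ∧
    toricVec N = κ • indicator (LinearMap.range (plaquetteMap N)) := by
  obtain ⟨κ, hκ, h⟩ := prod_one_add_shiftOp_mulVec
    ((plaquettesA N).toList.map fun p => onesOn (plaquette p))
  refine ⟨κ, hκ, ?_⟩
  have h1 : (fun p : Site 2 N => 1 + plaquetteX p) =
      fun p => 1 + shiftOp (onesOn (plaquette p)) := by
    ext p : 1
    rw [plaquetteX, pauliString_shift]
    rfl
  have h2 : {x | x ∈ (plaquettesA N).toList.map fun p => onesOn (plaquette p)} =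
      {x | ∃ p ∈ (plaquettesA N).toList, x = onesOn (plaquette p)} := by
    ext x
    simp only [Set.mem_ofPred_eq, List.mem_map, eq_comm]
  rw [List.map_map, h2] at h
  rw [toricVec, h1, range_plaquetteMap hN]
  exact h

theorem toricVec_norm_pos (hN : Even N) : 0 < ∑ x, ‖toricVec N x‖ ^ 2 := by
  obtain ⟨κ, hκ, h⟩ := exists_toricVec_eq hN
  refine Finset.sum_pos' (fun x _ => by positivity) ⟨0, Finset.mem_univ _, ?_⟩
  rw [h, Pi.smul_apply, indicator, Set.indicator_of_mem (by exact zero_mem _)]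
  simpa using pow_pos (norm_pos_iff.2 hκ) 2

theorem sum_norm_sq_toricCode (hN : Even N) : ∑ x, ‖toricCode N x‖ ^ 2 = 1 := by
  have h := toricVec_norm_pos hN
  simp only [toricCode, Pi.smul_apply, smul_eq_mul, norm_mul, mul_pow, ← Finset.mul_sum, norm_inv,
    Complex.norm_real, Real.norm_eq_abs, inv_pow, sq_abs]
  rw [Real.sq_sqrt h.le, inv_mul_cancel₀ h.ne']

theorem exists_indicator_eq_toricCode (hN : Even N) : ∃ κ : ℂ,
    indicator (LinearMap.range (plaquetteMap N)) = κ • toricCode N := by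
  obtain ⟨κ, hκ, h⟩ := exists_toricVec_eq hN
  have hr : ((Real.sqrt (∑ x, ‖toricVec N x‖ ^ 2) : ℝ) : ℂ) ≠ 0 := by
    rw [Complex.ofReal_ne_zero]
    exact (Real.sqrt_pos.2 (toricVec_norm_pos hN)).ne'
  refine ⟨κ⁻¹ * ((Real.sqrt (∑ x, ‖toricVec N x‖ ^ 2) : ℝ) : ℂ), ?_⟩
  rw [toricCode, smul_smul, mul_assoc, mul_inv_cancel₀ hr, mul_one, h, smul_smul,
    inv_mul_cancel₀ hκ, one_smul]

/-! ### Loops -/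

/-- The sites with a given value of a coordinate. -/
def lineOn (k : Fin 2) (c : Fin N) : Site 2 N → Fin 2 := fun v => if v k = c then 1 else 0

theorem lineOn_add_mem_range (c : Fin N) :
    lineOn 0 (c + 1) + lineOn 0 c ∈ LinearMap.range (plaquetteMap N) := by
  -- The plaquettes of type A in the strip between two adjacent parallel lines cover each site of
  -- these lines once.
  refine ⟨lineOn 0 c, ?_⟩
  ext u : 1
  rw [plaquetteMap_apply, Pi.add_apply]
  simp only [lineOn, unitVec, Pi.sub_apply, Pi.single_eq_same, ne_eq, zero_ne_one,
    not_false_eq_true, Pi.single_eq_of_ne, sub_zero, sub_eq_iff_eq_add]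
  split_ifs <;> rfl

theorem lineOn_add_zero_mem_range (c : Fin N) :
    lineOn 0 c + lineOn 0 0 ∈ LinearMap.range (plaquetteMap N) := by
  obtain ⟨n, hn⟩ := c
  induction n with
  | zero =>
    rw [show (⟨0, hn⟩ : Fin N) = 0 from Fin.ext (by simp), fin2_pi_add_self]
    exact zero_mem _
  | succ n ih =>
    have h1 : (⟨n + 1, hn⟩ : Fin N) = ⟨n, by omega⟩ + 1 := by
      apply Fin.ext
      rw [fin_val_add_one, if_neg (by dsimp only; omega)]
    have h2 := add_mem (lineOn_add_mem_range ⟨n, by omega⟩) (ih (by omega))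
    rw [add_assoc, ← add_assoc (lineOn 0 _) (lineOn 0 _) (lineOn 0 0), fin2_pi_add_self, zero_add,
      ← h1] at h2
    exact h2

/-- A plaquette meets a row in sites that pair up under a step along the row. -/
theorem row_dotProduct_eq_zero (hN : Even N) {a : Site 2 N → Fin 2}
    (ha : a ∈ LinearMap.range (plaquetteMap N)) : lineOn 1 0 ⬝ᵥ a = 0 := by
  rw [range_plaquetteMap hN] at ha
  induction ha using Submodule.span_induction with
  | mem x hx =>
    obtain ⟨p, hp, rfl⟩ := hx
    have h1 : lineOn 1 0 ⬝ᵥ onesOn (plaquette p) = ∑ u ∈ plaquette p, lineOn 1 0 u := by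
      simp only [dotProduct, onesOn, mul_ite, mul_one, mul_zero]
      rw [Finset.sum_ite_mem, Finset.univ_inter]
    have e0 := unitVec_ne_zero hN 0
    have e1 := unitVec_ne_zero hN 1
    have e01 := unitVec_ne hN
    have e2 := unitVec_add_ne_zero hN
    have h2 : ∀ v : Site 2 N, lineOn 1 0 (v + unitVec N 0) = lineOn 1 0 v := by
      intro v
      simp [lineOn, unitVec]
    rw [h1, plaquette_eq, add_right_comm p, Finset.sum_insert, Finset.sum_insert,
      Finset.sum_insert, Finset.sum_singleton, h2, h2, fin2_add_self, add_zero, fin2_add_self]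
    · simpa using e0
    · simp only [Finset.mem_insert, Finset.mem_singleton, not_or]
      refine ⟨by simpa using e01, fun h => e1 ?_⟩
      rw [add_right_comm] at h
      simpa using h
    · simp only [Finset.mem_insert, Finset.mem_singleton, not_or]
      refine ⟨by simpa using e0, by simpa using e1, fun h => e2 ?_⟩
      rw [add_assoc] at h
      rw [add_comm]
      simpa using h
  | zero => exact dotProduct_zero _
  | add x y _ _ hx hy => rw [dotProduct_add, hx, hy, add_zero]
  | smul c x _ hx => rw [dotProduct_smul, hx, smul_zero]

theorem row_dotProduct_column : lineOn 1 0 ⬝ᵥ lineOn 0 (0 : Fin N) = 1 := by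
  rw [dotProduct, Finset.sum_eq_single 0]
  · simp [lineOn]
  · intro v _ hv
    have : ¬(v 1 = 0 ∧ v 0 = 0) := fun h => hv (funext fun m => by
      fin_cases m
      · exact h.2
      · exact h.1)
    simp only [lineOn, mul_ite, mul_one, mul_zero]
    split_ifs <;> tauto
  · simp

/-- The unitary of the toric code is not a circuit of small depth. -/
theorem convOp_symbol_notMem_QC (hN : Even N)
    (P : PivotData (LinearMap.range (plaquetteMap N))) {ℓ : ℕ} (hℓ : 4 * ℓ < N) :
    convOp P.symbol ∉ QC (lattice Boundary.periodic 2 N) 2 ℓ := by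
  intro hU
  obtain ⟨M, hM⟩ := hN
  have hN : Even N := ⟨M, hM⟩
  have hNpos : 0 < N := Nat.pos_of_ne_zero (NeZero.ne N)
  -- Pivot bits are fixed anyway. At any other site the encoding depends only on nearby bits if the
  -- circuit is shallow, and the line can be moved far away by adding a codeword.
  have hfix : P.encode (lineOn 0 0) = lineOn 0 0 := by
    ext j : 1
    by_cases hj : j ∈ P.pivots
    · exact P.encode_apply_pivot _ hj
    · obtain ⟨γ, c, hc, hγ, hconj⟩ := P.exists_conj_signOp hj
      -- The line with coordinate `-s` is antipodal to `j`, at distance M = N/2.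
      set s : Fin N := ⟨M, by omega⟩ - j 0 with hs
      set w : Fin 2 → ℕ := ![1, 0] with hw
      have hw1 : ∀ k, w k ≤ 1 := by
        intro k
        fin_cases k <;> simp [hw]
      set f : Site 2 N → ℕ := fun v => ∑ m, w m * cycleDist (v m + s) with hf
      have hfv : ∀ v, f v = cycleDist (v 0 + s) := by
        intro v
        simp [hf, hw, Fin.sum_univ_two]
      have hjs : j 0 + s = ⟨M, by omega⟩ := by rw [hs, add_sub_cancel]
      have hfj : 1 + ℓ ≤ f j := by
        rw [hfv, hjs, cycleDist]
        dsimp only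
        omega
      have hcone := QC_conj_mem_localAlg (m := 1) (f := f)
        (fun _ _ => lattice_periodic_lipschitz (fun _ => s) w hw1) hU
        (twoSite_mem_localAlg (R := {x | 1 + ℓ ≤ f x}) hfj hfj (diagonal fun p => sgn p.1))
      rw [← signOp_single, hconj] at hcone
      have hmiss : ∀ y : Site 2 N, y 0 = -s → γ y = 0 := by
        intro y hy
        refine shift_eq_zero_of_mem_localAlg hc hcone ?_
        rw [Set.mem_ofPred_eq, hfv, hy, neg_add_cancel]
        simp [cycleDist]
      have hzero : P.encode (lineOn 0 (-s)) j = 0 := by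
        rw [hγ, dotProduct]
        refine Finset.sum_eq_zero fun y _ => ?_
        by_cases hy : y 0 = -s
        · rw [hmiss y hy, zero_mul]
        · rw [lineOn, if_neg hy, mul_zero]
      have hjline : lineOn 0 (-s) j = 0 := by
        rw [lineOn, if_neg]
        intro h
        rw [h, neg_add_cancel] at hjs
        have := congrArg Fin.val hjs
        simp only [Fin.val_zero] at this
        omega
      -- The two parallel lines differ by a codeword, which encoding fixes; at `j` the far line
      -- contributes zero before and after encoding.
      have hcode := congrFun (P.encode_eq (lineOn_add_zero_mem_range (-s))) j
      rw [map_add, Pi.add_apply, Pi.add_apply, hzero, hjline, zero_add, zero_add] at hcode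
      exact hcode
  have hmem := P.encode_mem (lineOn 0 0)
  rw [hfix] at hmem
  have h0 := row_dotProduct_eq_zero hN hmem
  rw [row_dotProduct_column] at h0
  exact absurd h0 (by decide)

/-- The unitary of the toric code. -/
theorem exists_toricCode_unitary (hN : Even N) :
    ∃ U : Matrix (Site 2 N → Fin 2) (Site 2 N → Fin 2) ℂ,
      IsClifford U ∧ U ∈ QCcc (lattice Boundary.periodic 2 N) 2 16 ∧
      (∃ V₀ ∈ LU (Site 2 N) (Fin 2),
        U *ᵥ zeroSpins (Site 2 N) 2 = V₀ *ᵥ toricCode N) ∧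
      ∀ ℓ : ℕ, 4 * ℓ < N → U ∉ QC (lattice Boundary.periodic 2 N) 2 ℓ := by
  obtain ⟨P⟩ := nonempty_pivotData (LinearMap.range (plaquetteMap N))
  obtain ⟨κ, hκ⟩ := exists_indicator_eq_toricCode hN
  exact ⟨convOp P.symbol,
    convOp_isClifford P.convOp_symbol_mem_unitaryGroup P.symbol_isQuadratic,
    -- The construction has depth 4; the bound 16 follows by padding.
    QCcc_mono (by omega) (PivotData.convOp_symbol_mem_QCcc P (realizes_plaquetteMap hN)),
    P.exists_LU_convOp_symbol (sum_norm_sq_toricCode hN) hκ,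
    fun ℓ hℓ => convOp_symbol_notMem_QC hN P hℓ⟩

end Toric

theorem mainTheorem8 :
    -- the inclusion, for qudits on every lattice
    (∀ (b : Boundary) (D N : ℕ) [NeZero N] (d : ℕ) [NeZero d] (ℓ : ℕ),
      QC (lattice b D N) d ℓ ⊆ QCcc (lattice b D N) d ℓ) ∧
    -- the GHZ unitary is a Clifford operator implemented with depth 2
    (∀ (b : Boundary) (D N : ℕ) [NeZero N], 1 ≤ D →
      IsClifford (UGHZ (Site D N)) ∧ UGHZ (Site D N) ∈ QCcc (lattice b D N) 2 2) ∧
    -- it is not a circuit of small depth, and the inclusion is strict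
    (∀ (b : Boundary) (D N : ℕ) [NeZero N] (ℓ : ℕ),
      ((2 ≤ D ∧ ℓ < N) ∨ (D = 1 ∧ b = Boundary.free ∧ ℓ + 1 < N) ∨
        (D = 1 ∧ b = Boundary.periodic ∧ 2 * ℓ < N)) →
      UGHZ (Site D N) ∉ QC (lattice b D N) 2 ℓ ∧
        QC (lattice b D N) 2 ℓ ⊂ QCcc (lattice b D N) 2 ℓ) ∧
    -- the toric-code unitary
    (∀ (N : ℕ) [NeZero N], Even N →
      ∃ U : Matrix (Site 2 N → Fin 2) (Site 2 N → Fin 2) ℂ,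
        IsClifford U ∧
        U ∈ QCcc (lattice Boundary.periodic 2 N) 2 16 ∧
        (∃ V₀ ∈ LU (Site 2 N) (Fin 2),
          U *ᵥ zeroSpins (Site 2 N) 2 = V₀ *ᵥ toricCode N) ∧
        ∀ ℓ : ℕ, 4 * ℓ < N → U ∉ QC (lattice Boundary.periodic 2 N) 2 ℓ) := by
  refine ⟨fun b D N _ d _ ℓ => QC_subset_QCcc ℓ,
    fun b D N _ _ => ⟨UGHZ_isClifford _, UGHZ_mem_QCcc b D N⟩,
    fun b D N _ ℓ h => ⟨UGHZ_notMem_QC b D N ℓ h, QC_ssubset_QCcc b D N ℓ h⟩,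
    fun N _ hN => exists_toricCode_unitary hN⟩
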